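/- For a finite simple graph $G=(V,E)$, $\beta>1$ and $z\in\mathbb C$, let $$Z_G(\beta,z)=\sum_{\sigma:V\to\{+,-\}}\beta^{\#\{uv\in E:\ \sigma_u=\sigma_v\}}\,z^{\#\{v\in V:\ \sigma_v=+\}}$$ be the partition function of the ferromagnetic Ising model. For $e\in E$ let $P_{G,e}(z)=Z_{G-e}(\beta,z)/Z_G(\beta,z)$ be the edge-deletion ratio, and for $f$ analytic at $0$ let $f^{[k]}$ be its Taylor polynomial of degree $k$ at $0$. Algorithms are deterministic programs (assignments, conditionals, while loops) over arrays of natural numbers, with addition, truncated subtraction and comparison, and arrays of complex numbers, with the field operations and comparison of real parts. Every operation has unit cost and all constants in a program are integers. The input is $|V|$, $|E|$, a list $e_1,\dots,e_m$ of the edges of $G$ with vertex set $\{0,\dots,n-1\}$, the numbers $\beta,\lambda$ and the accuracy $\varepsilon$. **Theorem.** Fix $\beta>1$ and $\lambda\in\mathbb C$ with $|\lambda|<1$. There are a deterministic algorithm, a constant $C$ and a function $k=k(m,\varepsilon)\in\mathbb N$ with $k(m,\varepsilon)\le C(1+\log(m/\varepsilon))$ for $m\ge1$ and $k(0,\varepsilon)\le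 C$, all depending only on $\beta$ and $\lambda$, such that for every graph $G$ with $n$ vertices, $m$ edges $e_1,\dots,e_m$ (listed in any order) and maximum degree $\Delta$, and for every $\varepsilon\in(0,1)$, the following holds. 1. $Z_G(\beta,\lambda)\ne0$, and the algorithm halts with an output $\hat Z$ such that $$\left|\frac{Z_G(\beta,\lambda)-\hat Z}{Z_G(\beta,\lambda)}\right|\le\varepsilon .$$ 2. If $\Delta\ge2$ and $G$ has no isolated vertices, the running time is at most $(m/\varepsilon)^{C\log\Delta}$. For every $G$ it is at most $C\bigl(n+(m/\varepsilon)^{C\log(\Delta+1)}\bigr)$, where $0^0=1$. 3. With $G_i=(V,\{e_1,\dots,e_i\})$, the output is the telescoping product of truncated edge-deletion ratios $$\hat Z=(1+\lambda)^{n}\prod_{i=1}^m\frac1{P_{G_i,e_i}^{[k]}(\lambda)},\qquad k=k(m,\varepsilon).$$ 4. For every $i$, with $e_i=uv$ and $H=G_i$, the polynomial $P_{H,e_i}^{[k]}$ is the truncation to degree $k$ of the power series $$1-\Bigl(1-\frac1\beta\Bigr)\frac{ab+1}{ab+1+b+c},$$ where $a,b,c$ are the following ratios on self-avoiding walk trees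 of depth $k$: at $v$ with $u$ pinned to $+$, at $u$ with $v$ pinned to $-$, and at $v$ with $u$ pinned to $-$. Here the ratio $R_j(w)\in\mathbb C[[X]]$ of a walk $w$ with $j$ remaining levels is $R_0(w)=0$ and $$R_{j+1}(w)=X\prod_{w'}\frac{\beta R_j(w')+1}{R_j(w')+\beta},$$ the product running over the extensions $w'=wy$ of $w$ to a neighbour $y$ of its last vertex $x$, other than the step back. The factor is $\beta$ (spin $+$) or $1/\beta$ (spin $-$) according to the pinned spin if $y$ is the pinned vertex. If $y$ already lies on $w$, the factor is $\beta$ when $x$ is smaller than the vertex to which $w$ moved from $y$, and $1/\beta$ otherwise. The ratio at a vertex is $R_k$ of the walk consisting of that vertex. -/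

import Mathlib

/-! ### The Ising model -/

open Classical in
/-- The weight of `σ : V → Bool` (`true` is the spin `+`): a factor `β` for every edge whose
endpoints have the same spin, and a factor `z` for every vertex with spin `+`. -/
noncomputable def isingWeight {V : Type*} [Fintype V] (G : SimpleGraph V) (β : ℝ) (z : ℂ)
    (σ : V → Bool) : ℂ :=
  (∏ e ∈ G.edgeFinset, if (e.map σ).IsDiag then (β : ℂ) else 1) *
    ∏ v : V, if σ v = true then z else 1

open Classical in
/-- The partition function `Z_G(β, z)` of the Ising model on `G`. -/
noncomputable def isingZ {V : Type*} [Fintype V] (G : SimpleGraph V) (β : ℝ) (z : ℂ) : ℂ :=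
  ∑ σ : V → Bool, isingWeight G β z σ

/-- The edge-deletion ratio `P_{G,e}(z) = Z_{G-e}(β, z) / Z_G(β, z)`. -/
noncomputable def edgeRatio {V : Type*} [Fintype V] (G : SimpleGraph V) (β : ℝ) (e : Sym2 V)
    (z : ℂ) : ℂ :=
  isingZ (G.deleteEdges {e}) β z / isingZ G β z

/-- The Taylor polynomial of `f` at `0` of degree `k`. -/
noncomputable def taylorPoly (f : ℂ → ℂ) (k : ℕ) : Polynomial ℂ :=
  ∑ j ∈ Finset.range (k + 1),
    Polynomial.C (iteratedDeriv j f 0 / (j.factorial : ℂ)) * Polynomial.X ^ j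

/-! ### Edge lists -/

/-- `L` lists every edge of `G` exactly once (each in one of its two orientations). -/
def IsEdgeList {V : Type*} (G : SimpleGraph V) (L : List (V × V)) : Prop :=
  (L.map fun p => s(p.1, p.2)).Nodup ∧
    ∀ e : Sym2 V, e ∈ L.map (fun p => s(p.1, p.2)) ↔ e ∈ G.edgeSet

/-- The graph whose edges are the first `i` pairs of `L`. -/
def prefixGraph {V : Type*} (L : List (V × V)) (i : ℕ) : SimpleGraph V :=
  SimpleGraph.fromEdgeSet {e | e ∈ (L.take i).map fun p => s(p.1, p.2)}

/-! ### The recursion on the self-avoiding walk tree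

A node of the tree is a walk, written as the list of its vertices with the most recent one first.
The vertex `u` of the graph is pinned to the spin `s`. -/

/-- The vertex to which the walk moved when it left its vertex `w` (for a list of vertices with
the most recent one first). -/
def stepAfter {V : Type*} [DecidableEq V] (w : V) : List V → V
  | [] => w
  | [x] => x
  | x :: y :: l => if y = w then x else stepAfter w (y :: l)

open Classical in
/-- The recursion for the marginal ratio on the self-avoiding walk tree of `G` (with `u` pinned to
`s`), as a power series in the field, at the node given by the walk, cut off `k` levels below that
node. The children of a walk at `v` are its one-step extensions to neighbours `w` of `v`, except
the step back. A child is a leaf with a fixed spin if `w` is the pinned vertex or if `w` is already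
on the walk; in the latter case the spin is `+` if the vertex `v` from which the walk
re-enters `w` is smaller than the vertex through which it left `w`, and `-` otherwise. A child with
ratio `R` contributes `(β R + 1) / (R + β)`, which is `β` for the spin `+` (`R = ∞`) and
`1 / β` for the spin `-` (`R = 0`). -/
noncomputable def sawRatio {V : Type*} [Fintype V] [LinearOrder V] (G : SimpleGraph V) (β : ℝ)
    (u : V) (s : Bool) : ℕ → List V → PowerSeries ℂ
  | 0, _ => 0
  | _ + 1, [] => 0
  | k + 1, v :: p =>
      PowerSeries.X * ∏ w ∈ (G.neighborFinset v).filter (fun w => p.head? ≠ some w),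
        if w = u then (if s = true then PowerSeries.C (β : ℂ) else PowerSeries.C (β : ℂ)⁻¹)
        else if w ∈ p then
          (if v < stepAfter w (v :: p) then PowerSeries.C (β : ℂ) else PowerSeries.C (β : ℂ)⁻¹)
        else
          (PowerSeries.C (β : ℂ) * sawRatio G β u s k (w :: v :: p) + 1) *
            (sawRatio G β u s k (w :: v :: p) + PowerSeries.C (β : ℂ))⁻¹

/-- The edge-deletion ratio of the edge `uv`, computed from three marginal ratios on self-avoiding
walk trees of depth `k`: at `v` with `u` pinned to `+`, at `u` with `v` pinned to `-`, and at `v`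
with `u` pinned to `-`. -/
noncomputable def sawEdgeRatio {V : Type*} [Fintype V] [LinearOrder V] (G : SimpleGraph V) (β : ℝ)
    (u v : V) (k : ℕ) : PowerSeries ℂ :=
  let a := sawRatio G β u true k [v]
  let b := sawRatio G β v false k [u]
  let c := sawRatio G β u false k [v]
  1 - PowerSeries.C (1 - (β : ℂ)⁻¹) * ((a * b + 1) * (a * b + 1 + b + c)⁻¹)

/-! ### Deterministic programs and their running time

Programs work with two kinds of memory: arrays of natural numbers, used for addresses and
counters, and arrays of complex numbers, on which the field operations and the comparison of
real parts are available at unit cost. The only constants in a program are integers. -/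

/-- The contents of the memory: cell `i` of the array number `a`, for both kinds of arrays. -/
structure Store where
  nat : ℕ → ℕ → ℕ
  num : ℕ → ℕ → ℂ

/-- Expressions for natural numbers. -/
inductive NatExp where
  | const (c : ℕ)
  | cell (a : ℕ) (i : NatExp)
  | add (x y : NatExp)
  | sub (x y : NatExp)

/-- The value of an expression (subtraction is truncated at `0`). -/
def NatExp.val (S : Store) : NatExp → ℕ
  | .const c => c
  | .cell a i => S.nat a (i.val S)
  | .add x y => x.val S + y.val S
  | .sub x y => x.val S - y.val S

/-- The number of steps that the evaluation of an expression takes. -/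
def NatExp.cost : NatExp → ℕ
  | .const _ => 1
  | .cell _ i => i.cost + 1
  | .add x y => x.cost + y.cost + 1
  | .sub x y => x.cost + y.cost + 1

/-- Expressions for complex numbers. -/
inductive NumExp where
  | const (c : ℤ)
  | cell (a : ℕ) (i : NatExp)
  | add (x y : NumExp)
  | sub (x y : NumExp)
  | mul (x y : NumExp)
  | div (x y : NumExp)

/-- The value of an expression (division by `0` returns `0`). -/
noncomputable def NumExp.val (S : Store) : NumExp → ℂ
  | .const c => (c : ℂ)
  | .cell a i => S.num a (i.val S)
  | .add x y => x.val S + y.val S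
  | .sub x y => x.val S - y.val S
  | .mul x y => x.val S * y.val S
  | .div x y => x.val S / y.val S

/-- The number of steps that the evaluation of an expression takes. -/
def NumExp.cost : NumExp → ℕ
  | .const _ => 1
  | .cell _ i => i.cost + 1
  | .add x y => x.cost + y.cost + 1
  | .sub x y => x.cost + y.cost + 1
  | .mul x y => x.cost + y.cost + 1
  | .div x y => x.cost + y.cost + 1

/-- Tests. -/
inductive Test where
  | natLt (x y : NatExp)
  | natEq (x y : NatExp)
  | reLt (x y : NumExp)
  | neg (b : Test)
  | conj (b c : Test)

/-- The truth of a test; `reLt` compares real parts. -/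
def Test.holds (S : Store) : Test → Prop
  | .natLt x y => x.val S < y.val S
  | .natEq x y => x.val S = y.val S
  | .reLt x y => (x.val S).re < (y.val S).re
  | .neg b => ¬ b.holds S
  | .conj b c => b.holds S ∧ c.holds S

/-- The number of steps that a test takes. -/
def Test.cost : Test → ℕ
  | .natLt x y => x.cost + y.cost + 1
  | .natEq x y => x.cost + y.cost + 1
  | .reLt x y => x.cost + y.cost + 1
  | .neg b => b.cost + 1
  | .conj b c => b.cost + c.cost + 1

/-- Programs. `setNat a i e` writes the value of `e` into cell `i` of the array `a`, and
likewise `setNum`. -/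
inductive Program where
  | skip
  | setNat (a : ℕ) (i : NatExp) (e : NatExp)
  | setNum (a : ℕ) (i : NatExp) (e : NumExp)
  | seq (p q : Program)
  | ite (b : Test) (p q : Program)
  | loop (b : Test) (p : Program)

/-- Write `x` into cell `i` of the array `a` of natural numbers. -/
def Store.writeNat (S : Store) (a i x : ℕ) : Store :=
  { S with nat := Function.update S.nat a (Function.update (S.nat a) i x) }

/-- Write `x` into cell `i` of the array `a` of complex numbers. -/
noncomputable def Store.writeNum (S : Store) (a i : ℕ) (x : ℂ) : Store :=
  { S with num := Function.update S.num a (Function.update (S.num a) i x) }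

/-- `Runs p S t S'`: started with the memory `S`, the program `p` halts after `t` steps with the
memory `S'`. -/
inductive Runs : Program → Store → ℕ → Store → Prop
  | skip (S : Store) : Runs .skip S 1 S
  | setNat (a : ℕ) (i e : NatExp) (S : Store) :
      Runs (.setNat a i e) S (i.cost + e.cost + 1) (S.writeNat a (i.val S) (e.val S))
  | setNum (a : ℕ) (i : NatExp) (e : NumExp) (S : Store) :
      Runs (.setNum a i e) S (i.cost + e.cost + 1) (S.writeNum a (i.val S) (e.val S))
  | seq {p q : Program} {S S₁ S₂ : Store} {t₁ t₂ : ℕ} (hp : Runs p S t₁ S₁)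
      (hq : Runs q S₁ t₂ S₂) : Runs (.seq p q) S (t₁ + t₂) S₂
  | iteTrue {b : Test} {p q : Program} {S S' : Store} {t : ℕ} (hb : b.holds S)
      (hp : Runs p S t S') : Runs (.ite b p q) S (b.cost + t) S'
  | iteFalse {b : Test} {p q : Program} {S S' : Store} {t : ℕ} (hb : ¬ b.holds S)
      (hq : Runs q S t S') : Runs (.ite b p q) S (b.cost + t) S'
  | loopDone {b : Test} {p : Program} {S : Store} (hb : ¬ b.holds S) :
      Runs (.loop b p) S b.cost S
  | loopStep {b : Test} {p : Program} {S S₁ S₂ : Store} {t₁ t₂ : ℕ} (hb : b.holds S)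
      (hp : Runs p S t₁ S₁) (hl : Runs (.loop b p) S₁ t₂ S₂) :
      Runs (.loop b p) S (b.cost + t₁ + t₂) S₂

/-- Programs are deterministic: the memory determines the running time and the result. -/
theorem Runs.deterministic {p : Program} {S S₁ S₂ : Store} {t₁ t₂ : ℕ}
    (h₁ : Runs p S t₁ S₁) (h₂ : Runs p S t₂ S₂) : t₁ = t₂ ∧ S₁ = S₂ := by
  induction h₁ generalizing t₂ S₂ with
  | skip S => cases h₂; exact ⟨rfl, rfl⟩
  | setNat a i e S => cases h₂; exact ⟨rfl, rfl⟩
  | setNum a i e S => cases h₂; exact ⟨rfl, rfl⟩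
  | seq _ _ ih₁ ih₂ =>
      cases h₂ with
      | seq hp hq =>
          obtain ⟨rfl, rfl⟩ := ih₁ hp
          obtain ⟨rfl, rfl⟩ := ih₂ hq
          exact ⟨rfl, rfl⟩
  | iteTrue hb _ ih =>
      cases h₂ with
      | iteTrue _ hp => obtain ⟨rfl, rfl⟩ := ih hp; exact ⟨rfl, rfl⟩
      | iteFalse hb' _ => exact absurd hb hb'
  | iteFalse hb _ ih =>
      cases h₂ with
      | iteTrue hb' _ => exact absurd hb' hb
      | iteFalse _ hp => obtain ⟨rfl, rfl⟩ := ih hp; exact ⟨rfl, rfl⟩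
  | loopDone hb =>
      cases h₂ with
      | loopDone _ => exact ⟨rfl, rfl⟩
      | loopStep hb' _ _ => exact absurd hb' hb
  | loopStep hb _ _ ih₁ ih₂ =>
      cases h₂ with
      | loopDone hb' => exact absurd hb hb'
      | loopStep _ hp hl =>
          obtain ⟨rfl, rfl⟩ := ih₁ hp
          obtain ⟨rfl, rfl⟩ := ih₂ hl
          exact ⟨rfl, rfl⟩

/-- The initial memory. The array `0` of natural numbers holds the number of vertices and the number
of edges, the arrays `1` and `2` hold the first and the second endpoints of the edges, in the order
of the list. The array `0` of complex numbers holds `β`, the field `z` and the accuracy `ε`.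
All other cells are `0`. -/
noncomputable def inputStore {n : ℕ} (β : ℝ) (z : ℂ) (L : List (Fin n × Fin n)) (ε : ℝ) :
    Store where
  nat a i :=
    if a = 0 then (if i = 0 then n else if i = 1 then L.length else 0)
    else if a = 1 then ((L.map fun p => (p.1 : ℕ)).getD i 0)
    else if a = 2 then ((L.map fun p => (p.2 : ℕ)).getD i 0)
    else 0
  num a i :=
    if a = 0 then (if i = 0 then (β : ℂ) else if i = 1 then z else if i = 2 then (ε : ℂ) else 0)
    else 0

/-- The output of a program is read from cell `0` of the array `1` of complex numbers. -/
def Store.output (S : Store) : ℂ := S.num 1 0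

/-! ### The Lee–Yang theorem -/

/-! Analytic half. By Lee–Yang, the partition function with a separate field at every vertex has no
zeros in the open unit polydisc. This is proved edge by edge. As a function of the fields `x`, `y`
at the ends of an edge the partition function is `β a x y + b x + c y + β d`, with coefficients that
do not depend on `β`. If the polynomial with `β = 1` has no zero in the bidisc, then neither has the
one with `β ≥ 1` (`bilinear_ne_zero_of_norm_lt_one`, `LeeYang.mul_edge`).

The same fact controls the ratio `P = Z_{G-e} / Z_G`. If `P(z) = c ≤ 0`, then `Z_{G-e} - c Z_G`
vanishes at `z`. But up to the factor `1 - c` it is the partition function in which `e` has the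
weight `(1 - cβ)/(1 - c) ≥ 1`, and that one has no zeros. So `P` maps the disc to the slit plane,
and `P(0) = 1/β`. Its square root has positive real part, and the Schwarz lemma bounds `|P|` above
and below on each smaller disc, independently of the graph. With Cauchy's estimates, the Taylor
polynomial of degree `k` has relative error at most `M θ^k` at `λ`, where `M` and `θ < 1` depend
only on `β` and `λ` (`exists_norm_taylorPoly_div_sub_one_le`). A degree `k = O(log(m/ε))` makes each
of the `m` relative errors at most `ε/(4m)`, and then the telescoping product has relative error at
most `ε`.

Combinatorial half. The Taylor coefficients come from Weitz's recursion, carried out in formal power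
series in the field. Let the edges from `v` to its neighbours lead to separate copies of `v`, and
switch these copies from `-` to `+` one after another in increasing order. The marginal ratio at `v`
telescopes into a product of factors, each depending on a marginal ratio at one neighbour in the
system without `v`, where smaller neighbours see `+` and larger ones see `-` (`spinRatio_eq_prod`).
Iterating gives the self-avoiding walk tree with its rule for leaves. Each level carries a factor
`X`, so cutting the tree at depth `k` changes no coefficient of degree at most `k`
(`X_pow_dvd_spinRatio_sub_sawRatio`). Three such ratios determine the probability that the ends of
`e` agree, and hence `P`.

Algorithmic half. A depth-first traversal with an explicit stack of height at most `k` evaluates the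
recursion. Each node scans the edge list, so there are at most `(m+1)(Δ+1)^k` traversal steps, each
with `O(k²)` operations on truncated series (`exists_stepsWhile_dfsStep`, `dfsProg_spec`). Over all
edges this is `O(m² k² (Δ+1)^k)`, up to the time for the initial power of `1 + λ`, and
`(Δ+1)^{O(log(m/ε))} = (m/ε)^{O(log(Δ+1))}` gives the running time (`exists_time_bound`). -/

theorem exists_unit_mul_re_eq_neg_norm (w : ℂ) : ∃ y : ℂ, ‖y‖ = 1 ∧ (w * y).re = -‖w‖ := by
  by_cases hw : w = 0
  · exact ⟨1, by simp, by simp [hw]⟩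
  · have hn : (‖w‖ : ℂ) ≠ 0 := by simpa using hw
    refine ⟨-(starRingEnd ℂ w) / ‖w‖, by simp [hw], ?_⟩
    have h : w * (-(starRingEnd ℂ w) / ‖w‖) = ((-‖w‖ : ℝ) : ℂ) := by
      rw [mul_div_assoc', mul_neg, Complex.mul_conj, Complex.normSq_eq_norm_sq]
      push_cast
      field_simp
    rw [h, Complex.ofReal_re]

theorem exists_unit_eq_norm_mul (x : ℂ) : ∃ u : ℂ, ‖u‖ = 1 ∧ x = ‖x‖ * u := by
  by_cases hx : x = 0
  · exact ⟨1, by simp, by simp [hx]⟩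
  · have hn : (‖x‖ : ℂ) ≠ 0 := by simpa using hx
    exact ⟨x / ‖x‖, by simp [hx], by field_simp⟩

theorem normSq_mul_add_of_norm_eq_one (a b y : ℂ) (hy : ‖y‖ = 1) :
    Complex.normSq (a * y + b) =
      Complex.normSq a + Complex.normSq b + 2 * (a * starRingEnd ℂ b * y).re := by
  rw [Complex.normSq_add, Complex.normSq_mul, Complex.normSq_eq_norm_sq y, hy]
  ring_nf

/-- If `a x y + b x + c y + d` has no zero in the closed bidisc then the differences of the squared
norms of the coefficients dominate the mixed terms. -/
theorem two_mul_norm_lt_of_bilinear_ne_zero {a b c d : ℂ}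
    (h : ∀ x y : ℂ, ‖x‖ ≤ 1 → ‖y‖ ≤ 1 → a * x * y + b * x + c * y + d ≠ 0) :
    2 * ‖c * starRingEnd ℂ d - a * starRingEnd ℂ b‖ <
      Complex.normSq c + Complex.normSq d - Complex.normSq a - Complex.normSq b := by
  -- This point of the unit circle makes the mixed term as negative as possible, so that the
  -- inequality `|a y + b| < |c y + d|` at it becomes the claim.
  obtain ⟨y, hy, hre⟩ := exists_unit_mul_re_eq_neg_norm
    (c * starRingEnd ℂ d - a * starRingEnd ℂ b)
  -- For fixed `y` the root in `x` is `-(c y + d)/(a y + b)`, which has to lie outside the closed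
  -- disc. If `a y + b = c y + d = 0`, every `x` would be a root.
  have hlt : Complex.normSq (a * y + b) < Complex.normSq (c * y + d) := by
    rw [Complex.normSq_eq_norm_sq, Complex.normSq_eq_norm_sq]
    by_contra! hle
    have hle' : ‖c * y + d‖ ≤ ‖a * y + b‖ := by
      simpa using (sq_le_sq₀ (norm_nonneg _) (norm_nonneg _)).1 hle
    by_cases h0 : a * y + b = 0
    · have h1 : c * y + d = 0 := by simpa [h0] using hle'
      refine h 0 y (by simp) hy.le ?_
      linear_combination h1
    · refine h (-(c * y + d) / (a * y + b)) y ?_ hy.le ?_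
      · rw [norm_div, norm_neg]
        exact div_le_one_of_le₀ hle' (norm_nonneg _)
      · field_simp
        ring
  rw [normSq_mul_add_of_norm_eq_one a b y hy, normSq_mul_add_of_norm_eq_one c d y hy] at hlt
  rw [sub_mul, Complex.sub_re] at hre
  linarith

/-- A zero on the torus forces `|β a y + b| = |c y + β d|`. Write `D = |d|² - |a|²` and `T = |c d̄ -
a b̄|`. Expanding the squares, the difference of the two sides is at least `β² D + |c|² - |b|² -
2βT`, and the coefficient inequality makes this larger than `(β - 1)((β + 1) D - 2T)`. This is
nonnegative because `D ≥ T`, which follows by adding the coefficient inequality and its mirror image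
under exchange of `x` and `y`. -/
theorem bilinear_ne_zero_of_norm_eq_one {a b c d : ℂ}
    (h : ∀ x y : ℂ, ‖x‖ ≤ 1 → ‖y‖ ≤ 1 → a * x * y + b * x + c * y + d ≠ 0)
    {β : ℝ} (hβ : 1 ≤ β) {x y : ℂ} (hx : ‖x‖ = 1) (hy : ‖y‖ = 1) :
    β * a * x * y + b * x + c * y + β * d ≠ 0 := by
  intro h0
  have h1 := two_mul_norm_lt_of_bilinear_ne_zero h
  have h2 := two_mul_norm_lt_of_bilinear_ne_zero (a := a) (b := c) (c := b) (d := d)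
    (fun x y hx hy h3 => h y x hy hx (by linear_combination h3))
  have h3 : Complex.normSq (β * a * y + b) = Complex.normSq (c * y + β * d) := by
    rw [Complex.normSq_eq_norm_sq, Complex.normSq_eq_norm_sq]
    have h4 : c * y + β * d = -(β * a * y + b) * x := by linear_combination h0
    rw [h4, norm_mul, norm_neg, hx, mul_one]
  rw [normSq_mul_add_of_norm_eq_one _ _ y hy, normSq_mul_add_of_norm_eq_one _ _ y hy,
    Complex.normSq_mul, Complex.normSq_mul, Complex.normSq_ofReal] at h3
  have h5 : (c * starRingEnd ℂ (β * d) * y).re - (β * a * starRingEnd ℂ b * y).re =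
      β * ((c * starRingEnd ℂ d - a * starRingEnd ℂ b) * y).re := by
    rw [← Complex.re_ofReal_mul, ← Complex.sub_re]
    congr 1
    rw [map_mul, Complex.conj_ofReal]
    ring
  have h6 : -‖c * starRingEnd ℂ d - a * starRingEnd ℂ b‖ ≤
      ((c * starRingEnd ℂ d - a * starRingEnd ℂ b) * y).re := by
    have := Complex.abs_re_le_norm ((c * starRingEnd ℂ d - a * starRingEnd ℂ b) * y)
    rw [norm_mul, hy, mul_one] at this
    exact (abs_le.1 this).1
  have h7 := norm_nonneg (b * starRingEnd ℂ d - a * starRingEnd ℂ c)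
  set T := ‖c * starRingEnd ℂ d - a * starRingEnd ℂ b‖
  have hT : 0 ≤ T := norm_nonneg _
  have h8 : β * (-T) ≤ β * ((c * starRingEnd ℂ d - a * starRingEnd ℂ b) * y).re :=
    mul_le_mul_of_nonneg_left h6 (by linarith)
  have h9 : 0 ≤ (β - 1) * ((β + 1) * (Complex.normSq d - Complex.normSq a) - 2 * T) := by
    apply mul_nonneg (by linarith)
    nlinarith
  nlinarith

/-- The moduli of `x` and `y` are absorbed into the coefficients. The rescaled polynomial has no
zero in the closed bidisc, and the point to be treated becomes a point of the torus. -/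
theorem bilinear_ne_zero_of_norm_lt_one {a b c d : ℂ}
    (h : ∀ x y : ℂ, ‖x‖ < 1 → ‖y‖ < 1 → a * x * y + b * x + c * y + d ≠ 0)
    {β : ℝ} (hβ : 1 ≤ β) {x y : ℂ} (hx : ‖x‖ < 1) (hy : ‖y‖ < 1) :
    β * a * x * y + b * x + c * y + β * d ≠ 0 := by
  obtain ⟨u, hu, hxu⟩ := exists_unit_eq_norm_mul x
  obtain ⟨v, hv, hyv⟩ := exists_unit_eq_norm_mul y
  have key := bilinear_ne_zero_of_norm_eq_one (a := a * ‖x‖ * ‖y‖) (b := b * ‖x‖)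
    (c := c * ‖y‖) (d := d) (fun x' y' hx' hy' h0 => h (‖x‖ * x') (‖y‖ * y')
      (by
        rw [norm_mul, Complex.norm_real, norm_norm]
        exact lt_of_le_of_lt (mul_le_of_le_one_right (norm_nonneg _) hx') hx)
      (by
        rw [norm_mul, Complex.norm_real, norm_norm]
        exact lt_of_le_of_lt (mul_le_of_le_one_right (norm_nonneg _) hy') hy)
      (by linear_combination h0)) hβ hu hv
  intro h0
  apply key
  rw [hxu, hyv] at h0
  linear_combination h0

section LeeYang

variable {V : Type*} [Fintype V]

open Classical in
/-- The partition function of a spin system with weights `W` and vertex fields `z`. -/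
noncomputable def spinZ (W : (V → Bool) → ℂ) (z : V → ℂ) : ℂ :=
  ∑ σ : V → Bool, W σ * ∏ v, if σ v = true then z v else 1

/-- The Lee–Yang property: no zeros in the open unit polydisc. -/
def LeeYang (W : (V → Bool) → ℂ) : Prop :=
  ∀ z : V → ℂ, (∀ v, ‖z v‖ < 1) → spinZ W z ≠ 0

-- The partition function is affine in each field. The coefficients `a, b, c, d` collect the
-- configurations with spins `++`, `+-`, `-+`, `--` at `u`, `v`, and the edge weight multiplies only
-- those where the spins agree. The coefficients come before the quantifier over `β`, so that they
-- can be compared with the case `β = 1`, which is `W` itself.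
open Classical in
theorem spinZ_update_update (W : (V → Bool) → ℂ) (z : V → ℂ) {u v : V}
    (huv : u ≠ v) :
    ∃ a b c d : ℂ, ∀ (β : ℝ) (x y : ℂ),
      spinZ (fun σ => (if σ u = σ v then (β : ℂ) else 1) * W σ)
        (Function.update (Function.update z u x) v y) =
      β * a * x * y + b * x + c * y + β * d := by
  let A : Bool → Bool → ℂ := fun s t => ∑ σ : V → Bool, if σ u = s ∧ σ v = t then
    W σ * ∏ w ∈ (Finset.univ.erase u).erase v, (if σ w = true then z w else 1) else 0
  refine ⟨A true true, A true false, A false true, A false false, fun β x y => ?_⟩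
  simp only [A, spinZ, Finset.mul_sum, Finset.sum_mul, ← Finset.sum_add_distrib]
  refine Finset.sum_congr rfl fun σ _ => ?_
  rw [← Finset.mul_prod_erase Finset.univ _ (Finset.mem_univ u),
    ← Finset.mul_prod_erase (Finset.univ.erase u) _
      (Finset.mem_erase.2 ⟨huv.symm, Finset.mem_univ v⟩)]
  have hprod : ∏ w ∈ (Finset.univ.erase u).erase v,
      (if σ w = true then Function.update (Function.update z u x) v y w else 1) =
      ∏ w ∈ (Finset.univ.erase u).erase v, (if σ w = true then z w else 1) := by
    refine Finset.prod_congr rfl fun w hw => ?_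
    have h1 : w ≠ v := (Finset.mem_erase.1 hw).1
    have h2 : w ≠ u := (Finset.mem_erase.1 (Finset.mem_erase.1 hw).2).1
    rw [Function.update_of_ne h1, Function.update_of_ne h2]
  rw [hprod, Function.update_self, Function.update_of_ne huv, Function.update_self]
  cases σ u <;> cases σ v <;> simp <;> ring

theorem LeeYang.mul_edge {W : (V → Bool) → ℂ} (hW : LeeYang W) {u v : V} (huv : u ≠ v) {β : ℝ}
    (hβ : 1 ≤ β) : LeeYang (fun σ => (if σ u = σ v then (β : ℂ) else 1) * W σ) := by
  classical
  intro z hz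
  obtain ⟨a, b, c, d, h⟩ := spinZ_update_update W z huv
  have h1 : Function.update (Function.update z u (z u)) v (z v) = z := by simp
  have key := bilinear_ne_zero_of_norm_lt_one (a := a) (b := b) (c := c) (d := d)
    (fun x y hx hy h0 => by
      have h2 := h 1 x y
      simp only [Complex.ofReal_one, ite_self, one_mul, h0] at h2
      refine hW _ (fun w => ?_) h2
      by_cases hwv : w = v
      · subst hwv; simpa using hy
      · rw [Function.update_of_ne hwv]
        by_cases hwu : w = u
        · subst hwu; simpa using hx
        · rw [Function.update_of_ne hwu]; exact hz w) hβ (hz u) (hz v)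
  rwa [← h β (z u) (z v), h1] at key

/-- Without edges the partition function is the product of the `1 + z v`. -/
theorem leeYang_one : LeeYang (fun _ : V → Bool => (1 : ℂ)) := by
  classical
  intro z hz
  have h : spinZ (fun _ => 1) z = ∏ v, (z v + 1) := by
    simp only [spinZ, one_mul]
    have := (Finset.prod_univ_sum (fun _ : V => (Finset.univ : Finset Bool))
      (fun v (b : Bool) => if b = true then z v else 1)).symm
    rw [Fintype.piFinset_univ] at this
    rw [this]
    simp
  rw [h, Finset.prod_ne_zero_iff]
  intro v _ h0
  have h1 : z v = -1 := by linear_combination h0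
  have := hz v
  simp [h1] at this

theorem LeeYang.const_mul {W : (V → Bool) → ℂ} (hW : LeeYang W) {c : ℂ} (hc : c ≠ 0) :
    LeeYang (fun σ => c * W σ) := by
  intro z hz
  have : spinZ (fun σ => c * W σ) z = c * spinZ W z := by
    simp [spinZ, Finset.mul_sum, mul_assoc]
  rw [this]
  exact mul_ne_zero hc (hW z hz)

open Classical in
/-- The edge part of the Ising weight. -/
noncomputable def edgeWeight (T : Finset (Sym2 V)) (β : ℝ) (σ : V → Bool) : ℂ :=
  ∏ e ∈ T, if (e.map σ).IsDiag then (β : ℂ) else 1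

open Classical in
theorem LeeYang.mul_sym2 {W : (V → Bool) → ℂ} (hW : LeeYang W) {e : Sym2 V} (he : ¬ e.IsDiag)
    {β : ℝ} (hβ : 1 ≤ β) :
    LeeYang (fun σ => (if (e.map σ).IsDiag then (β : ℂ) else 1) * W σ) := by
  induction e using Sym2.ind with
  | _ u v =>
    have := hW.mul_edge (u := u) (v := v) (by simpa using he) hβ
    simpa only [Sym2.map_mk, Sym2.mk_isDiag_iff] using this

theorem leeYang_edgeWeight (T : Finset (Sym2 V)) (hT : ∀ e ∈ T, ¬ e.IsDiag) {β : ℝ} (hβ : 1 ≤ β) :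
    LeeYang (edgeWeight T β) := by
  classical
  induction T using Finset.induction_on with
  | empty =>
    have : edgeWeight (∅ : Finset (Sym2 V)) β = fun _ => 1 := by
      funext σ; simp [edgeWeight]
    rw [this]; exact leeYang_one
  | insert e T he ih =>
    have : edgeWeight (insert e T) β =
        fun σ => (if (e.map σ).IsDiag then (β : ℂ) else 1) * edgeWeight T β σ := by
      funext σ; simp only [edgeWeight]; rw [Finset.prod_insert he]
    rw [this]
    exact (ih fun e he => hT e (Finset.mem_insert_of_mem he)).mul_sym2
      (hT e (Finset.mem_insert_self _ _)) hβ

open Classical in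
theorem isingZ_eq_spinZ (G : SimpleGraph V) (β : ℝ) (z : ℂ) :
    isingZ G β z = spinZ (edgeWeight G.edgeFinset β) (fun _ => z) := by
  simp only [isingZ, isingWeight, spinZ, edgeWeight]

theorem isingZ_ne_zero (G : SimpleGraph V) {β : ℝ} (hβ : 1 ≤ β) {z : ℂ} (hz : ‖z‖ < 1) :
    isingZ G β z ≠ 0 := by
  classical
  rw [isingZ_eq_spinZ]
  exact leeYang_edgeWeight _ (fun e he => G.not_isDiag_of_mem_edgeSet (SimpleGraph.mem_edgeFinset.1 he)) hβ _ fun _ => hz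

/-- The edge-deletion ratio does not take values in `(-∞, 0]`. -/
theorem edgeRatio_mem_slitPlane (G : SimpleGraph V) {β : ℝ} (hβ : 1 ≤ β) {z : ℂ} (hz : ‖z‖ < 1)
    {e : Sym2 V} (he : e ∈ G.edgeSet) : edgeRatio G β e z ∈ Complex.slitPlane := by
  classical
  by_contra hc
  have hZ := isingZ_ne_zero G hβ hz
  rw [Complex.mem_slitPlane_iff_not_le_zero, not_not] at hc
  obtain ⟨c, hc0, hcP⟩ : ∃ c : ℝ, c ≤ 0 ∧ edgeRatio G β e z = c := by
    obtain ⟨h1, h2⟩ := Complex.le_def.1 hc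
    exact ⟨(edgeRatio G β e z).re, by simpa using h1, Complex.ext (by simp) (by simpa using h2)⟩
  rw [edgeRatio, div_eq_iff hZ] at hcP
  set T := (G.deleteEdges {e}).edgeFinset with hT
  have hins : G.edgeFinset = insert e T := by
    ext f
    simp only [hT, SimpleGraph.mem_edgeFinset, SimpleGraph.edgeSet_deleteEdges, Finset.mem_insert,
      Set.mem_sdiff, Set.mem_singleton_iff]
    constructor
    · intro hf
      by_cases hfe : f = e
      · exact Or.inl hfe
      · exact Or.inr ⟨hf, hfe⟩
    · rintro (rfl | h)
      · exact he
      · exact h.1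
  have heT : e ∉ T := by simp [hT, SimpleGraph.edgeSet_deleteEdges]
  have h1c : (0 : ℝ) < 1 - c := by linarith
  -- The weight of `e` in `(Z_{G-e} - c Z_G)/(1 - c)`: a configuration gets `1 - cβ` if the ends of
  -- `e` agree and `1 - c` otherwise. It is at least `1` because `c ≤ 0` and `β ≥ 1`, so Lee–Yang
  -- applies to it.
  have hβ' : 1 ≤ (1 - c * β) / (1 - c) := by
    rw [le_div_iff₀ h1c]; nlinarith
  have key := ((leeYang_edgeWeight T (fun f hf =>
    SimpleGraph.not_isDiag_of_mem_edgeSet _ (SimpleGraph.mem_edgeFinset.1 hf))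
    hβ).mul_sym2 (G.not_isDiag_of_mem_edgeSet he) hβ').const_mul
      (c := ((1 - c : ℝ) : ℂ)) (by exact_mod_cast h1c.ne') (fun _ => z) (fun _ => hz)
  apply key
  have hZT : isingZ (G.deleteEdges {e}) β z = spinZ (edgeWeight T β) fun _ => z := by
    rw [isingZ_eq_spinZ]; congr!
  rw [hZT, isingZ_eq_spinZ, ← sub_eq_zero] at hcP
  refine Eq.trans ?_ hcP
  rw [show G.edgeFinset = insert e T by rw [← hins]]
  clear_value T
  simp only [spinZ, Finset.mul_sum, ← Finset.sum_sub_distrib]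
  refine Finset.sum_congr rfl fun σ _ => ?_
  have h2 : edgeWeight (insert e T) β σ =
      (if (e.map σ).IsDiag then (β : ℂ) else 1) * edgeWeight T β σ := by
    simp only [edgeWeight]; rw [Finset.prod_insert heT]
  rw [h2]
  have h3 : ((1 - c : ℝ) : ℂ) ≠ 0 := by exact_mod_cast h1c.ne'
  split_ifs
  · push_cast at h3 ⊢
    field_simp
  · push_cast; ring

end LeeYang

/-! ### Bounds for maps of the disc to the slit plane -/

/-- The Cayley transform `w ↦ (w - s)/(w + s)` maps the right half-plane to the disc and `s` to `0`,
so this is the Schwarz lemma for its composition with `g`. -/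
theorem norm_sub_le_mul_norm_add {g : ℂ → ℂ} {s : ℝ} (hs : 0 < s)
    (hg : DifferentiableOn ℂ g (Metric.ball 0 1)) (hre : ∀ z ∈ Metric.ball (0 : ℂ) 1, 0 < (g z).re)
    (h0 : g 0 = s) {z : ℂ} (hz : ‖z‖ < 1) : ‖g z - s‖ ≤ ‖z‖ * ‖g z + s‖ := by
  have hne : ∀ w ∈ Metric.ball (0 : ℂ) 1, g w + s ≠ 0 := by
    intro w hw h
    have := hre w hw
    have h1 := congrArg Complex.re h
    simp at h1
    linarith
  have key := Complex.norm_le_norm_of_mapsTo_ball (f := fun w => (g w - s) / (g w + s)) (R := 1)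
    ((hg.sub_const _).div (hg.add_const _) hne)
    (fun w hw => by
      rw [mem_closedBall_zero_iff, norm_div]
      refine div_le_one_of_le₀ ?_ (norm_nonneg _)
      rw [← sq_le_sq₀ (norm_nonneg _) (norm_nonneg _), ← Complex.normSq_eq_norm_sq,
        ← Complex.normSq_eq_norm_sq, Complex.normSq_apply, Complex.normSq_apply]
      have := mul_pos (hre w hw) hs
      simp
      nlinarith)
    (by simp [h0]) hz
  simp only [norm_div] at key
  rwa [div_le_iff₀ (norm_pos_iff.2 (hne z (by simpa using hz)))] at key

/-- Upper and lower bounds for a function on the unit disc which avoids the negative real axis. -/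
theorem norm_bounds_of_slitPlane {f : ℂ → ℂ} {a : ℝ} (ha : 0 < a)
    (hf : DifferentiableOn ℂ f (Metric.ball 0 1))
    (hslit : ∀ z ∈ Metric.ball (0 : ℂ) 1, f z ∈ Complex.slitPlane) (h0 : f 0 = a)
    {z : ℂ} {r : ℝ} (hz : ‖z‖ ≤ r) (hr : r < 1) :
    a * ((1 - r) / (1 + r)) ^ 2 ≤ ‖f z‖ ∧ ‖f z‖ ≤ a * ((1 + r) / (1 - r)) ^ 2 := by
  have hr0 : 0 ≤ r := (norm_nonneg z).trans hz
  -- The principal square root maps the slit plane to the right half-plane. The bounds for `g`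
  -- follow from the Schwarz lemma and are squared at the end.
  let g : ℂ → ℂ := fun w => f w ^ (2⁻¹ : ℂ)
  have hgsq : ∀ w, g w ^ 2 = f w := fun w => Complex.cpow_nat_inv_pow (f w) two_ne_zero
  have hg0 : g 0 = (Real.sqrt a : ℝ) := by
    simp only [g, h0]
    rw [Real.sqrt_eq_rpow, Complex.ofReal_cpow ha.le]
    norm_num
  have hs : 0 < Real.sqrt a := Real.sqrt_pos.2 ha
  have key := norm_sub_le_mul_norm_add (g := g) hs (hf.cpow_const hslit)
    (fun w hw => by
      have h1 := hslit w hw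
      have h2 : g w ≠ 0 := fun h => Complex.slitPlane_ne_zero h1 (by rw [← hgsq w, h]; simp)
      have h4 := Complex.mem_slitPlane_iff_arg.1 h1
      simp only [g]
      rw [Complex.cpow_def_of_ne_zero (Complex.slitPlane_ne_zero h1), Complex.exp_re]
      refine mul_pos (Real.exp_pos _) (Real.cos_pos_of_mem_Ioo ?_)
      have h5 : (Complex.log (f w) * 2⁻¹).im = (f w).arg / 2 := by
        rw [← Complex.log_im, div_eq_mul_inv, show (2⁻¹ : ℂ) = ((2⁻¹ : ℝ) : ℂ) by norm_num,
          Complex.im_mul_ofReal]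
      rw [h5]
      have h6 := Complex.neg_pi_lt_arg (f w)
      have h7 := lt_of_le_of_ne (Complex.arg_le_pi (f w)) h4.1
      constructor <;> linarith)
    hg0 (lt_of_le_of_lt hz hr)
  set s := Real.sqrt a
  have hsn : ‖(s : ℂ)‖ = s := by rw [Complex.norm_real, Real.norm_of_nonneg hs.le]
  have h1 : ‖g z + s‖ ≤ ‖g z‖ + s := (norm_add_le _ _).trans_eq (by rw [hsn])
  have h2 : ‖g z‖ - s ≤ ‖g z - s‖ := by simpa only [hsn] using norm_sub_norm_le (g z) s
  have h3 : s - ‖g z‖ ≤ ‖g z - s‖ := by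
    simpa only [hsn, norm_sub_rev] using norm_sub_norm_le (s : ℂ) (g z)
  have h4 : ‖z‖ * ‖g z + s‖ ≤ r * (‖g z‖ + s) :=
    mul_le_mul hz h1 (norm_nonneg _) hr0
  have hsa : s ^ 2 = a := Real.sq_sqrt ha.le
  have hlow : s * ((1 - r) / (1 + r)) ≤ ‖g z‖ := by
    rw [mul_div_assoc', div_le_iff₀ (by linarith)]; linarith
  have hup : ‖g z‖ ≤ s * ((1 + r) / (1 - r)) := by
    rw [mul_div_assoc', le_div_iff₀ (by linarith)]; linarith
  rw [← hgsq z, norm_pow, ← hsa, ← mul_pow, ← mul_pow]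
  have : 0 ≤ s * ((1 - r) / (1 + r)) := by
    have : 0 ≤ 1 - r := by linarith
    positivity
  exact ⟨pow_le_pow_left₀ this hlow 2, pow_le_pow_left₀ (norm_nonneg _) hup 2⟩

/-! ### Truncation of Taylor series -/

theorem eval_taylorPoly (f : ℂ → ℂ) (k : ℕ) (z : ℂ) :
    (taylorPoly f k).eval z =
      ∑ j ∈ Finset.range (k + 1), (j.factorial : ℂ)⁻¹ • (z - 0) ^ j • iteratedDeriv j f 0 := by
  rw [taylorPoly, Polynomial.eval_finsetSum]
  refine Finset.sum_congr rfl fun j _ => ?_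
  simp only [Polynomial.eval_mul, Polynomial.eval_C, Polynomial.eval_pow, Polynomial.eval_X,
    smul_eq_mul, sub_zero]
  ring

/-- Cauchy's estimate on the circle of radius `ρ` bounds the term of degree `j` by `M (‖z‖/ρ)^j`,
and the tail from degree `k + 1` on is a geometric series. -/
theorem norm_sub_eval_taylorPoly_le {f : ℂ → ℂ} (hf : DifferentiableOn ℂ f (Metric.ball 0 1))
    {ρ M : ℝ} (hρ : ρ < 1) (hM : ∀ z : ℂ, ‖z‖ ≤ ρ → ‖f z‖ ≤ M) {z : ℂ} (hz : ‖z‖ < ρ) (k : ℕ) :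
    ‖(taylorPoly f k).eval z - f z‖ ≤ M * (‖z‖ / ρ) ^ (k + 1) * (1 - ‖z‖ / ρ)⁻¹ := by
  have hρ0 : 0 < ρ := (norm_nonneg z).trans_lt hz
  have hθ0 : 0 ≤ ‖z‖ / ρ := by positivity
  have hθ : ‖z‖ / ρ < 1 := (div_lt_one hρ0).2 hz
  have hM0 : 0 ≤ M := (norm_nonneg _).trans (hM 0 (by simpa using hρ0.le))
  have hsum := Complex.hasSum_taylorSeries_on_ball hf (z := z) (by simpa using hz.trans hρ)
  have hball : Metric.closedBall (0 : ℂ) ρ ⊆ Metric.ball 0 1 := Metric.closedBall_subset_ball hρ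
  have hdc : DiffContOnCl ℂ f (Metric.ball 0 ρ) :=
    (hf.mono (by rw [closure_ball _ hρ0.ne']; exact hball)).diffContOnCl
  have hterm : ∀ j : ℕ, ‖(j.factorial : ℂ)⁻¹ • (z - 0) ^ j • iteratedDeriv j f 0‖ ≤
      M * (‖z‖ / ρ) ^ j := by
    intro j
    have h1 := Complex.norm_iteratedDeriv_le_of_forall_mem_sphere_norm_le j hρ0 hdc
      (fun w hw => hM w (by simpa using (mem_sphere_zero_iff_norm.1 hw).le))
    rw [norm_smul, norm_smul, norm_inv, sub_zero, norm_pow, Complex.norm_natCast]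
    have hj : (0 : ℝ) < j.factorial := by exact_mod_cast j.factorial_pos
    calc (j.factorial : ℝ)⁻¹ * (‖z‖ ^ j * ‖iteratedDeriv j f 0‖)
        ≤ (j.factorial : ℝ)⁻¹ * (‖z‖ ^ j * (j.factorial * M / ρ ^ j)) := by gcongr
      _ = M * (‖z‖ / ρ) ^ j := by rw [div_pow]; field_simp
  have h2 : HasSum (fun j : ℕ => M * (‖z‖ / ρ) ^ j) (M * (1 - ‖z‖ / ρ)⁻¹) :=
    (hasSum_geometric_of_lt_one hθ0 hθ).mul_left M
  rw [eval_taylorPoly, norm_sub_rev]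
  have h3 := (hasSum_nat_add_iff' (k + 1)).2 hsum
  have h4 : HasSum (fun j : ℕ => M * (‖z‖ / ρ) ^ (j + (k + 1)))
      (M * (‖z‖ / ρ) ^ (k + 1) * (1 - ‖z‖ / ρ)⁻¹) := by
    have := (hasSum_geometric_of_lt_one hθ0 hθ).mul_left (M * (‖z‖ / ρ) ^ (k + 1))
    refine this.congr_fun ?_
    intro j
    ring
  rw [← h3.tsum_eq, ← h4.tsum_eq]
  refine (norm_tsum_le_tsum_norm ?_).trans ?_
  · exact Summable.of_nonneg_of_le (fun _ => norm_nonneg _) (fun j => hterm _) h4.summable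
  · exact Summable.tsum_le_tsum (fun j => hterm _)
      (Summable.of_nonneg_of_le (fun _ => norm_nonneg _) (fun j => hterm _) h4.summable) h4.summable

/-! ### The edge-deletion ratio on the disc -/

section

variable {V : Type*} [Fintype V]

theorem differentiable_isingZ (G : SimpleGraph V) (β : ℝ) :
    Differentiable ℂ (fun z => isingZ G β z) := by
  classical
  unfold isingZ isingWeight
  refine Differentiable.fun_sum fun σ _ => Differentiable.const_mul ?_ _
  refine Differentiable.fun_finsetProd fun v _ => ?_
  split_ifs
  · exact differentiable_id
  · exact differentiable_const _

-- At field `0` only the configuration with all spins `-` has nonzero weight, and there every edge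
-- contributes `β`.
open Classical in
theorem isingZ_zero (G : SimpleGraph V) (β : ℝ) : isingZ G β 0 = (β : ℂ) ^ G.edgeFinset.card := by
  rw [isingZ, Finset.sum_eq_single (fun _ => false)]
  · simp only [isingWeight, Bool.false_eq_true, if_false, Finset.prod_const_one, mul_one]
    rw [← Finset.prod_const]
    refine Finset.prod_congr rfl fun e _ => ?_
    induction e using Sym2.ind with
    | _ u v => simp
  · intro σ _ hσ
    obtain ⟨v, hv⟩ : ∃ v, σ v = true := by
      by_contra! h
      exact hσ (funext fun v => by simpa using h v)
    rw [isingWeight, Finset.prod_eq_zero (Finset.mem_univ v) (by simp [hv]), mul_zero]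
  · simp

theorem edgeRatio_zero (G : SimpleGraph V) {β : ℝ} (hβ : β ≠ 0) {e : Sym2 V} (he : e ∈ G.edgeSet) :
    edgeRatio G β e 0 = (β⁻¹ : ℝ) := by
  classical
  have hb : (β : ℂ) ≠ 0 := by exact_mod_cast hβ
  have h1 : (G.deleteEdges {e}).edgeFinset.card + 1 = G.edgeFinset.card := by
    have : (G.deleteEdges {e}).edgeFinset = G.edgeFinset.erase e := by
      ext f; simp [SimpleGraph.edgeSet_deleteEdges, and_comm]
    rw [this, Finset.card_erase_add_one (SimpleGraph.mem_edgeFinset.2 he)]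
  rw [edgeRatio, isingZ_zero, isingZ_zero, ← h1, pow_succ]
  push_cast
  field_simp
  congr!

theorem differentiableOn_edgeRatio (G : SimpleGraph V) {β : ℝ} (hβ : 1 ≤ β) (e : Sym2 V) :
    DifferentiableOn ℂ (edgeRatio G β e) (Metric.ball 0 1) :=
  (differentiable_isingZ _ β).differentiableOn.div (differentiable_isingZ _ β).differentiableOn
    fun _ hz => isingZ_ne_zero G hβ (by simpa using hz)

end

/-- The relative truncation error of the edge-deletion ratio decays exponentially in the degree, at
a rate which does not depend on the graph. -/
theorem exists_norm_taylorPoly_div_sub_one_le {β : ℝ} (hβ : 1 < β) {lam : ℂ} (hlam : ‖lam‖ < 1) :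
    ∃ M θ : ℝ, 0 ≤ M ∧ 0 ≤ θ ∧ θ < 1 ∧ ∀ (n : ℕ) (G : SimpleGraph (Fin n)) (e : Sym2 (Fin n)),
      e ∈ G.edgeSet → ∀ k : ℕ,
        ‖(taylorPoly (edgeRatio G β e) k).eval lam / edgeRatio G β e lam - 1‖ ≤ M * θ ^ k := by
  set r := ‖lam‖ with hr
  -- Cauchy's estimates need a radius strictly between `|λ|` and `1`. The upper bound for the ratio
  -- is used on the disc of radius `ρ`, the lower bound only at `λ`.
  set ρ := (1 + r) / 2 with hρ
  have hr0 : 0 ≤ r := norm_nonneg _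
  have hρ1 : ρ < 1 := by rw [hρ]; linarith
  have hrρ : r < ρ := by rw [hρ]; linarith
  have hρ0 : 0 < ρ := hr0.trans_lt hrρ
  have hθ0 : 0 ≤ r / ρ := by positivity
  have hθ : r / ρ < 1 := (div_lt_one hρ0).2 hrρ
  have hβ0 : 0 < β⁻¹ := by positivity
  set up := β⁻¹ * ((1 + ρ) / (1 - ρ)) ^ 2 with hup
  set low := β⁻¹ * ((1 - r) / (1 + r)) ^ 2 with hlow
  have hup0 : 0 ≤ up := by positivity
  have hlow0 : 0 < low := by
    have : 0 < 1 - r := by linarith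
    positivity
  have h1θ : 0 < 1 - r / ρ := by linarith
  refine ⟨up * (1 - r / ρ)⁻¹ / low, r / ρ, by positivity, hθ0, hθ, ?_⟩
  intro n G e he k
  have hd := differentiableOn_edgeRatio G hβ.le e
  have hs : ∀ z ∈ Metric.ball (0 : ℂ) 1, edgeRatio G β e z ∈ Complex.slitPlane := fun z hz =>
    edgeRatio_mem_slitPlane G hβ.le (by simpa using hz) he
  have h0 := edgeRatio_zero G (show β ≠ 0 by positivity) he
  have h1 := (norm_bounds_of_slitPlane hβ0 hd hs h0 hr.ge hlam).1
  have h2 := norm_sub_eval_taylorPoly_le hd hρ1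
    (fun z hz => (norm_bounds_of_slitPlane hβ0 hd hs h0 hz hρ1).2) (z := lam) hrρ k
  have hne : edgeRatio G β e lam ≠ 0 := by
    intro h; rw [h, norm_zero] at h1; exact absurd h1 (not_le.2 hlow0)
  rw [div_sub_one hne, norm_div, div_le_iff₀ (norm_pos_iff.2 hne)]
  refine h2.trans ?_
  calc up * (r / ρ) ^ (k + 1) * (1 - r / ρ)⁻¹
      ≤ up * (r / ρ) ^ k * (1 - r / ρ)⁻¹ := by
        gcongr up * ?_ * _
        exact pow_le_pow_of_le_one hθ0 hθ.le (Nat.le_succ k)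
    _ = up * (1 - r / ρ)⁻¹ / low * (r / ρ) ^ k * low := by field_simp
    _ ≤ _ := by gcongr

/-- If every factor has relative error at most `ε / (4 m)` then the product of the inverses has
relative error at most `ε`. -/
theorem norm_one_sub_prod_inv_le {m : ℕ} {x : Fin m → ℂ} {ε : ℝ} (hε : 0 < ε) (hε1 : ε < 1)
    (hx : ∀ i, ‖x i - 1‖ ≤ ε / (4 * m)) : ‖1 - ∏ i, (x i)⁻¹‖ ≤ ε := by
  rcases Nat.eq_zero_or_pos m with rfl | hm
  · simp [hε.le]
  have hm' : (1 : ℝ) ≤ m := by exact_mod_cast hm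
  have hsmall : ε / (4 * m) ≤ 1 / 2 := by
    rw [div_le_iff₀ (by positivity)]; nlinarith
  -- Passing to the inverse at most doubles the error, since `|x i| ≥ 1/2`.
  have hy : ∀ i, ‖(x i)⁻¹ - 1‖ ≤ ε / (2 * m) := by
    intro i
    have h1 := hx i
    have h2 : 1 / 2 ≤ ‖x i‖ := by
      have := norm_sub_norm_le (1 : ℂ) (1 - x i)
      rw [sub_sub_cancel, norm_one, norm_sub_rev] at this
      linarith
    have h3 : x i ≠ 0 := by
      intro h; rw [h, norm_zero] at h2; norm_num at h2
    have h4 : (x i)⁻¹ - 1 = -(x i - 1) / x i := by field_simp; ring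
    rw [h4, norm_div, norm_neg, div_le_iff₀ (norm_pos_iff.2 h3)]
    calc ‖x i - 1‖ ≤ ε / (4 * m) := h1
      _ = ε / (2 * m) * (1 / 2) := by field_simp; norm_num
      _ ≤ _ := by gcongr
  have key := Finset.norm_prod_one_add_sub_one_le Finset.univ (fun i => (x i)⁻¹ - 1)
  simp only [add_sub_cancel] at key
  rw [norm_sub_rev]
  refine key.trans ?_
  have hsum : ∑ i, ‖(x i)⁻¹ - 1‖ ≤ ε / 2 := by
    refine (Finset.sum_le_sum fun i _ => hy i).trans_eq ?_
    rw [Finset.sum_const, Finset.card_univ, Fintype.card_fin, nsmul_eq_mul]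
    field_simp
  -- The error of the product is at most `exp (ε/2) - 1`, which is at most `2 (ε/2) = ε`.
  have h5 := Real.abs_exp_sub_one_le (x := ε / 2) (by rw [abs_of_pos (by positivity)]; linarith)
  rw [abs_of_pos (show 0 < ε / 2 by positivity)] at h5
  have h6 := Real.exp_le_exp.2 hsum
  have h7 := le_abs_self (Real.exp (ε / 2) - 1)
  linarith

/-! ### Spin sums with vertex fields and the recursion for marginal ratios -/

section SpinSum

variable {V : Type*} [LinearOrder V] {R : Type*} [CommRing R]

open Classical in
/-- The weight of the edges inside `U` when `A` is the set of vertices with spin `+`. -/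
noncomputable def pairWeight (G : SimpleGraph V) (b : R) (U A : Finset V) : R :=
  ∏ x ∈ U, ∏ y ∈ U, if x < y ∧ G.Adj x y ∧ (x ∈ A ↔ y ∈ A) then b else 1

/-- The partition function on `U` where a vertex `x` has weight `p x` for the spin `+` and weight
`q x` for the spin `-`. -/
noncomputable def spinSum (G : SimpleGraph V) (b : R) (U : Finset V) (p q : V → R) : R :=
  ∑ A ∈ U.powerset, pairWeight G b U A * ((∏ x ∈ A, p x) * ∏ x ∈ U \ A, q x)

open Classical in
/-- Multiply the values at the neighbours of `v` by `b`. -/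
noncomputable def bump (G : SimpleGraph V) (b : R) (v : V) (p : V → R) (x : V) : R :=
  if G.Adj v x then b * p x else p x

theorem spinSum_congr (G : SimpleGraph V) (b : R) {U : Finset V} {p q p' q' : V → R}
    (hp : ∀ x ∈ U, p x = p' x) (hq : ∀ x ∈ U, q x = q' x) :
    spinSum G b U p q = spinSum G b U p' q' := by
  refine Finset.sum_congr rfl fun A hA => ?_
  rw [Finset.prod_congr rfl fun x hx => hp x (Finset.mem_powerset.1 hA hx),
    Finset.prod_congr rfl fun x hx => hq x (Finset.mem_sdiff.1 hx).1]

/-- The sum is defined over any commutative ring so that it can be read over `ℂ`, over polynomials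
and over power series. Evaluation, coercion and constant coefficient are ring homomorphisms that
connect these readings. -/
theorem map_spinSum {R' : Type*} [CommRing R'] (f : R →+* R') (G : SimpleGraph V) (b : R)
    (U : Finset V) (p q : V → R) :
    f (spinSum G b U p q) = spinSum G (f b) U (fun x => f (p x)) (fun x => f (q x)) := by
  simp only [spinSum, pairWeight, map_sum, map_mul, map_prod, apply_ite f, map_one]

open Classical in
theorem pairWeight_congr (G : SimpleGraph V) (b : R) {U A B : Finset V}
    (h : ∀ x ∈ U, x ∈ A ↔ x ∈ B) : pairWeight G b U A = pairWeight G b U B := by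
  refine Finset.prod_congr rfl fun x hx => Finset.prod_congr rfl fun y hy => ?_
  exact if_congr (by rw [h x hx, h y hy]) rfl rfl

open Classical in
theorem pairWeight_insert (G : SimpleGraph V) (b : R) {U : Finset V} {v : V} (hv : v ∉ U)
    (A : Finset V) :
    pairWeight G b (insert v U) A =
      (∏ x ∈ U, if G.Adj v x ∧ (v ∈ A ↔ x ∈ A) then b else 1) * pairWeight G b U A := by
  simp only [pairWeight, Finset.prod_insert hv, lt_irrefl, false_and, if_false, one_mul,
    Finset.prod_mul_distrib]
  rw [← mul_assoc, ← Finset.prod_mul_distrib]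
  congr 1
  refine Finset.prod_congr rfl fun x hx => ?_
  have hxv : x ≠ v := fun h => hv (h ▸ hx)
  simp only [G.adj_comm x v, iff_comm (a := x ∈ A)]
  rcases lt_or_gt_of_ne hxv with h | h
  · simp [h, h.not_gt]
  · simp [h, h.not_gt]

theorem prod_bump (G : SimpleGraph V) (b : R) (v : V) (p : V → R) (A : Finset V) :
    ∏ x ∈ A, bump G b v p x =
      haveI := Classical.decRel G.Adj
      (∏ x ∈ A, if G.Adj v x then b else 1) * ∏ x ∈ A, p x := by
  rw [← Finset.prod_mul_distrib]
  refine Finset.prod_congr rfl fun x _ => ?_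
  unfold bump
  split_ifs <;> simp

/-- Expansion of the partition function according to the spin of one vertex. -/
theorem spinSum_insert (G : SimpleGraph V) (b : R) {U : Finset V} {v : V} (hv : v ∉ U)
    (p q : V → R) :
    spinSum G b (insert v U) p q =
      p v * spinSum G b U (bump G b v p) q + q v * spinSum G b U p (bump G b v q) := by
  classical
  rw [spinSum, Finset.sum_powerset_insert hv, add_comm, spinSum, spinSum, Finset.mul_sum,
    Finset.mul_sum]
  congr 1
  · refine Finset.sum_congr rfl fun A hA => ?_
    have hAU := Finset.mem_powerset.1 hA
    have hvA : v ∉ A := fun h => hv (hAU h)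
    rw [pairWeight_insert G b hv, pairWeight_congr G b (A := insert v A) (B := A)
      (fun x hx => by
        have : x ≠ v := fun h => hv (h ▸ hx)
        simp [this]), Finset.prod_insert hvA, prod_bump,
      show insert v U \ insert v A = U \ A by
        ext x
        simp only [Finset.mem_sdiff, Finset.mem_insert]
        have : x ∈ U → x ≠ v := fun hx h => hv (h ▸ hx)
        tauto]
    have h1 : (∏ x ∈ U, if G.Adj v x ∧ (v ∈ insert v A ↔ x ∈ insert v A) then b else 1) =
        ∏ x ∈ A, if G.Adj v x then b else 1 := by
      rw [← Finset.prod_subset hAU]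
      · refine Finset.prod_congr rfl fun x hx => ?_
        simp [hx]
      · intro x hx hxA
        have : x ≠ v := fun h => hv (h ▸ hx)
        simp [this, hxA]
    rw [h1]
    ring_nf
  · refine Finset.sum_congr rfl fun A hA => ?_
    have hAU := Finset.mem_powerset.1 hA
    have hvA : v ∉ A := fun h => hv (hAU h)
    rw [pairWeight_insert G b hv, prod_bump,
      show insert v U \ A = insert v (U \ A) by rw [Finset.insert_sdiff_of_notMem _ hvA],
      Finset.prod_insert (by simp [hv])]
    have h1 : (∏ x ∈ U, if G.Adj v x ∧ (v ∈ A ↔ x ∈ A) then b else 1) =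
        ∏ x ∈ U \ A, if G.Adj v x then b else 1 := by
      rw [← Finset.prod_subset (Finset.sdiff_subset (s := U) (t := A))]
      · refine Finset.prod_congr rfl fun x hx => ?_
        simp [hvA, (Finset.mem_sdiff.1 hx).2]
      · intro x hx hxA
        have : x ∈ A := by simpa [hx] using hxA
        simp [this, hvA]
    rw [h1]
    ring_nf

theorem spinSum_erase (G : SimpleGraph V) (b : R) {U : Finset V} {v : V} (hv : v ∈ U)
    (p q : V → R) :
    spinSum G b U p q =
      p v * spinSum G b (U.erase v) (bump G b v p) q +
        q v * spinSum G b (U.erase v) p (bump G b v q) := by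
  rw [← spinSum_insert G b (Finset.notMem_erase v U), Finset.insert_erase hv]

theorem pairWeight_ne_zero [IsDomain R] (G : SimpleGraph V) {b : R} (hb : b ≠ 0)
    (U A : Finset V) : pairWeight G b U A ≠ 0 := by
  refine Finset.prod_ne_zero_iff.2 fun x _ => Finset.prod_ne_zero_iff.2 fun y _ => ?_
  split_ifs
  exacts [hb, one_ne_zero]

/-- If all `+` weights vanish, a single term survives: the product of an edge weight and the `-`
weights. -/
theorem spinSum_zero_ne_zero [IsDomain R] (G : SimpleGraph V) {b : R} (hb : b ≠ 0) (U : Finset V)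
    {p q : V → R} (hp : ∀ x ∈ U, p x = 0) (hq : ∀ x ∈ U, q x ≠ 0) : spinSum G b U p q ≠ 0 := by
  rw [spinSum, Finset.sum_eq_single ∅]
  · simp only [Finset.prod_empty, one_mul, Finset.sdiff_empty]
    exact mul_ne_zero (pairWeight_ne_zero G hb _ _) (Finset.prod_ne_zero_iff.2 hq)
  · intro A hA hne
    obtain ⟨x, hx⟩ := Finset.nonempty_iff_ne_empty.2 hne
    rw [Finset.prod_eq_zero hx (hp x (Finset.mem_powerset.1 hA hx)), zero_mul, mul_zero]
  · simp

end SpinSum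

section Ratio

open PowerSeries

variable {V : Type*} [LinearOrder V]

/-- The contribution of a child with ratio `r`. -/
noncomputable def edgeFactor (β : ℂ) (r : PowerSeries ℂ) : PowerSeries ℂ :=
  (C β * r + 1) * (r + C β)⁻¹

/-- The marginal ratio at `v ∉ U` in the spin system on `insert v U`. -/
noncomputable def spinRatio (G : SimpleGraph V) (β : ℂ) (U : Finset V) (p q : V → PowerSeries ℂ)
    (v : V) : PowerSeries ℂ :=
  p v * spinSum G (C β) U (bump G (C β) v p) q *
    (q v * spinSum G (C β) U p (bump G (C β) v q))⁻¹

theorem constantCoeff_bump_eq_zero (G : SimpleGraph V) (b : PowerSeries ℂ) (v : V)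
    {p : V → PowerSeries ℂ} {x : V} (hp : constantCoeff (p x) = 0) :
    constantCoeff (bump G b v p x) = 0 := by
  unfold bump
  split_ifs <;> simp [hp]

theorem constantCoeff_bump_ne_zero (G : SimpleGraph V) {b : PowerSeries ℂ} (v : V)
    {q : V → PowerSeries ℂ} (hb : constantCoeff b ≠ 0) {x : V} (hq : constantCoeff (q x) ≠ 0) :
    constantCoeff (bump G b v q x) ≠ 0 := by
  unfold bump
  split_ifs <;> simp [hq, hb]

/-- The inverse of a power series is a true inverse only if the constant coefficient is nonzero.
This provides that for the partition functions which occur as denominators. -/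
theorem constantCoeff_spinSum_ne_zero (G : SimpleGraph V) {b : PowerSeries ℂ}
    (hb : constantCoeff b ≠ 0) (U : Finset V) {p q : V → PowerSeries ℂ}
    (hp : ∀ x ∈ U, constantCoeff (p x) = 0) (hq : ∀ x ∈ U, constantCoeff (q x) ≠ 0) :
    constantCoeff (spinSum G b U p q) ≠ 0 := by
  rw [map_spinSum]
  exact spinSum_zero_ne_zero G hb U hp hq

theorem spinRatio_congr (G : SimpleGraph V) (β : ℂ) {U : Finset V} {p q p' q' : V → PowerSeries ℂ}
    {v : V} (hp : ∀ x ∈ U, p x = p' x) (hq : ∀ x ∈ U, q x = q' x) (hpv : p v = p' v)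
    (hqv : q v = q' v) : spinRatio G β U p q v = spinRatio G β U p' q' v := by
  unfold spinRatio
  rw [hpv, hqv, spinSum_congr G _ (p := bump G (C β) v p) (p' := bump G (C β) v p') (q := q)
    (q' := q') (fun x hx => by simp only [bump, hp x hx]) hq,
    spinSum_congr G _ (q := bump G (C β) v q) (q' := bump G (C β) v q') (p := p)
    (p' := p') hp (fun x hx => by simp only [bump, hq x hx])]

/-- If `P` and `Q` are the partition functions with spin `+` and `-` at the child, then `β P + Q`
and `P + β Q` are those where the edge to the child comes from a parent with spin `+` and `-`. The
contribution of the child is the quotient of these two. -/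
theorem edgeFactor_mul {β : ℂ} (hβ : β ≠ 0) {P Q : PowerSeries ℂ} (hP : constantCoeff P = 0)
    (hQ : constantCoeff Q ≠ 0) : edgeFactor β (P * Q⁻¹) * (P + C β * Q) = C β * P + Q := by
  have h1 : Q * Q⁻¹ = 1 := PowerSeries.mul_inv_cancel _ hQ
  have h2 : (P * Q⁻¹ + C β) * (P * Q⁻¹ + C β)⁻¹ = 1 :=
    PowerSeries.mul_inv_cancel _ (by simp [hP, hβ])
  unfold edgeFactor
  linear_combination (C β * P * Q⁻¹ + 1) * Q * h2 -
    (C β * P * Q⁻¹ + 1) * (P * Q⁻¹ + C β)⁻¹ * P * h1 + C β * P * h1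

open Classical in
/-- The recursion for the marginal ratio: the neighbours of `v` are switched one after another. -/
theorem spinRatio_eq_prod (G : SimpleGraph V) {β : ℂ} (hβ : β ≠ 0) {U : Finset V}
    {p q : V → PowerSeries ℂ} {v : V} (hp : ∀ x, constantCoeff (p x) = 0)
    (hq : ∀ x, constantCoeff (q x) ≠ 0) :
    spinRatio G β U p q v = p v * (q v)⁻¹ * ∏ x ∈ U.filter (fun x => G.Adj v x),
      edgeFactor β (spinRatio G β (U.erase x)
        (fun y => if G.Adj v y ∧ y < x then C β * p y else p y)
        (fun y => if G.Adj v y ∧ x < y then C β * q y else q y) x) := by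
  have hCβ : constantCoeff (C β) ≠ 0 := by simpa using hβ
  set N := U.filter (fun x => G.Adj v x) with hN
  set F : V → PowerSeries ℂ := fun x => edgeFactor β (spinRatio G β (U.erase x)
        (fun y => if G.Adj v y ∧ y < x then C β * p y else p y)
        (fun y => if G.Adj v y ∧ x < y then C β * q y else q y) x) with hF
  -- Each neighbour `y` of `v` sees its own copy of `v`, which has spin `+` if `y ∈ T` and `-`
  -- otherwise. All copies `+` gives the numerator of the marginal ratio, all copies `-` the
  -- denominator.
  let pT : Finset V → V → PowerSeries ℂ := fun T y => if y ∈ T then C β * p y else p y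
  let qT : Finset V → V → PowerSeries ℂ := fun T y => if G.Adj v y ∧ y ∉ T then C β * q y else q y
  -- Induction over the initial segments `T` of the neighbourhood. When the largest element `a` is
  -- added, the neighbours seeing `+` are exactly those below `a`, and those still seeing `-`
  -- exactly those above it, so the quotient of the two partition functions is `F a`.
  have claim : ∀ T : Finset V, T ⊆ N → (∀ y ∈ N, ∀ t ∈ T, y < t → y ∈ T) →
      spinSum G (C β) U (pT T) (qT T) = (∏ x ∈ T, F x) * spinSum G (C β) U (pT ∅) (qT ∅) := by
    intro T
    induction T using Finset.induction_on_max with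
    | empty => simp
    | insert a T hmax ih =>
      intro hTN hlow
      have haT : a ∉ T := fun h => lt_irrefl _ (hmax a h)
      have haN : a ∈ N := hTN (Finset.mem_insert_self _ _)
      have haU : a ∈ U := (Finset.mem_filter.1 haN).1
      have hav : G.Adj v a := (Finset.mem_filter.1 haN).2
      have ih' := ih (fun x hx => hTN (Finset.mem_insert_of_mem hx)) (fun y hy t ht hyt => by
        have h1 := hlow y hy t (Finset.mem_insert_of_mem ht) hyt
        rcases Finset.mem_insert.1 h1 with rfl | h1
        · exact absurd (hmax t ht) hyt.not_gt
        · exact h1)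
      rw [Finset.prod_insert haT, mul_assoc, ← ih', spinSum_erase G (C β) haU,
        spinSum_erase G (C β) haU (pT T)]
      set p' : V → PowerSeries ℂ := fun y => if G.Adj v y ∧ y < a then C β * p y else p y with hp'
      set q' : V → PowerSeries ℂ := fun y => if G.Adj v y ∧ a < y then C β * q y else q y with hq'
      -- Away from `a`, the initial segment `T` consists of the neighbours of `v` below `a`. Hence
      -- the fields for `T` and for `insert a T` agree there with `p'` and `q'`, and only the
      -- weights at `a` itself change.
      have hmem : ∀ y ∈ U.erase a, (y ∈ T ↔ G.Adj v y ∧ y < a) := by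
        intro y hy
        obtain ⟨hya, hyU⟩ := Finset.mem_erase.1 hy
        constructor
        · intro h
          exact ⟨(Finset.mem_filter.1 (hTN (Finset.mem_insert_of_mem h))).2, hmax y h⟩
        · rintro ⟨h1, h2⟩
          exact (Finset.mem_insert.1 (hlow y (Finset.mem_filter.2 ⟨hyU, h1⟩) a
            (Finset.mem_insert_self _ _) h2)).resolve_left hya
      have e1 : ∀ y ∈ U.erase a, pT T y = p' y := fun y hy => by
        simp only [pT, hp', hmem y hy]
      have e2 : ∀ y ∈ U.erase a, pT (insert a T) y = p' y := fun y hy => by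
        have := (Finset.mem_erase.1 hy).1
        simp only [pT, hp', Finset.mem_insert, this, false_or, hmem y hy]
      have hlt : ∀ y ∈ U.erase a, (G.Adj v y ∧ y ∉ T ↔ G.Adj v y ∧ a < y) := by
        intro y hy
        have h1 := (Finset.mem_erase.1 hy).1
        rw [hmem y hy]
        have h2 : a < y ↔ ¬ y < a := ⟨fun h => h.not_gt, fun h => lt_of_le_of_ne (not_lt.1 h) h1.symm⟩
        tauto
      have e3 : ∀ y ∈ U.erase a, qT T y = q' y := fun y hy => by
        simp only [qT, hq', hlt y hy]
      have e4 : ∀ y ∈ U.erase a, qT (insert a T) y = q' y := fun y hy => by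
        have h1 := (Finset.mem_erase.1 hy).1
        simp only [qT, hq', Finset.mem_insert, h1, false_or, hlt y hy]
      have b1 : ∀ y ∈ U.erase a, bump G (C β) a (pT T) y = bump G (C β) a p' y := fun y hy => by
        simp only [bump, e1 y hy]
      have b2 : ∀ y ∈ U.erase a, bump G (C β) a (pT (insert a T)) y = bump G (C β) a p' y :=
        fun y hy => by simp only [bump, e2 y hy]
      have b3 : ∀ y ∈ U.erase a, bump G (C β) a (qT T) y = bump G (C β) a q' y := fun y hy => by
        simp only [bump, e3 y hy]
      have b4 : ∀ y ∈ U.erase a, bump G (C β) a (qT (insert a T)) y = bump G (C β) a q' y :=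
        fun y hy => by simp only [bump, e4 y hy]
      rw [spinSum_congr G _ b2 e4, spinSum_congr G _ e2 b4, spinSum_congr G _ b1 e3,
        spinSum_congr G _ e1 b3]
      have v1 : pT T a = p a := by simp [pT, haT]
      have v2 : pT (insert a T) a = C β * p a := by simp [pT]
      have v3 : qT T a = C β * q a := by simp [qT, haT, hav]
      have v4 : qT (insert a T) a = q a := by simp [qT]
      have hFa : F a = edgeFactor β ((p a * spinSum G (C β) (U.erase a) (bump G (C β) a p') q') *
          (q a * spinSum G (C β) (U.erase a) p' (bump G (C β) a q'))⁻¹) := by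
        simp only [hF, spinRatio, hp', hq', lt_irrefl, and_false, if_false]
      have hp'0 : ∀ y, constantCoeff (p' y) = 0 := fun y => by
        simp only [hp']; split_ifs <;> simp [hp y]
      have hq'0 : ∀ y, constantCoeff (q' y) ≠ 0 := fun y => by
        simp only [hq']; split_ifs <;> simp [hq y, hβ]
      rw [v1, v2, v3, v4, hFa]
      have := edgeFactor_mul hβ
        (P := p a * spinSum G (C β) (U.erase a) (bump G (C β) a p') q')
        (Q := q a * spinSum G (C β) (U.erase a) p' (bump G (C β) a q'))
        (by rw [map_mul, hp a, zero_mul])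
        (by
          rw [map_mul]
          exact mul_ne_zero (hq a) (constantCoeff_spinSum_ne_zero G hCβ _ (fun x _ => hp'0 x)
            fun x _ => constantCoeff_bump_ne_zero G a hCβ (hq'0 x)))
      linear_combination -this
  have key := claim N subset_rfl (fun y hy _ _ _ => hy)
  have c1 : spinSum G (C β) U (pT N) (qT N) = spinSum G (C β) U (bump G (C β) v p) q :=
    spinSum_congr G _ (fun x hx => by simp [pT, hN, bump, hx])
      (fun x hx => by
        have : ¬ (G.Adj v x ∧ x ∉ N) := by simp [hN, hx]
        simp only [qT, if_neg this])
  have c2 : spinSum G (C β) U (pT ∅) (qT ∅) = spinSum G (C β) U p (bump G (C β) v q) :=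
    spinSum_congr G _ (fun x hx => by simp [pT]) (fun x hx => by simp [qT, bump])
  rw [c1, c2] at key
  have hS : constantCoeff (spinSum G (C β) U p (bump G (C β) v q)) ≠ 0 :=
    constantCoeff_spinSum_ne_zero G hCβ _ (fun x _ => hp x)
      fun x _ => constantCoeff_bump_ne_zero G v hCβ (hq x)
  rw [spinRatio, key, PowerSeries.mul_inv_rev]
  have := PowerSeries.mul_inv_cancel _ hS
  linear_combination (p v * (q v)⁻¹ * ∏ x ∈ N, F x) * this

end Ratio

/-! ### Correctness of the recursion on the self-avoiding walk tree -/

section Saw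

open PowerSeries

/-- Congruences modulo `d` pass to quotients with invertible denominators. Used with powers of `X`,
this carries agreement of the first coefficients through the recursion. -/
theorem dvd_mul_inv_sub_mul_inv {d M M' D D' : PowerSeries ℂ} (hM : d ∣ M - M') (hD : d ∣ D - D')
    (h : constantCoeff D ≠ 0) (h' : constantCoeff D' ≠ 0) : d ∣ M * D⁻¹ - M' * D'⁻¹ := by
  have h1 := PowerSeries.mul_inv_cancel _ h
  have h2 := PowerSeries.mul_inv_cancel _ h'
  have : M * D⁻¹ - M' * D'⁻¹ = (M - M') * D⁻¹ - (D - D') * (M' * D⁻¹ * D'⁻¹) := by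
    linear_combination M' * D'⁻¹ * h1 - M' * D⁻¹ * h2
  rw [this]
  exact dvd_sub (hM.mul_right _) (hD.mul_right _)

theorem dvd_edgeFactor_sub {β : ℂ} (hβ : β ≠ 0) {d A B : PowerSeries ℂ} (h : d ∣ A - B)
    (hA : constantCoeff A = 0) (hB : constantCoeff B = 0) :
    d ∣ edgeFactor β A - edgeFactor β B := by
  refine dvd_mul_inv_sub_mul_inv ?_ ?_ (by simp [hA, hβ]) (by simp [hB, hβ])
  · have : C β * A + 1 - (C β * B + 1) = (A - B) * C β := by ring
    rw [this]; exact h.mul_right _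
  · simpa using h

theorem dvd_prod_sub_prod {R ι : Type*} [CommRing R] (d : R) (s : Finset ι) {f g : ι → R}
    (h : ∀ i ∈ s, d ∣ f i - g i) : d ∣ ∏ i ∈ s, f i - ∏ i ∈ s, g i := by
  classical
  induction s using Finset.induction_on with
  | empty => simp
  | insert a s ha ih =>
    rw [Finset.prod_insert ha, Finset.prod_insert ha]
    have : f a * ∏ i ∈ s, f i - g a * ∏ i ∈ s, g i =
        (f a - g a) * ∏ i ∈ s, f i + (∏ i ∈ s, f i - ∏ i ∈ s, g i) * g a := by ring
    rw [this]
    exact dvd_add ((h a (Finset.mem_insert_self _ _)).mul_right _)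
      ((ih fun i hi => h i (Finset.mem_insert_of_mem hi)).mul_right _)

variable {V : Type*} [Fintype V] [LinearOrder V]

open Classical in
/-- Whether the leaf at `w` below the vertex `x` has spin `+`, for the walk `l`. -/
def sawPlus (u : V) (s : Bool) (l : List V) (w x : V) : Prop :=
  if w = u then s = true else x < stepAfter w l

open Classical in
/-- The neighbours of `x` which are pinned or on the walk `v :: p`. -/
noncomputable def sawBoundary (G : SimpleGraph V) (u v : V) (p : List V) (x : V) : Finset V :=
  (G.neighborFinset x).filter fun w => (w = u ∨ w ∈ p) ∧ ¬ (x = v ∧ p.head? = some w)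

open Classical in
/-- The field of the spin `+` in the spin system at the walk `v :: p`. -/
noncomputable def sawP (G : SimpleGraph V) (β : ℂ) (u : V) (s : Bool) (v : V) (p : List V) (x : V) :
    PowerSeries ℂ :=
  X * ∏ w ∈ sawBoundary G u v p x, if sawPlus u s (v :: p) w x then C β else 1

open Classical in
/-- The field of the spin `-` in the spin system at the walk `v :: p`. -/
noncomputable def sawQ (G : SimpleGraph V) (β : ℂ) (u : V) (s : Bool) (v : V) (p : List V) (x : V) :
    PowerSeries ℂ :=
  ∏ w ∈ sawBoundary G u v p x, if sawPlus u s (v :: p) w x then 1 else C β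

theorem constantCoeff_sawP (G : SimpleGraph V) (β : ℂ) (u : V) (s : Bool) (v : V) (p : List V)
    (x : V) : constantCoeff (sawP G β u s v p x) = 0 := by
  simp [sawP]

theorem constantCoeff_sawQ (G : SimpleGraph V) {β : ℂ} (hβ : β ≠ 0) (u : V) (s : Bool) (v : V)
    (p : List V) (x : V) : constantCoeff (sawQ G β u s v p x) ≠ 0 := by
  rw [sawQ, map_prod, Finset.prod_ne_zero_iff]
  intro w _
  split_ifs <;> simp [hβ]

-- A neighbour with a fixed spin is absorbed into the fields: it multiplies the `+` field by `β` or
-- the `-` field by `β`. In the quotient this is the leaf factor `β` or `1/β`.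
open Classical in
theorem sawP_mul_inv_sawQ (G : SimpleGraph V) {β : ℂ} (hβ : β ≠ 0) (u : V) (s : Bool) (v : V)
    (p : List V) (x : V) :
    sawP G β u s v p x * (sawQ G β u s v p x)⁻¹ =
      X * ∏ w ∈ sawBoundary G u v p x, if sawPlus u s (v :: p) w x then C β else C β⁻¹ := by
  symm
  rw [PowerSeries.eq_mul_inv_iff_mul_eq (constantCoeff_sawQ G hβ u s v p x), sawP, sawQ, mul_assoc,
    ← Finset.prod_mul_distrib]
  congr 1
  refine Finset.prod_congr rfl fun w _ => ?_
  split_ifs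
  · simp
  · rw [← map_mul, inv_mul_cancel₀ hβ, map_one]

-- When the walk moves from `v` to `w`, the vertex `v` becomes a fixed neighbour of each of its
-- other neighbours. The exception is `x = w`, because the edge back from `w` to `v` has already
-- been used.
open Classical in
theorem prod_sawBoundary_cons (G : SimpleGraph V) {u v w x : V} {p : List V} (hvu : v ≠ u)
    (hvp : v ∉ p) (hxv : x ≠ v) (g : V → PowerSeries ℂ) :
    ∏ y ∈ sawBoundary G u w (v :: p) x, g y =
      (if G.Adj v x ∧ x ≠ w then g v else 1) * ∏ y ∈ sawBoundary G u v p x, g y := by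
  have hnot : v ∉ sawBoundary G u v p x := by simp [sawBoundary, hvu, hvp]
  by_cases h : G.Adj v x ∧ x ≠ w
  · rw [if_pos h, ← Finset.prod_insert hnot]
    refine Finset.prod_congr ?_ fun _ _ => rfl
    ext y
    simp only [sawBoundary, Finset.mem_filter, SimpleGraph.mem_neighborFinset, Finset.mem_insert,
      List.mem_cons, List.head?_cons, hxv, h.2, false_and, not_false_iff, and_true]
    constructor
    · rintro ⟨h1, h2 | h2 | h2⟩
      · exact Or.inr ⟨h1, Or.inl h2⟩
      · exact Or.inl h2
      · exact Or.inr ⟨h1, Or.inr h2⟩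
    · rintro (rfl | ⟨h1, h2 | h2⟩)
      · exact ⟨h.1.symm, Or.inr (Or.inl rfl)⟩
      · exact ⟨h1, Or.inl h2⟩
      · exact ⟨h1, Or.inr (Or.inr h2)⟩
  · rw [if_neg h, one_mul]
    refine Finset.prod_congr ?_ fun _ _ => rfl
    ext y
    simp only [sawBoundary, Finset.mem_filter, SimpleGraph.mem_neighborFinset,
      List.mem_cons, List.head?_cons, hxv, false_and, not_false_iff, and_true, Option.some.injEq]
    constructor
    · rintro ⟨h1, h2, h3⟩
      refine ⟨h1, ?_⟩
      rcases h2 with h2 | rfl | h2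
      · exact Or.inl h2
      · exact absurd ⟨h1.symm, fun h4 => h3 ⟨h4, rfl⟩⟩ h
      · exact Or.inr h2
    · rintro ⟨h1, h2⟩
      have hyv : v ≠ y := by
        rintro rfl
        rcases h2 with h2 | h2
        · exact hvu h2
        · exact hvp h2
      refine ⟨h1, ?_, fun h3 => hyv h3.2⟩
      rcases h2 with h2 | h2
      · exact Or.inl h2
      · exact Or.inr (Or.inr h2)

/-- A further step of the walk does not change the vertex through which it left an older vertex, so
the spins of older leaves persist along the walk. -/
theorem sawPlus_cons_cons {u v w x y : V} {s : Bool} {p : List V} (hyv : v ≠ y) :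
    sawPlus u s (w :: v :: p) y x ↔ sawPlus u s (v :: p) y x := by
  classical
  unfold sawPlus
  rw [stepAfter]
  simp only [if_neg hyv]

theorem sawPlus_cons_self {u v w x : V} {s : Bool} {p : List V} (hvu : v ≠ u) :
    sawPlus u s (w :: v :: p) v x ↔ x < w := by
  unfold sawPlus
  rw [stepAfter]
  simp [hvu]

theorem ne_of_mem_sawBoundary {G : SimpleGraph V} {u v x y : V} {p : List V} (hvu : v ≠ u)
    (hvp : v ∉ p) (hy : y ∈ sawBoundary G u v p x) : v ≠ y := by
  classical
  rintro rfl
  simp [sawBoundary, hvu, hvp] at hy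

-- The fields change exactly as in `spinRatio_eq_prod`: neighbours of `v` below `w` see a copy of
-- `v` with spin `+`, those above it (in `sawQ_cons`) a copy with spin `-`. This is where the
-- ordering rule for closing a cycle comes from.
open Classical in
theorem sawP_cons (G : SimpleGraph V) (β : ℂ) {u v w x : V} (s : Bool) {p : List V} (hvu : v ≠ u)
    (hvp : v ∉ p) (hxv : x ≠ v) :
    sawP G β u s w (v :: p) x =
      if G.Adj v x ∧ x < w then C β * sawP G β u s v p x else sawP G β u s v p x := by
  rw [sawP, prod_sawBoundary_cons G hvu hvp hxv, sawP]
  simp only [sawPlus_cons_self hvu]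
  rw [Finset.prod_congr rfl fun y hy => if_congr
    (sawPlus_cons_cons (u := u) (w := w) (x := x) (s := s) (p := p)
      (ne_of_mem_sawBoundary hvu hvp hy)) rfl rfl]
  by_cases h1 : x < w
  · by_cases h2 : G.Adj v x
    · simp only [h1, h2, h1.ne, ne_eq, not_false_iff, and_self, if_true]; ring
    · simp [h2]
  · simp [h1]

open Classical in
theorem sawQ_cons (G : SimpleGraph V) (β : ℂ) {u v w x : V} (s : Bool) {p : List V} (hvu : v ≠ u)
    (hvp : v ∉ p) (hxv : x ≠ v) :
    sawQ G β u s w (v :: p) x =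
      if G.Adj v x ∧ w < x then C β * sawQ G β u s v p x else sawQ G β u s v p x := by
  rw [sawQ, prod_sawBoundary_cons G hvu hvp hxv, sawQ]
  simp only [sawPlus_cons_self hvu]
  rw [Finset.prod_congr rfl fun y hy => if_congr
    (sawPlus_cons_cons (u := u) (w := w) (x := x) (s := s) (p := p)
      (ne_of_mem_sawBoundary hvu hvp hy)) rfl rfl]
  by_cases h1 : w < x
  · by_cases h2 : G.Adj v x
    · simp [h1, h2, h1.ne', h1.not_gt]
    · simp [h2]
  · by_cases h3 : x = w
    · simp [h3]
    · have h4 : x < w := lt_of_le_of_ne (not_lt.1 h1) h3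
      simp [h1, h4]

theorem constantCoeff_sawRatio (G : SimpleGraph V) (β : ℝ) (u : V) (s : Bool) (k : ℕ)
    (l : List V) : constantCoeff (sawRatio G β u s k l) = 0 := by
  cases k with
  | zero => cases l <;> simp [sawRatio]
  | succ k => cases l <;> simp [sawRatio]

open Classical in
/-- The vertices which are neither pinned nor on the walk. -/
noncomputable def sawRest (u : V) (l : List V) : Finset V :=
  Finset.univ.filter fun y => y ≠ u ∧ y ∉ l

/-- The recursion cut off at depth `k` agrees with the marginal ratio up to order `k`. -/
theorem X_pow_dvd_spinRatio_sub_sawRatio (G : SimpleGraph V) {β : ℝ} (hβ : β ≠ 0) (u : V) (s : Bool)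
    (k : ℕ) (v : V) (p : List V) (hnd : (v :: p).Nodup) (hu : u ∉ v :: p) :
    X ^ (k + 1) ∣ spinRatio G β (sawRest u (v :: p)) (sawP G β u s v p) (sawQ G β u s v p) v -
      sawRatio G β u s k (v :: p) := by
  classical
  have hb : (β : ℂ) ≠ 0 := by exact_mod_cast hβ
  induction k generalizing v p with
  | zero =>
    -- The `+` field contains the factor `X`, so a marginal ratio agrees with `0` in degree `0`.
    rw [sawRatio, sub_zero, spinRatio, sawP]
    simp only [zero_add, pow_one, mul_assoc]
    exact Dvd.intro _ rfl
  | succ k ih =>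
    have hvu : v ≠ u := fun h => hu (by simp [h])
    have hvp : v ∉ p := (List.nodup_cons.1 hnd).1
    rw [spinRatio_eq_prod G hb (constantCoeff_sawP G β u s v p)
      (constantCoeff_sawQ G hb u s v p), sawP_mul_inv_sawQ G hb]
    simp only [sawRatio]
    rw [← Finset.prod_filter_mul_prod_filter_not
      ((G.neighborFinset v).filter fun w => p.head? ≠ some w) (fun w => w = u ∨ w ∈ p)]
    -- The neighbours other than the step back are split into leaves with a fixed spin (`hB`),
    -- absorbed in the fields, and free vertices (`hN`), which are the children.
    have hB : (((G.neighborFinset v).filter fun w => p.head? ≠ some w).filter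
        fun w => w = u ∨ w ∈ p) = sawBoundary G u v p v := by
      ext w
      simp only [sawBoundary, Finset.mem_filter, true_and]
      tauto
    have hN : (((G.neighborFinset v).filter fun w => p.head? ≠ some w).filter
        fun w => ¬ (w = u ∨ w ∈ p)) = (sawRest u (v :: p)).filter fun x => G.Adj v x := by
      ext w
      simp only [sawRest, Finset.mem_filter, SimpleGraph.mem_neighborFinset, Finset.mem_univ,
        true_and, List.mem_cons, not_or]
      constructor
      · rintro ⟨⟨h1, -⟩, h2, h3⟩
        exact ⟨⟨h2, h1.ne', h3⟩, h1⟩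
      · rintro ⟨⟨h1, h2, h3⟩, h4⟩
        exact ⟨⟨h4, fun h => h3 (List.mem_of_mem_head? h)⟩, h1, h3⟩
    rw [hB, hN, ← mul_assoc]
    have hbdry : ∀ (g : V → PowerSeries ℂ), (∏ w ∈ sawBoundary G u v p v,
        if w = u then (if s = true then C (β : ℂ) else C (β : ℂ)⁻¹)
        else if w ∈ p then
          (if v < stepAfter w (v :: p) then C (β : ℂ) else C (β : ℂ)⁻¹)
        else g w) =
        ∏ w ∈ sawBoundary G u v p v,
          if sawPlus u s (v :: p) w v then C (β : ℂ) else C (β : ℂ)⁻¹ := by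
      intro g
      refine Finset.prod_congr rfl fun w hw => ?_
      have h1 := (Finset.mem_filter.1 hw).2.1
      unfold sawPlus
      by_cases hwu : w = u
      · simp only [hwu, if_true]
      · simp only [hwu, if_false, h1.resolve_left hwu, if_true]
    -- The factor `X` of this level supplies the additional order, so it suffices that the products
    -- over the children agree to the order given by the induction hypothesis.
    rw [hbdry, ← mul_sub, pow_succ', mul_assoc]
    refine mul_dvd_mul_left X (Dvd.dvd.mul_left ?_ _)
    refine dvd_prod_sub_prod _ _ fun w hw => ?_
    obtain ⟨hw1, hw2⟩ := Finset.mem_filter.1 hw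
    obtain ⟨hwu, hwl⟩ := (Finset.mem_filter.1 hw1).2
    obtain ⟨hwv, hwp⟩ : w ≠ v ∧ w ∉ p := by simpa using hwl
    rw [if_neg hwu, if_neg hwp]
    have hrest : sawRest u (w :: v :: p) = (sawRest u (v :: p)).erase w := by
      ext y
      simp only [sawRest, Finset.mem_filter, Finset.mem_univ, true_and, List.mem_cons,
        Finset.mem_erase, not_or]
      tauto
    have ih' := ih w (v :: p) (List.nodup_cons.2 ⟨hwl, hnd⟩) (by
      rw [List.mem_cons, not_or]; exact ⟨fun h => hwu h.symm, hu⟩)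
    have hmemv : ∀ x ∈ (sawRest u (v :: p)).erase w, x ≠ v := by
      intro x hx
      have := (Finset.mem_filter.1 (Finset.mem_erase.1 hx).2).2.2
      simp only [List.mem_cons, not_or] at this
      exact this.1
    -- The system at the child walk is the system that the recursion attaches to the neighbour `w`,
    -- which makes the induction hypothesis applicable.
    have hcongr : spinRatio G β (sawRest u (w :: v :: p)) (sawP G β u s w (v :: p))
        (sawQ G β u s w (v :: p)) w =
        spinRatio G β ((sawRest u (v :: p)).erase w)
          (fun y => if G.Adj v y ∧ y < w then C (β : ℂ) * sawP G β u s v p y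
            else sawP G β u s v p y)
          (fun y => if G.Adj v y ∧ w < y then C (β : ℂ) * sawQ G β u s v p y
            else sawQ G β u s v p y) w := by
      rw [hrest]
      exact spinRatio_congr G β
        (fun x hx => sawP_cons G β s hvu hvp (hmemv x hx))
        (fun x hx => sawQ_cons G β s hvu hvp (hmemv x hx))
        (sawP_cons G β s hvu hvp hwv) (sawQ_cons G β s hvu hvp hwv)
    rw [← hcongr]
    refine dvd_edgeFactor_sub hb ih' ?_ (constantCoeff_sawRatio G β u s k _)
    rw [spinRatio, map_mul, map_mul, constantCoeff_sawP, zero_mul, zero_mul]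

theorem bump_comm (G : SimpleGraph V) (b : PowerSeries ℂ) (u v : V) (p : V → PowerSeries ℂ) :
    bump G b u (bump G b v p) = bump G b v (bump G b u p) := by
  funext x
  unfold bump
  split_ifs <;> ring

/-- For a walk of one vertex the pinned vertex is the only one on the boundary, and pinning it
multiplies one of the two fields at its neighbours by `β`. -/
theorem sawP_singleton (G : SimpleGraph V) (β : ℂ) (u : V) (s : Bool) (v : V) :
    sawP G β u s v [] = if s = true then bump G (C β) u (fun _ => X) else fun _ => X := by
  classical
  funext x
  have : sawBoundary G u v [] x = if G.Adj u x then {u} else ∅ := by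
    ext w
    simp only [sawBoundary, List.not_mem_nil, or_false, Finset.mem_filter,
      SimpleGraph.mem_neighborFinset, List.head?_nil, reduceCtorEq, and_false, not_false_iff,
      and_true]
    split_ifs with h
    · simp only [Finset.mem_singleton]
      exact ⟨fun h1 => h1.2, fun h1 => ⟨h1 ▸ h.symm, h1⟩⟩
    · simp only [Finset.notMem_empty, iff_false]
      rintro ⟨h1, rfl⟩
      exact h h1.symm
  rw [sawP, this]
  cases s <;> by_cases h : G.Adj u x <;> simp [bump, h, sawPlus, mul_comm]

theorem sawQ_singleton (G : SimpleGraph V) (β : ℂ) (u : V) (s : Bool) (v : V) :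
    sawQ G β u s v [] = if s = true then fun _ => 1 else bump G (C β) u (fun _ => 1) := by
  classical
  funext x
  have : sawBoundary G u v [] x = if G.Adj u x then {u} else ∅ := by
    ext w
    simp only [sawBoundary, List.not_mem_nil, or_false, Finset.mem_filter,
      SimpleGraph.mem_neighborFinset, List.head?_nil, reduceCtorEq, and_false, not_false_iff,
      and_true]
    split_ifs with h
    · simp only [Finset.mem_singleton]
      exact ⟨fun h1 => h1.2, fun h1 => ⟨h1 ▸ h.symm, h1⟩⟩
    · simp only [Finset.notMem_empty, iff_false]
      rintro ⟨h1, rfl⟩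
      exact h h1.symm
  rw [sawQ, this]
  cases s <;> by_cases h : G.Adj u x <;> simp [bump, h, sawPlus]

/-- The partition function as a power series in the field. -/
noncomputable def seriesZ (G : SimpleGraph V) (β : ℂ) : PowerSeries ℂ :=
  spinSum G (C β) Finset.univ (fun _ => X) (fun _ => 1)

theorem constantCoeff_seriesZ (G : SimpleGraph V) {β : ℂ} (hβ : β ≠ 0) :
    constantCoeff (seriesZ G β) ≠ 0 :=
  constantCoeff_spinSum_ne_zero G (by simpa using hβ) _ (fun _ _ => by simp) fun _ _ => by simp

/-- The four terms are the spins `++`, `+-`, `-+`, `--` at `u`, `v`. The edge between `u` and `v` is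
accounted for by the `bump` evaluated at `v`, so the formula serves both the graph and the graph
with that edge deleted. -/
theorem seriesZ_expand (G : SimpleGraph V) (β : ℂ) {u v : V} (huv : u ≠ v) :
    seriesZ G β =
      X * (bump G (C β) u (fun _ => X) v *
          spinSum G (C β) (sawRest u [v]) (bump G (C β) v (bump G (C β) u fun _ => X)) (fun _ => 1) +
        spinSum G (C β) (sawRest u [v]) (bump G (C β) u fun _ => X)
          (bump G (C β) v fun _ => 1)) +
      (X * spinSum G (C β) (sawRest u [v]) (bump G (C β) v fun _ => X) (bump G (C β) u fun _ => 1) +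
        bump G (C β) u (fun _ => 1) v *
          spinSum G (C β) (sawRest u [v]) (fun _ => X)
            (bump G (C β) v (bump G (C β) u fun _ => 1))) := by
  classical
  have h1 : (Finset.univ.erase u).erase v = sawRest u [v] := by
    ext y; simp [sawRest, and_comm]
  rw [seriesZ, spinSum_erase G _ (Finset.mem_univ u),
    spinSum_erase G _ (v := v) (Finset.mem_erase.2 ⟨huv.symm, Finset.mem_univ v⟩),
    spinSum_erase G _ (v := v) (Finset.mem_erase.2 ⟨huv.symm, Finset.mem_univ v⟩), h1]
  ring

theorem spinSum_deleteEdges (G : SimpleGraph V) (b : PowerSeries ℂ) {u v : V} (U : Finset V)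
    (hu : u ∉ U) (p q : V → PowerSeries ℂ) :
    spinSum (G.deleteEdges {s(u, v)}) b U p q = spinSum G b U p q := by
  classical
  refine Finset.sum_congr rfl fun A _ => ?_
  congr 1
  refine Finset.prod_congr rfl fun x hx => Finset.prod_congr rfl fun y hy => ?_
  have h1 : x ≠ u := fun h => hu (h ▸ hx)
  have h2 : y ≠ u := fun h => hu (h ▸ hy)
  simp [SimpleGraph.deleteEdges_adj, h1, h2]

/-- The power series of the edge-deletion ratio agrees with the value computed on the
self-avoiding walk trees of depth `k` up to order `k`. -/
theorem X_pow_dvd_seriesZ_div_sub_sawEdgeRatio (G : SimpleGraph V) {β : ℝ} (hβ : β ≠ 0) {u v : V}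
    (huv : G.Adj u v) (k : ℕ) :
    X ^ (k + 1) ∣ seriesZ (G.deleteEdges {s(u, v)}) β * (seriesZ G β)⁻¹ -
      sawEdgeRatio G β u v k := by
  classical
  have hb : (β : ℂ) ≠ 0 := by exact_mod_cast hβ
  have hCb : constantCoeff (C (β : ℂ)) ≠ 0 := by simpa using hb
  have hne : u ≠ v := huv.ne
  have hrest : sawRest v [u] = sawRest u [v] := by ext y; simp [sawRest, and_comm]
  set U := sawRest u [v] with hU
  have huU : u ∉ U := by simp [hU, sawRest]
  have hvU : v ∉ U := by simp [hU, sawRest]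
  set b : PowerSeries ℂ := C (β : ℂ) with hbdef
  -- The signs are the spins of `u` and `v`, in this order. The sums run over the other vertices and
  -- do not involve the edge `uv`.
  set Spp := spinSum G b U (bump G b v (bump G b u fun _ => X)) (fun _ => 1) with hSpp
  set Spm := spinSum G b U (bump G b u fun _ => X) (bump G b v fun _ => 1) with hSpm
  set Smp := spinSum G b U (bump G b v fun _ => X) (bump G b u fun _ => 1) with hSmp
  set Smm := spinSum G b U (fun _ => X) (bump G b v (bump G b u fun _ => 1)) with hSmm
  have hX0 : ∀ x : V, constantCoeff ((fun _ => X : V → PowerSeries ℂ) x) = 0 := fun x => by simp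
  have h10 : ∀ x : V, constantCoeff ((fun _ => 1 : V → PowerSeries ℂ) x) ≠ 0 := fun x => by simp
  have cSpm : constantCoeff Spm ≠ 0 := constantCoeff_spinSum_ne_zero G hCb _
    (fun x _ => constantCoeff_bump_eq_zero G _ _ (hX0 x))
    (fun x _ => constantCoeff_bump_ne_zero G _ hCb (h10 x))
  have cSmm : constantCoeff Smm ≠ 0 := constantCoeff_spinSum_ne_zero G hCb _
    (fun x _ => hX0 x)
    (fun x _ => constantCoeff_bump_ne_zero G _ hCb (constantCoeff_bump_ne_zero G _ hCb (h10 x)))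
  have hZ : seriesZ G β = X * (b * X * Spp + Spm) + (X * Smp + b * Smm) := by
    rw [seriesZ_expand G β hne]
    simp only [bump, huv, if_true, mul_one]
    rfl
  have hZ' : seriesZ (G.deleteEdges {s(u, v)}) β = X * (X * Spp + Spm) + (X * Smp + Smm) := by
    have hnadj : ¬ (G.deleteEdges {s(u, v)}).Adj u v := by simp
    have hadj : ∀ x ∈ U, ((G.deleteEdges {s(u, v)}).Adj u x ↔ G.Adj u x) := by
      intro x hx
      have h1 : x ≠ u := fun h => huU (h ▸ hx)
      have h2 : x ≠ v := fun h => hvU (h ▸ hx)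
      simp [SimpleGraph.deleteEdges_adj, h1, h2]
    have hadj' : ∀ x ∈ U, ((G.deleteEdges {s(u, v)}).Adj v x ↔ G.Adj v x) := by
      intro x hx
      have h1 : x ≠ u := fun h => huU (h ▸ hx)
      have h2 : x ≠ v := fun h => hvU (h ▸ hx)
      simp [SimpleGraph.deleteEdges_adj, h1, h2]
    rw [seriesZ_expand _ β hne, ← hU]
    simp only [spinSum_deleteEdges G _ _ huU]
    have e1 : bump (G.deleteEdges {s(u, v)}) b u (fun _ => X) v = X := by
      simp only [bump, if_neg hnadj]
    have e2 : bump (G.deleteEdges {s(u, v)}) b u (fun _ => (1 : PowerSeries ℂ)) v = 1 := by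
      simp only [bump, if_neg hnadj]
    rw [e1, e2, one_mul]
    have hbu : ∀ (p : V → PowerSeries ℂ), ∀ x ∈ U,
        bump (G.deleteEdges {s(u, v)}) b u p x = bump G b u p x := fun p x hx => by
      simp only [bump, hadj x hx]
    have hbv : ∀ (p p' : V → PowerSeries ℂ), (∀ x ∈ U, p x = p' x) → ∀ x ∈ U,
        bump (G.deleteEdges {s(u, v)}) b v p x = bump G b v p' x := fun p p' hp x hx => by
      simp only [bump, hadj' x hx, hp x hx]
    rw [spinSum_congr G _ (hbv _ _ (hbu _)) (fun _ _ => rfl),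
      spinSum_congr G _ (hbu _) (hbv _ _ fun _ _ => rfl),
      spinSum_congr G _ (hbv _ _ fun _ _ => rfl) (hbu _),
      spinSum_congr G _ (fun _ _ => rfl) (hbv _ _ (hbu _))]
  have da := X_pow_dvd_spinRatio_sub_sawRatio G hβ u true k v [] (by simp) (by simpa using hne)
  have db := X_pow_dvd_spinRatio_sub_sawRatio G hβ v false k u [] (by simp) (by simpa using hne.symm)
  have dc := X_pow_dvd_spinRatio_sub_sawRatio G hβ u false k v [] (by simp) (by simpa using hne)
  simp only [sawP_singleton, sawQ_singleton, if_true, Bool.false_eq_true, if_false] at da db dc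
  rw [hrest] at db
  have ca := constantCoeff_sawRatio G β u true k [v]
  have cb := constantCoeff_sawRatio G β v false k [u]
  have cc := constantCoeff_sawRatio G β u false k [v]
  unfold sawEdgeRatio
  simp only
  set a' := sawRatio G β u true k [v]
  set b' := sawRatio G β v false k [u]
  set c' := sawRatio G β u false k [v]
  have ea : spinRatio G β U (bump G b u fun _ => X) (fun _ => 1) v = b * X * Spp * Spm⁻¹ := by
    rw [spinRatio, one_mul]
    simp only [bump, huv, if_true]
    rfl
  have eb : spinRatio G β U (fun _ => X) (bump G b v fun _ => 1) u = X * Spm * (b * Smm)⁻¹ := by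
    rw [spinRatio, bump_comm G _ u v]
    simp only [bump, huv.symm, if_true, mul_one]
    rfl
  have ec : spinRatio G β U (fun _ => X) (bump G b u fun _ => 1) v = X * Smp * (b * Smm)⁻¹ := by
    rw [spinRatio]
    simp only [bump, huv, if_true, mul_one]
    rfl
  rw [ea] at da
  rw [eb] at db
  rw [ec] at dc
  set a := b * X * Spp * Spm⁻¹ with ha
  set bb := X * Spm * (b * Smm)⁻¹ with hbb
  set c := X * Smp * (b * Smm)⁻¹ with hc
  have i1 : Spm * Spm⁻¹ = 1 := PowerSeries.mul_inv_cancel _ cSpm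
  have i2 : b * Smm * (b * Smm)⁻¹ = 1 := PowerSeries.mul_inv_cancel _ (by
    rw [map_mul]; exact mul_ne_zero hCb cSmm)
  have cZ := constantCoeff_seriesZ G hb
  have i3 : seriesZ G β * (seriesZ G β)⁻¹ = 1 := PowerSeries.mul_inv_cancel _ cZ
  -- Multiplied by `b * Smm`, the numerator becomes the weight of the configurations where `u` and
  -- `v` agree, and the denominator (`hD`) becomes the whole partition function. Their quotient `q`
  -- is the probability of agreement. Deleting the edge divides the weight of these configurations
  -- by `β`, so the deletion ratio is `1 - (1 - 1/β) q`.
  have hM : (a * bb + 1) * (b * Smm) = b * (X ^ 2 * Spp + Smm) := by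
    rw [ha, hbb]
    linear_combination (b * X ^ 2 * Spp * (b * Smm * (b * Smm)⁻¹)) * i1 + b * X ^ 2 * Spp * i2
  have hD : (a * bb + 1 + bb + c) * (b * Smm) = seriesZ G β := by
    have h1 : bb * (b * Smm) = X * Spm := by rw [hbb]; linear_combination X * Spm * i2
    have h2 : c * (b * Smm) = X * Smp := by rw [hc]; linear_combination X * Smp * i2
    rw [hZ]
    linear_combination hM + h1 + h2
  have caa : constantCoeff a = 0 := by simp [ha]
  have cbb : constantCoeff bb = 0 := by simp [hbb]
  have ccc : constantCoeff c = 0 := by simp [hc]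
  have cD : constantCoeff (a * bb + 1 + bb + c) ≠ 0 := by simp [caa, cbb, ccc]
  have cD' : constantCoeff (a' * b' + 1 + b' + c') ≠ 0 := by simp [ca, cb, cc]
  have i4 := PowerSeries.mul_inv_cancel _ cD
  have hP : seriesZ (G.deleteEdges {s(u, v)}) β * (seriesZ G β)⁻¹ =
      1 - C (1 - (β : ℂ)⁻¹) * ((a * bb + 1) * (a * bb + 1 + bb + c)⁻¹) := by
    have h1 : (a * bb + 1) * (a * bb + 1 + bb + c)⁻¹ =
        b * (X ^ 2 * Spp + Smm) * (seriesZ G β)⁻¹ := by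
      rw [PowerSeries.eq_mul_inv_iff_mul_eq cZ, ← hD]
      linear_combination (a * bb + 1) * (b * Smm) * i4 + hM
    have h2 : C (1 - (β : ℂ)⁻¹) * b = b - 1 := by
      rw [hbdef, ← map_mul, sub_mul, one_mul, inv_mul_cancel₀ hb, map_sub, map_one]
    rw [h1]
    linear_combination (seriesZ G β)⁻¹ * hZ' - (seriesZ G β)⁻¹ * hZ + i3 +
      (X ^ 2 * Spp + Smm) * (seriesZ G β)⁻¹ * h2
  rw [hP]
  have : ∀ t t' : PowerSeries ℂ, 1 - C (1 - (β : ℂ)⁻¹) * t - (1 - C (1 - (β : ℂ)⁻¹) * t') =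
      (t - t') * -C (1 - (β : ℂ)⁻¹) := fun t t' => by ring
  rw [this]
  have dab : X ^ (k + 1) ∣ a * bb + 1 - (a' * b' + 1) := by
    have : a * bb + 1 - (a' * b' + 1) = (a - a') * bb + (bb - b') * a' := by ring
    rw [this]
    exact dvd_add (da.mul_right _) (db.mul_right _)
  refine Dvd.dvd.mul_right (dvd_mul_inv_sub_mul_inv dab ?_ cD cD') _
  have : a * bb + 1 + bb + c - (a' * b' + 1 + b' + c') =
      (a * bb + 1 - (a' * b' + 1)) + (bb - b') + (c - c') := by ring
  rw [this]
  exact dvd_add (dvd_add dab db) dc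

end Saw

/-! ### Taylor series of the edge-deletion ratio -/

section Taylor

/-- The Taylor series at `0`. -/
noncomputable def taylorSeries (f : ℂ → ℂ) : PowerSeries ℂ :=
  PowerSeries.mk fun j => iteratedDeriv j f 0 / (j.factorial : ℂ)

theorem taylorPoly_eq_trunc (f : ℂ → ℂ) (k : ℕ) :
    taylorPoly f k = PowerSeries.trunc (k + 1) (taylorSeries f) := by
  ext j
  rw [taylorPoly, Polynomial.finsetSum_coeff, PowerSeries.coeff_trunc]
  simp only [Polynomial.coeff_C_mul, Polynomial.coeff_X_pow, mul_ite, mul_one, mul_zero,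
    Finset.sum_ite_eq, Finset.mem_range, taylorSeries, PowerSeries.coeff_mk]

/-- Leibniz' rule divided by `j!` is the Cauchy product of the coefficients. -/
theorem taylorSeries_mul {f g : ℂ → ℂ} (hf : AnalyticAt ℂ f 0) (hg : AnalyticAt ℂ g 0) :
    taylorSeries (f * g) = taylorSeries f * taylorSeries g := by
  ext j
  rw [taylorSeries, PowerSeries.coeff_mk, iteratedDeriv_mul hf.contDiffAt hg.contDiffAt,
    PowerSeries.coeff_mul, Finset.Nat.sum_antidiagonal_eq_sum_range_succ_mk, Finset.sum_div]
  refine Finset.sum_congr rfl fun i hi => ?_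
  simp only [taylorSeries, PowerSeries.coeff_mk]
  rw [Nat.cast_choose ℂ (Nat.lt_succ_iff.1 (Finset.mem_range.1 hi))]
  have h1 : (j.factorial : ℂ) ≠ 0 := by exact_mod_cast j.factorial_ne_zero
  field_simp

theorem taylorSeries_eval (p : Polynomial ℂ) :
    taylorSeries (fun z => p.eval z) = (p : PowerSeries ℂ) := by
  have h : ∀ (j : ℕ) (p : Polynomial ℂ), iteratedDeriv j (fun z => p.eval z) =
      fun z => (Polynomial.derivative^[j] p).eval z := by
    intro j
    induction j with
    | zero => intro p; simp
    | succ j ih =>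
      intro p
      rw [iteratedDeriv_succ']
      have : deriv (fun z => p.eval z) = fun z => (Polynomial.derivative p).eval z := by
        funext z; exact p.deriv
      rw [this, ih, Function.iterate_succ_apply]
  ext j
  rw [taylorSeries, PowerSeries.coeff_mk, h, Polynomial.coeff_coe]
  change Polynomial.eval 0 _ / _ = _
  rw [← Polynomial.coeff_zero_eq_eval_zero, Polynomial.coeff_iterate_derivative, zero_add,
    Nat.descFactorial_self, nsmul_eq_mul]
  have h1 : (j.factorial : ℂ) ≠ 0 := by exact_mod_cast j.factorial_ne_zero
  field_simp

theorem taylorSeries_congr {f g : ℂ → ℂ} (h : f =ᶠ[nhds 0] g) :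
    taylorSeries f = taylorSeries g := by
  ext j
  simp only [taylorSeries, PowerSeries.coeff_mk, h.iteratedDeriv_eq j]

theorem trunc_eq_trunc_of_X_pow_dvd {p q : PowerSeries ℂ} {k : ℕ}
    (h : PowerSeries.X ^ k ∣ p - q) : PowerSeries.trunc k p = PowerSeries.trunc k q := by
  ext j
  rw [PowerSeries.coeff_trunc, PowerSeries.coeff_trunc]
  split_ifs with hj
  · have := PowerSeries.X_pow_dvd_iff.1 h j hj
    rwa [map_sub, sub_eq_zero] at this
  · rfl

variable {V : Type*} [Fintype V] [LinearOrder V]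

-- An edge is identified with its endpoints in increasing order, so each edge is counted once.
open Classical in
theorem prod_edgeFinset_eq (G : SimpleGraph V) (f : Sym2 V → ℂ) :
    ∏ e ∈ G.edgeFinset, f e = ∏ x : V, ∏ y : V, if x < y ∧ G.Adj x y then f s(x, y) else 1 := by
  rw [← Finset.prod_product', ← Finset.prod_filter]
  refine Finset.prod_nbij' (fun e => (e.inf, e.sup)) (fun p => s(p.1, p.2)) ?_ ?_ ?_ ?_ ?_
  · intro e
    induction e using Sym2.ind with
    | _ x y =>
      intro he
      have hxy : G.Adj x y := by simpa using he
      simp only [Finset.mem_filter, Finset.mem_product, Finset.mem_univ, true_and, Sym2.inf_mk,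
        Sym2.sup_mk]
      rcases lt_or_gt_of_ne hxy.ne with h | h
      · rw [inf_eq_left.2 h.le, sup_eq_right.2 h.le]; exact ⟨h, hxy⟩
      · rw [inf_eq_right.2 h.le, sup_eq_left.2 h.le]; exact ⟨h, hxy.symm⟩
  · rintro ⟨x, y⟩ h
    simpa using (Finset.mem_filter.1 h).2.2
  · intro e
    induction e using Sym2.ind with
    | _ x y =>
      intro he
      simp only [Sym2.inf_mk, Sym2.sup_mk]
      rcases le_total x y with h | h
      · rw [inf_eq_left.2 h, sup_eq_right.2 h]
      · rw [inf_eq_right.2 h, sup_eq_left.2 h, Sym2.eq_swap]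
  · rintro ⟨x, y⟩ h
    have h1 := (Finset.mem_filter.1 h).2.1
    simp only [Sym2.inf_mk, Sym2.sup_mk, inf_eq_left.2 h1.le, sup_eq_right.2 h1.le]
  · intro e
    induction e using Sym2.ind with
    | _ x y =>
      intro he
      simp only [Sym2.inf_mk, Sym2.sup_mk]
      rcases le_total x y with h | h
      · rw [inf_eq_left.2 h, sup_eq_right.2 h]
      · rw [inf_eq_right.2 h, sup_eq_left.2 h, Sym2.eq_swap]

/-- A configuration is identified with its set of vertices of spin `+`. -/
theorem isingZ_eq_spinSum (G : SimpleGraph V) (β : ℝ) (z : ℂ) :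
    isingZ G β z = spinSum G (β : ℂ) Finset.univ (fun _ => z) (fun _ => 1) := by
  classical
  rw [isingZ, spinSum, Finset.powerset_univ]
  refine Finset.sum_nbij' (fun σ => Finset.univ.filter fun v => σ v = true)
    (fun A v => decide (v ∈ A)) (fun _ _ => Finset.mem_univ _) ?_ ?_ ?_ ?_
  · intro A _; simp
  · intro σ _; funext v; simp
  · intro A _; ext v; simp
  · intro σ _
    rw [isingWeight, prod_edgeFinset_eq, pairWeight, Finset.prod_const_one, mul_one]
    congr 1
    · refine Finset.prod_congr rfl fun x _ => Finset.prod_congr rfl fun y _ => ?_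
      simp only [Sym2.map_mk, Sym2.mk_isDiag_iff, Finset.mem_filter, Finset.mem_univ, true_and,
        ← ite_and, ← Bool.eq_iff_iff, and_assoc]
    · rw [Finset.prod_filter]

/-- The partition function as a polynomial in the field. -/
noncomputable def polyZ (G : SimpleGraph V) (β : ℂ) : Polynomial ℂ :=
  spinSum G (Polynomial.C β) Finset.univ (fun _ => Polynomial.X) (fun _ => 1)

theorem eval_polyZ (G : SimpleGraph V) (β : ℝ) (z : ℂ) :
    (polyZ G β).eval z = isingZ G β z := by
  rw [isingZ_eq_spinSum, polyZ, ← Polynomial.coe_evalRingHom, map_spinSum]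
  simp

theorem coe_polyZ (G : SimpleGraph V) (β : ℂ) : (polyZ G β : PowerSeries ℂ) = seriesZ G β := by
  rw [seriesZ, polyZ, ← Polynomial.coeToPowerSeries.ringHom_apply, map_spinSum]
  simp

/-- Near `0` the ratio times `Z_G` equals `Z_{G-e}`. Taylor series are multiplicative and those of
the two partition functions are polynomials, so the ratio can be formed in the ring of power series.
-/
theorem taylorSeries_edgeRatio (G : SimpleGraph V) {β : ℝ} (hβ : 1 ≤ β) (e : Sym2 V) :
    taylorSeries (edgeRatio G β e) = seriesZ (G.deleteEdges {e}) β * (seriesZ G β)⁻¹ := by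
  have hb : (β : ℂ) ≠ 0 := by
    have : β ≠ 0 := by linarith
    exact_mod_cast this
  rw [PowerSeries.eq_mul_inv_iff_mul_eq (constantCoeff_seriesZ G hb), ← coe_polyZ, ← coe_polyZ,
    ← taylorSeries_eval, ← taylorSeries_eval, ← taylorSeries_mul]
  · apply taylorSeries_congr
    filter_upwards [Metric.ball_mem_nhds (0 : ℂ) one_pos] with z hz
    simp only [Pi.mul_apply, eval_polyZ, edgeRatio]
    exact div_mul_cancel₀ _ (isingZ_ne_zero G hβ (by simpa using hz))
  · exact (differentiableOn_edgeRatio G hβ e).analyticAt (Metric.ball_mem_nhds _ one_pos)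
  · exact (polyZ G β).differentiable.analyticAt 0

/-- The Taylor polynomial of the edge-deletion ratio is computed by the recursion on self-avoiding
walk trees. -/
theorem taylorPoly_edgeRatio (G : SimpleGraph V) {β : ℝ} (hβ : 1 ≤ β) {u v : V} (huv : G.Adj u v)
    (k : ℕ) : taylorPoly (edgeRatio G β s(u, v)) k =
      PowerSeries.trunc (k + 1) (sawEdgeRatio G β u v k) := by
  rw [taylorPoly_eq_trunc, taylorSeries_edgeRatio G hβ]
  exact trunc_eq_trunc_of_X_pow_dvd
    (X_pow_dvd_seriesZ_div_sub_sawEdgeRatio G (by linarith) huv k)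

end Taylor

/-! ### Edge lists -/

section EdgeList

variable {V : Type*} {G : SimpleGraph V} {L : List (V × V)}

theorem IsEdgeList.mem_edgeSet (hL : IsEdgeList G L) {i : ℕ} (hi : i < L.length) :
    s(L[i].1, L[i].2) ∈ G.edgeSet :=
  (hL.2 _).1 (List.mem_map.2 ⟨L[i], List.getElem_mem hi, rfl⟩)

theorem IsEdgeList.prefixGraph_adj (hL : IsEdgeList G L) (i : ℕ) (x y : V) :
    (prefixGraph L i).Adj x y ↔ s(x, y) ∈ (L.take i).map fun p => s(p.1, p.2) := by
  rw [prefixGraph, SimpleGraph.fromEdgeSet_adj, Set.mem_ofPred_eq, and_iff_left_iff_imp]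
  intro h
  have h1 : s(x, y) ∈ G.edgeSet := (hL.2 _).1 (by
    rw [List.map_take] at h; exact List.mem_of_mem_take h)
  exact G.ne_of_adj h1

theorem IsEdgeList.prefixGraph_le (hL : IsEdgeList G L) (i : ℕ) : prefixGraph L i ≤ G := by
  intro x y h
  rw [hL.prefixGraph_adj, List.map_take] at h
  exact (hL.2 _).1 (List.mem_of_mem_take h)

theorem IsEdgeList.prefixGraph_length (hL : IsEdgeList G L) : prefixGraph L L.length = G := by
  ext x y
  rw [hL.prefixGraph_adj, List.take_length, hL.2, SimpleGraph.mem_edgeSet]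

theorem IsEdgeList.prefixGraph_succ_adj (hL : IsEdgeList G L) {i : ℕ} (hi : i < L.length) :
    (prefixGraph L (i + 1)).Adj L[i].1 L[i].2 := by
  rw [hL.prefixGraph_adj]
  exact List.mem_map.2 ⟨L[i], by
    rw [List.take_succ_eq_append_getElem hi]
    exact List.mem_append_right _ (List.mem_singleton_self _), rfl⟩

/-- The list has no repetitions, even up to orientation, so the edge `L[i]` does not occur among the
earlier ones. -/
theorem IsEdgeList.deleteEdges_prefixGraph (hL : IsEdgeList G L) {i : ℕ} (hi : i < L.length) :
    (prefixGraph L (i + 1)).deleteEdges {s(L[i].1, L[i].2)} = prefixGraph L i := by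
  have hnd : (((L.take i).map fun p => s(p.1, p.2)) ++ [s(L[i].1, L[i].2)]).Nodup := by
    have : ((L.take (i + 1)).map fun p => s(p.1, p.2)) =
        ((L.take i).map fun p => s(p.1, p.2)) ++ [s(L[i].1, L[i].2)] := by
      rw [List.take_succ_eq_append_getElem hi, List.map_append]; rfl
    rw [← this, List.map_take]
    exact hL.1.sublist (List.take_sublist _ _)
  have hnot : s(L[i].1, L[i].2) ∉ (L.take i).map fun p => s(p.1, p.2) := by
    intro h
    rw [List.nodup_append] at hnd
    exact hnd.2.2 _ h _ (List.mem_singleton_self _) rfl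
  ext x y
  rw [SimpleGraph.deleteEdges_adj, hL.prefixGraph_adj, hL.prefixGraph_adj,
    List.take_succ_eq_append_getElem hi, List.map_append, List.mem_append, Set.mem_singleton_iff]
  simp only [List.map_cons, List.map_nil, List.mem_singleton]
  constructor
  · rintro ⟨h1 | h1, h2⟩
    · exact h1
    · exact absurd h1 h2
  · intro h
    exact ⟨Or.inl h, fun h1 => hnot (h1 ▸ h)⟩

theorem IsEdgeList.length_eq [Fintype V] [DecidableRel G.Adj] (hL : IsEdgeList G L) :
    L.length = G.edgeFinset.card := by
  classical
  have : G.edgeFinset = (L.map fun p => s(p.1, p.2)).toFinset := by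
    ext e; rw [SimpleGraph.mem_edgeFinset, List.mem_toFinset, hL.2]
  rw [this, List.toFinset_card_of_nodup hL.1, List.length_map]

theorem isingZ_bot [Fintype V] (β : ℝ) (z : ℂ) :
    isingZ (⊥ : SimpleGraph V) β z = (1 + z) ^ Fintype.card V := by
  classical
  have := (Finset.prod_univ_sum (fun _ : V => (Finset.univ : Finset Bool))
    (fun v (b : Bool) => if b = true then z else 1)).symm
  rw [Fintype.piFinset_univ] at this
  simp only [isingZ, isingWeight]
  rw [Finset.sum_congr rfl fun σ _ => by
    rw [Finset.prod_eq_one (fun e he => by simp at he), one_mul]]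
  convert this using 1
  simp [add_comm]

/-- The telescoping product of the edge-deletion ratios. -/
theorem IsEdgeList.isingZ_eq [Fintype V] (hL : IsEdgeList G L) {β : ℝ} (hβ : 1 ≤ β) {z : ℂ}
    (hz : ‖z‖ < 1) : isingZ G β z = (1 + z) ^ Fintype.card V *
      ∏ i : Fin L.length, (edgeRatio (prefixGraph L (i + 1)) β s(L[i].1, L[i].2) z)⁻¹ := by
  have key : ∀ j, j ≤ L.length → isingZ (prefixGraph L j) β z = (1 + z) ^ Fintype.card V *
      ∏ i ∈ Finset.range j, (isingZ (prefixGraph L (i + 1)) β z / isingZ (prefixGraph L i) β z) := by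
    intro j hj
    induction j with
    | zero =>
      have : prefixGraph L 0 = ⊥ := by
        ext x y; rw [hL.prefixGraph_adj]; simp
      rw [this, isingZ_bot]; simp
    | succ j ih =>
      rw [Finset.prod_range_succ, ← mul_assoc, ← ih (by omega),
        mul_div_cancel₀ _ (isingZ_ne_zero _ hβ hz)]
  have h := key L.length le_rfl
  rw [hL.prefixGraph_length, Finset.prod_range] at h
  rw [h]
  congr 1
  refine Finset.prod_congr rfl fun i _ => ?_
  rw [edgeRatio, inv_div]
  have := hL.deleteEdges_prefixGraph i.2
  simp only [Fin.getElem_fin]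
  rw [this]

end EdgeList

/-! ### Depth-first traversal of the self-avoiding walk tree -/

section Traversal

variable {n : ℕ}

/-- The other endpoint of an edge at `v`. -/
def edgeOther (v : Fin n) (e : Fin n × Fin n) : Option (Fin n) :=
  if e.1 = v then some e.2 else if e.2 = v then some e.1 else none

/-- A stack frame: the current vertex, the index of the next edge and the product so far. -/
structure Frame (n : ℕ) where
  v : Fin n
  e : ℕ
  acc : PowerSeries ℂ

open Classical in
/-- What to do with the neighbour `w` of the walk `v :: p`: multiply by a constant, or descend. -/
noncomputable def dfsVisit (β : ℝ) (u : Fin n) (s : Bool) (k : ℕ) (p : List (Fin n)) (v w : Fin n) :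
    ℂ ⊕ Fin n :=
  if p.head? = some w then .inl 1
  else if w = u then .inl (if s = true then (β : ℂ) else (β : ℂ)⁻¹)
  else if w ∈ p then .inl (if v < stepAfter w (v :: p) then (β : ℂ) else (β : ℂ)⁻¹)
  else if p.length + 1 = k then .inl (β : ℂ)⁻¹
  else .inr w

/-- What to do with an edge. -/
noncomputable def dfsAction (β : ℝ) (u : Fin n) (s : Bool) (k : ℕ) (p : List (Fin n)) (v : Fin n)
    (e : Fin n × Fin n) : ℂ ⊕ Fin n :=
  match edgeOther v e with
  | none => .inl 1
  | some w => dfsVisit β u s k p v w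

/-- One step of the traversal. -/
noncomputable def dfsStep (E : List (Fin n × Fin n)) (β : ℝ) (u : Fin n) (s : Bool) (k : ℕ) :
    List (Frame n) → List (Frame n)
  | [] => []
  | f :: fs =>
    match E[f.e]? with
    | none =>
      match fs with
      | [] => [f]
      | g :: gs => ⟨g.v, g.e, g.acc * edgeFactor β f.acc⟩ :: gs
    | some e =>
      match dfsAction β u s k (fs.map Frame.v) f.v e with
      | .inl c => ⟨f.v, f.e + 1, f.acc * PowerSeries.C c⟩ :: fs
      | .inr w => ⟨w, 0, PowerSeries.X⟩ :: ⟨f.v, f.e + 1, f.acc⟩ :: fs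

/-- `N` steps of a map, all of them from points where `P` holds. -/
inductive StepsWhile {α : Type*} (P : α → Prop) (f : α → α) : ℕ → α → α → Prop
  | refl (a : α) : StepsWhile P f 0 a a
  | step {N : ℕ} {a b : α} (ha : P a) (h : StepsWhile P f N (f a) b) : StepsWhile P f (N + 1) a b

theorem StepsWhile.trans {α : Type*} {P : α → Prop} {f : α → α} {M N : ℕ} {a b c : α}
    (h₁ : StepsWhile P f M a b) (h₂ : StepsWhile P f N b c) : StepsWhile P f (M + N) a c := by
  induction h₁ with
  | refl => simpa using h₂
  | @step M a b ha _ ih =>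
    rw [Nat.add_right_comm]
    exact .step ha (ih h₂)

/-- The traversal has not finished. -/
def DfsRunning (E : List (Fin n × Fin n)) (st : List (Frame n)) : Prop :=
  ¬ (st.length = 1 ∧ ∀ f ∈ st, E.length ≤ f.e)

open Classical in
/-- The factor of the neighbour `w` in the recursion at the walk `v :: p`. -/
noncomputable def sawFactor (H : SimpleGraph (Fin n)) (β : ℝ) (u : Fin n) (s : Bool) (j : ℕ)
    (p : List (Fin n)) (v w : Fin n) : PowerSeries ℂ :=
  if p.head? ≠ some w then
    if w = u then
      (if s = true then PowerSeries.C (β : ℂ) else PowerSeries.C (β : ℂ)⁻¹)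
    else if w ∈ p then
      (if v < stepAfter w (v :: p) then PowerSeries.C (β : ℂ) else PowerSeries.C (β : ℂ)⁻¹)
    else edgeFactor β (sawRatio H β u s j (w :: v :: p))
  else 1

theorem edgeOther_eq_some {v w : Fin n} {e : Fin n × Fin n} (h : edgeOther v e = some w) :
    s(e.1, e.2) = s(v, w) := by
  unfold edgeOther at h
  split_ifs at h with h1 h2
  · rw [← h1, ← Option.some.inj h]
  · rw [← h2, ← Option.some.inj h, Sym2.eq_swap]

/-- Two entries with the same other endpoint at `v` would be the same edge. Hence a scan of the edge
list meets each neighbour once, and no adjacency lists are needed. -/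
theorem nodup_filterMap_edgeOther {H : SimpleGraph (Fin n)} {E : List (Fin n × Fin n)}
    (hE : IsEdgeList H E) (v : Fin n) : (E.filterMap (edgeOther v)).Nodup := by
  rw [List.Nodup, List.pairwise_filterMap]
  have := hE.1
  rw [List.Nodup, List.pairwise_map] at this
  refine this.imp ?_
  intro e e' hne w hw w' hw' hww
  apply hne
  rw [edgeOther_eq_some hw, edgeOther_eq_some hw', hww]

open Classical in
theorem toFinset_filterMap_edgeOther {H : SimpleGraph (Fin n)} {E : List (Fin n × Fin n)}
    (hE : IsEdgeList H E) (v : Fin n) :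
    (E.filterMap (edgeOther v)).toFinset = H.neighborFinset v := by
  ext w
  rw [List.mem_toFinset, List.mem_filterMap, SimpleGraph.mem_neighborFinset,
    ← SimpleGraph.mem_edgeSet, ← hE.2, List.mem_map]
  constructor
  · rintro ⟨e, he, hw⟩
    exact ⟨e, he, edgeOther_eq_some hw⟩
  · rintro ⟨e, he, hw⟩
    refine ⟨e, he, ?_⟩
    rcases Sym2.eq_iff.1 hw with ⟨h1, h2⟩ | ⟨h1, h2⟩
    · simp [edgeOther, h1, h2]
    · by_cases h : e.1 = v
      · rw [edgeOther, if_pos h, h2, ← h, h1]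
      · rw [edgeOther, if_neg h, if_pos h2, h1]

open Classical in
theorem sawRatio_succ_eq {H : SimpleGraph (Fin n)} {E : List (Fin n × Fin n)}
    (hE : IsEdgeList H E) (β : ℝ) (u : Fin n) (s : Bool) (j : ℕ) (p : List (Fin n)) (v : Fin n) :
    sawRatio H β u s (j + 1) (v :: p) = PowerSeries.X *
      ((E.filterMap (edgeOther v)).map (sawFactor H β u s j p v)).prod := by
  rw [← List.prod_toFinset _ (nodup_filterMap_edgeOther hE v), toFinset_filterMap_edgeOther hE]
  simp only [sawRatio, sawFactor, Finset.prod_filter]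
  rfl

theorem length_filterMap_edgeOther {H : SimpleGraph (Fin n)} [DecidableRel H.Adj]
    {E : List (Fin n × Fin n)} (hE : IsEdgeList H E) (v : Fin n) :
    (E.filterMap (edgeOther v)).length = H.degree v := by
  classical
  rw [← List.toFinset_card_of_nodup (nodup_filterMap_edgeOther hE v),
    toFinset_filterMap_edgeOther hE, ← SimpleGraph.card_neighborFinset_eq_degree]
  congr!

theorem dfsRunning_of_lt {E : List (Fin n × Fin n)} {f : Frame n} {fs : List (Frame n)}
    (h : f.e < E.length) : DfsRunning E (f :: fs) := fun h1 =>
  absurd (h1.2 f (by simp)) h.not_ge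

theorem dfsRunning_cons_cons {E : List (Fin n × Fin n)} {f g : Frame n} {fs : List (Frame n)} :
    DfsRunning E (f :: g :: fs) := fun h1 => by simp at h1

/-- A child at the cutoff has ratio `0` and contributes the constant `1/β`, so the traversal opens
no frame for it. -/
theorem edgeFactor_zero (β : ℂ) : edgeFactor β 0 = PowerSeries.C β⁻¹ := by
  simp [edgeFactor, PowerSeries.C_inv]

/-- Away from the last level a constant action is a leaf or the step back, whatever the remaining
depth `j`. On the last level the constant `1/β` may instead stand for a child that is cut off, and
this is why that level is excluded. -/
theorem sawFactor_of_dfsVisit_eq_inl (H : SimpleGraph (Fin n)) {β : ℝ} {u : Fin n} {s : Bool}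
    {k j : ℕ} {p : List (Fin n)} {v w : Fin n} {c : ℂ} (hk : p.length + 1 ≠ k)
    (h : dfsVisit β u s k p v w = .inl c) : sawFactor H β u s j p v w = PowerSeries.C c := by
  unfold dfsVisit at h
  unfold sawFactor
  by_cases h1 : p.head? = some w
  · rw [if_pos h1] at h
    rw [if_neg (not_not.2 h1), ← Sum.inl.inj h, map_one]
  rw [if_neg h1] at h
  rw [if_pos h1]
  by_cases h2 : w = u
  · rw [if_pos h2] at h ⊢
    rw [← Sum.inl.inj h, apply_ite PowerSeries.C]
  rw [if_neg h2] at h ⊢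
  by_cases h3 : w ∈ p
  · rw [if_pos h3] at h ⊢
    rw [← Sum.inl.inj h, apply_ite PowerSeries.C]
  · rw [if_neg h3, if_neg hk] at h
    cases h

theorem sawFactor_of_dfsVisit_eq_inr (H : SimpleGraph (Fin n)) {β : ℝ} {u : Fin n} {s : Bool}
    {k j : ℕ} {p : List (Fin n)} {v w w' : Fin n} (h : dfsVisit β u s k p v w = .inr w') :
    w = w' ∧ sawFactor H β u s j p v w = edgeFactor β (sawRatio H β u s j (w :: v :: p)) := by
  unfold dfsVisit at h
  unfold sawFactor
  by_cases h1 : p.head? = some w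
  · rw [if_pos h1] at h; cases h
  by_cases h2 : w = u
  · rw [if_neg h1, if_pos h2] at h; cases h
  by_cases h3 : w ∈ p
  · rw [if_neg h1, if_neg h2, if_pos h3] at h; cases h
  by_cases h4 : p.length + 1 = k
  · rw [if_neg h1, if_neg h2, if_neg h3, if_pos h4] at h; cases h
  rw [if_neg h1, if_neg h2, if_neg h3, if_neg h4] at h
  rw [if_pos h1, if_neg h2, if_neg h3]
  exact ⟨Sum.inr.inj h, rfl⟩

/-- The traversal multiplies the product of a frame by the factors of the remaining edges. -/
theorem exists_stepsWhile_dfsStep {H : SimpleGraph (Fin n)} {E : List (Fin n × Fin n)}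
    (hE : IsEdgeList H E) (β : ℝ) (u : Fin n) (s : Bool) (k : ℕ) {Δ : ℕ}
    (hΔ : ∀ v, (E.filterMap (edgeOther v)).length ≤ Δ) (j : ℕ) :
    ∀ (v : Fin n) (fs : List (Frame n)), fs.length + (j + 1) = k →
      ∃ N, N + 1 ≤ (E.length + 1) * (Δ + 1) ^ (j + 1) ∧
        StepsWhile (DfsRunning E) (dfsStep E β u s k) N (⟨v, 0, PowerSeries.X⟩ :: fs)
          (⟨v, E.length, sawRatio H β u s (j + 1) (v :: fs.map Frame.v)⟩ :: fs) := by
  induction j with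
  | zero =>
    intro v fs hk
    -- On the last level every edge costs one step, since a free neighbour is cut off immediately.
    have claim : ∀ (i : ℕ) (e : ℕ) (acc : PowerSeries ℂ), e + i = E.length →
        StepsWhile (DfsRunning E) (dfsStep E β u s k) i (⟨v, e, acc⟩ :: fs)
          (⟨v, E.length, acc * (((E.drop e).filterMap (edgeOther v)).map
            (sawFactor H β u s 0 (fs.map Frame.v) v)).prod⟩ :: fs) := by
      intro i
      induction i with
      | zero =>
        intro e acc he
        obtain rfl : e = E.length := by omega
        simpa using StepsWhile.refl _
      | succ i ih =>
        intro e acc he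
        have hlt : e < E.length := by omega
        refine .step (dfsRunning_of_lt hlt) ?_
        rw [List.drop_eq_getElem_cons hlt, List.filterMap_cons]
        simp only [dfsStep, List.getElem?_eq_getElem hlt, dfsAction]
        cases hw : edgeOther v E[e] with
        | none =>
          have := ih (e + 1) (acc * PowerSeries.C 1) (by omega)
          rw [map_one, mul_one] at this
          simpa using this
        | some w =>
          simp only [List.map_cons, List.prod_cons, ← mul_assoc]
          obtain ⟨c, hv, hc⟩ : ∃ c, dfsVisit β u s k (fs.map Frame.v) v w = .inl c ∧
              sawFactor H β u s 0 (fs.map Frame.v) v w = PowerSeries.C c := by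
            unfold dfsVisit sawFactor
            have h0 : sawRatio H β u s 0 (w :: v :: fs.map Frame.v) = 0 := by simp [sawRatio]
            have hk' : fs.length + 1 = k := by omega
            simp only [h0, edgeFactor_zero, List.length_map, hk', if_true, ite_not]
            split_ifs <;> exact ⟨_, rfl, by simp⟩
          rw [hv, hc]
          exact ih (e + 1) (acc * PowerSeries.C c) (by omega)
    refine ⟨E.length, ?_, ?_⟩
    · simp only [zero_add, pow_one]; nlinarith
    · rw [sawRatio_succ_eq hE]
      simpa using claim E.length 0 PowerSeries.X (by omega)
  | succ j ihj =>
    intro v fs hk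
    -- `B` bounds the steps spent on one child, including the step that removes its frame. That step
    -- is the `+ 1` on the left of the bound being proved.
    set B := (E.length + 1) * (Δ + 1) ^ (j + 1) with hB
    have claim : ∀ (i : ℕ) (e : ℕ) (acc : PowerSeries ℂ), e + i = E.length →
        ∃ N, N ≤ i + ((E.drop e).filterMap (edgeOther v)).length * B ∧
        StepsWhile (DfsRunning E) (dfsStep E β u s k) N (⟨v, e, acc⟩ :: fs)
          (⟨v, E.length, acc * (((E.drop e).filterMap (edgeOther v)).map
            (sawFactor H β u s (j + 1) (fs.map Frame.v) v)).prod⟩ :: fs) := by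
      intro i
      induction i with
      | zero =>
        intro e acc he
        obtain rfl : e = E.length := by omega
        exact ⟨0, by simp, by simpa using StepsWhile.refl _⟩
      | succ i ih =>
        intro e acc he
        have hlt : e < E.length := by omega
        rw [List.drop_eq_getElem_cons hlt, List.filterMap_cons]
        cases hw : edgeOther v E[e] with
        | none =>
          obtain ⟨N, hN, hsteps⟩ := ih (e + 1) (acc * PowerSeries.C 1) (by omega)
          refine ⟨N + 1, by simp only; omega, .step (dfsRunning_of_lt hlt) ?_⟩
          simp only [dfsStep, List.getElem?_eq_getElem hlt, dfsAction, hw]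
          simpa using hsteps
        | some w =>
          simp only [List.map_cons, List.prod_cons, ← mul_assoc, List.length_cons]
          cases hvis : dfsVisit β u s k (fs.map Frame.v) v w with
          | inl c =>
            have hc : sawFactor H β u s (j + 1) (fs.map Frame.v) v w = PowerSeries.C c :=
              sawFactor_of_dfsVisit_eq_inl H (by rw [List.length_map]; omega) hvis
            obtain ⟨N, hN, hsteps⟩ := ih (e + 1) (acc * PowerSeries.C c) (by omega)
            refine ⟨N + 1, by nlinarith, .step (dfsRunning_of_lt hlt) ?_⟩
            simp only [dfsStep, List.getElem?_eq_getElem hlt, dfsAction, hw, hvis]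
            rw [hc]
            exact hsteps
          | inr w' =>
            obtain ⟨rfl, hc⟩ : w = w' ∧ sawFactor H β u s (j + 1) (fs.map Frame.v) v w =
                edgeFactor β (sawRatio H β u s (j + 1) (w :: v :: fs.map Frame.v)) :=
              sawFactor_of_dfsVisit_eq_inr H hvis
            obtain ⟨N₁, hN₁, hsteps₁⟩ := ihj w (⟨v, e + 1, acc⟩ :: fs) (by
              rw [List.length_cons]; omega)
            obtain ⟨N₂, hN₂, hsteps₂⟩ := ih (e + 1) (acc *
              edgeFactor β (sawRatio H β u s (j + 1) (w :: v :: fs.map Frame.v))) (by omega)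
            refine ⟨(N₁ + (N₂ + 1)) + 1, by nlinarith, .step (dfsRunning_of_lt hlt) ?_⟩
            have h1 : dfsStep E β u s k (⟨v, e, acc⟩ :: fs) =
                ⟨w, 0, PowerSeries.X⟩ :: ⟨v, e + 1, acc⟩ :: fs := by
              simp only [dfsStep, List.getElem?_eq_getElem hlt, dfsAction, hw, hvis]
            rw [h1, hc]
            -- The finished frame of the child is removed and its factor is multiplied into the
            -- frame below, whose edge index was advanced when the child was opened.
            refine hsteps₁.trans (.step dfsRunning_cons_cons ?_)
            simp only [dfsStep, List.getElem?_eq_none le_rfl, List.map_cons]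
            exact hsteps₂
    obtain ⟨N, hN, hsteps⟩ := claim E.length 0 PowerSeries.X (by omega)
    refine ⟨N, ?_, ?_⟩
    · rw [List.drop_zero] at hN
      have h1 := Nat.mul_le_mul_right B (hΔ v)
      have h2 : (E.length + 1) * (Δ + 1) ^ (j + 1 + 1) = B * (Δ + 1) := by rw [hB]; ring
      have h3 : E.length + 1 ≤ B := Nat.le_mul_of_pos_right _ (by positivity)
      rw [h2]
      nlinarith
    · rw [sawRatio_succ_eq hE]
      simpa using hsteps

end Traversal

/-! ### Reasoning about programs -/

section Programs

/-- Started with `S`, the program `p` halts after at most `T` steps, and then `Q` holds. -/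
def Trip (p : Program) (S : Store) (T : ℕ) (Q : Store → Prop) : Prop :=
  ∃ t S', Runs p S t S' ∧ t ≤ T ∧ Q S'

theorem Trip.mono {p : Program} {S : Store} {T T' : ℕ} {Q Q' : Store → Prop} (h : Trip p S T Q)
    (hT : T ≤ T') (hQ : ∀ S', Q S' → Q' S') : Trip p S T' Q' := by
  obtain ⟨t, S', h1, h2, h3⟩ := h
  exact ⟨t, S', h1, h2.trans hT, hQ _ h3⟩

theorem Trip.skip {S : Store} {Q : Store → Prop} (h : Q S) : Trip .skip S 1 Q :=
  ⟨_, _, .skip S, le_rfl, h⟩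

theorem Trip.setNat {a : ℕ} {i e : NatExp} {S : Store} {Q : Store → Prop}
    (h : Q (S.writeNat a (i.val S) (e.val S))) :
    Trip (.setNat a i e) S (i.cost + e.cost + 1) Q :=
  ⟨_, _, .setNat a i e S, le_rfl, h⟩

theorem Trip.setNum {a : ℕ} {i : NatExp} {e : NumExp} {S : Store} {Q : Store → Prop}
    (h : Q (S.writeNum a (i.val S) (e.val S))) :
    Trip (.setNum a i e) S (i.cost + e.cost + 1) Q :=
  ⟨_, _, .setNum a i e S, le_rfl, h⟩

theorem Trip.seq {p q : Program} {S : Store} {T₁ T₂ : ℕ} {Q₁ Q : Store → Prop}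
    (hp : Trip p S T₁ Q₁) (hq : ∀ S₁, Q₁ S₁ → Trip q S₁ T₂ Q) : Trip (.seq p q) S (T₁ + T₂) Q := by
  obtain ⟨t₁, S₁, h1, h2, h3⟩ := hp
  obtain ⟨t₂, S₂, h4, h5, h6⟩ := hq S₁ h3
  exact ⟨_, _, .seq h1 h4, add_le_add h2 h5, h6⟩

theorem Trip.ite {b : Test} {p q : Program} {S : Store} {T : ℕ} {Q : Store → Prop}
    (hp : b.holds S → Trip p S T Q) (hq : ¬ b.holds S → Trip q S T Q) :
    Trip (.ite b p q) S (b.cost + T) Q := by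
  by_cases hb : b.holds S
  · obtain ⟨t, S', h1, h2, h3⟩ := hp hb
    exact ⟨_, _, .iteTrue hb h1, by omega, h3⟩
  · obtain ⟨t, S', h1, h2, h3⟩ := hq hb
    exact ⟨_, _, .iteFalse hb h1, by omega, h3⟩

/-- A loop which simulates the steps of a map. -/
theorem Trip.loop_stepsWhile {α : Type*} {P : α → Prop} {f : α → α} {R : α → Store → Prop}
    {b : Test} {p : Program} {T : ℕ}
    (hstep : ∀ x, P x → ∀ S, R x S → b.holds S ∧ Trip p S T (R (f x))) {N : ℕ} {x y : α}
    (h : StepsWhile P f N x y) (hy : ∀ S, R y S → ¬ b.holds S) {S : Store} (hS : R x S) :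
    Trip (.loop b p) S (N * (b.cost + T) + b.cost) (R y) := by
  induction h generalizing S with
  | refl x => exact ⟨_, _, .loopDone (hy S hS), by omega, hS⟩
  | @step N x y hx _ ih =>
    obtain ⟨hb, t₁, S₁, h1, h2, h3⟩ := hstep x hx S hS
    obtain ⟨t₂, S₂, h4, h5, h6⟩ := ih hy h3
    refine ⟨_, _, .loopStep hb h1 h4, ?_, h6⟩
    rw [Nat.add_mul, one_mul]
    omega

theorem stepsWhile_succ (N : ℕ) : StepsWhile (fun i => i < N) Nat.succ N 0 N := by
  have : ∀ i j, j + i = N → StepsWhile (fun i => i < N) Nat.succ i j N := by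
    intro i
    induction i with
    | zero => intro j h; obtain rfl : j = N := by omega
              exact .refl _
    | succ i ih => intro j h; exact .step (by omega) (ih (j + 1) (by omega))
  exact this N 0 (by omega)

/-- A loop with a known number of iterations. -/
theorem Trip.loop {I : ℕ → Store → Prop} {b : Test} {p : Program} {T N : ℕ}
    (hstep : ∀ i < N, ∀ S, I i S → b.holds S ∧ Trip p S T (I (i + 1)))
    (hN : ∀ S, I N S → ¬ b.holds S) {S : Store} (h0 : I 0 S) :
    Trip (.loop b p) S (N * (b.cost + T) + b.cost) (I N) :=
  Trip.loop_stepsWhile hstep (stepsWhile_succ N) hN h0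

@[simp] theorem Store.writeNat_nat (S : Store) (a i x b j : ℕ) :
    (S.writeNat a i x).nat b j = if b = a ∧ j = i then x else S.nat b j := by
  by_cases hb : b = a
  · subst hb
    by_cases hj : j = i
    · subst hj; simp [Store.writeNat]
    · simp [Store.writeNat, hj]
  · simp [Store.writeNat, hb]

@[simp] theorem Store.writeNat_num (S : Store) (a i x : ℕ) : (S.writeNat a i x).num = S.num := rfl

@[simp] theorem Store.writeNum_num (S : Store) (a i : ℕ) (x : ℂ) (b j : ℕ) :
    (S.writeNum a i x).num b j = if b = a ∧ j = i then x else S.num b j := by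
  by_cases hb : b = a
  · subst hb
    by_cases hj : j = i
    · subst hj; simp [Store.writeNum]
    · simp [Store.writeNum, hj]
  · simp [Store.writeNum, hb]

@[simp] theorem Store.writeNum_nat (S : Store) (a i : ℕ) (x : ℂ) :
    (S.writeNum a i x).nat = S.nat := rfl

/-- The memories differ at most in the arrays `ns` of natural numbers and `ms` of complex
numbers. -/
def Same (ns ms : List ℕ) (S S' : Store) : Prop :=
  (∀ a ∉ ns, ∀ i, S'.nat a i = S.nat a i) ∧ ∀ a ∉ ms, ∀ i, S'.num a i = S.num a i

theorem Same.refl (ns ms : List ℕ) (S : Store) : Same ns ms S S :=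
  ⟨fun _ _ _ => rfl, fun _ _ _ => rfl⟩

/-- Array numbers are usually literals, so the default proofs by `decide` can settle which arrays a
program part may change. -/
theorem Same.trans {ns ms ns' ms' ns'' ms'' : List ℕ} {S S' S'' : Store} (h : Same ns ms S S')
    (h' : Same ns' ms' S' S'') (h1 : ns ⊆ ns'' := by decide) (h2 : ns' ⊆ ns'' := by decide)
    (h3 : ms ⊆ ms'' := by decide) (h4 : ms' ⊆ ms'' := by decide) : Same ns'' ms'' S S'' :=
  ⟨fun a ha i => (h'.1 a (fun h => ha (h2 h)) i).trans (h.1 a (fun h => ha (h1 h)) i),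
    fun a ha i => (h'.2 a (fun h => ha (h4 h)) i).trans (h.2 a (fun h => ha (h3 h)) i)⟩

theorem Same.writeNat {ns ms : List ℕ} {S S' : Store} (h : Same ns ms S S') {a : ℕ} (i x : ℕ)
    (ha : a ∈ ns := by decide) : Same ns ms S (S'.writeNat a i x) := by
  refine ⟨fun b hb j => ?_, h.2⟩
  have : b ≠ a := fun h => hb (h ▸ ha)
  rw [Store.writeNat_nat, if_neg (fun h => this h.1), h.1 b hb]

theorem Same.writeNum {ns ms : List ℕ} {S S' : Store} (h : Same ns ms S S') {a : ℕ} (i : ℕ) (x : ℂ)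
    (ha : a ∈ ms := by decide) : Same ns ms S (S'.writeNum a i x) := by
  refine ⟨h.1, fun b hb j => ?_⟩
  have : b ≠ a := fun h => hb (h ▸ ha)
  rw [Store.writeNum_num, if_neg (fun h => this h.1), h.2 b hb]

theorem Same.nat {ns ms : List ℕ} {S S' : Store} (h : Same ns ms S S') {a : ℕ} (i : ℕ)
    (ha : a ∉ ns := by decide) : S'.nat a i = S.nat a i := h.1 a ha i

theorem Same.num {ns ms : List ℕ} {S S' : Store} (h : Same ns ms S S') {a : ℕ} (i : ℕ)
    (ha : a ∉ ms := by decide) : S'.num a i = S.num a i := h.2 a ha i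

/-- The cell `0` of an array of natural numbers. -/
def NatExp.reg (a : ℕ) : NatExp := .cell a (.const 0)

/-- The cell `0` of an array of complex numbers. -/
def NumExp.reg (a : ℕ) : NumExp := .cell a (.const 0)

/-- Assignment to the cell `0` of an array of natural numbers. -/
def Program.letNat (a : ℕ) (e : NatExp) : Program := .setNat a (.const 0) e

/-- Assignment to the cell `0` of an array of complex numbers. -/
def Program.letNum (a : ℕ) (e : NumExp) : Program := .setNum a (.const 0) e

@[simp] theorem NatExp.val_reg (S : Store) (a : ℕ) : (NatExp.reg a).val S = S.nat a 0 := rfl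
@[simp] theorem NumExp.val_reg (S : Store) (a : ℕ) : (NumExp.reg a).val S = S.num a 0 := rfl
@[simp] theorem NatExp.cost_reg (a : ℕ) : (NatExp.reg a).cost = 2 := rfl
@[simp] theorem NumExp.cost_reg (a : ℕ) : (NumExp.reg a).cost = 2 := rfl

attribute [simp] NatExp.val NumExp.val NatExp.cost NumExp.cost Test.cost Test.holds

theorem Trip.letNat {a : ℕ} {e : NatExp} {S : Store} {Q : Store → Prop}
    (h : Q (S.writeNat a 0 (e.val S))) : Trip (.letNat a e) S (e.cost + 2) Q :=
  (Trip.setNat (i := .const 0) h).mono (by simp; omega) fun _ h => h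

theorem Trip.letNum {a : ℕ} {e : NumExp} {S : Store} {Q : Store → Prop}
    (h : Q (S.writeNum a 0 (e.val S))) : Trip (.letNum a e) S (e.cost + 2) Q :=
  (Trip.setNum (i := .const 0) h).mono (by simp; omega) fun _ h => h

/-- Run `p` with the counter in cell `0` of the array `a` going from `0` to the value of `e`. -/
def Program.forTo (a : ℕ) (e : NatExp) (p : Program) : Program :=
  .seq (.letNat a (.const 0)) (.loop (.natLt (.reg a) e)
    (.seq p (.letNat a (.add (.reg a) (.const 1)))))

/-- The bound `e` is evaluated again before every iteration, so the invariant has to fix its value.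
The invariant is stated after the counter has been written. The `9` collects the remaining cost of
the test and of the increment. -/
theorem Trip.forTo {a : ℕ} {e : NatExp} {p : Program} {I : ℕ → Store → Prop} {T N : ℕ} {S : Store}
    (h0 : I 0 (S.writeNat a 0 0))
    (hI : ∀ i ≤ N, ∀ S', I i S' → S'.nat a 0 = i → e.val S' = N)
    (hstep : ∀ i < N, ∀ S', I i S' → S'.nat a 0 = i →
      Trip p S' T fun S'' => S''.nat a 0 = i ∧ I (i + 1) (S''.writeNat a 0 (i + 1))) :
    Trip (.forTo a e p) S ((N + 1) * (e.cost + T + 9)) (I N) := by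
  have key := Trip.seq (p := .letNat a (.const 0)) (S := S)
    (Q₁ := fun S' => S'.nat a 0 = 0 ∧ I 0 S') (Trip.letNat ⟨by simp, by simpa using h0⟩)
    (fun S₁ hS₁ => Trip.loop (I := fun i S' => S'.nat a 0 = i ∧ I i S') (b := .natLt (.reg a) e)
      (p := .seq p (.letNat a (.add (.reg a) (.const 1)))) (T := T + 6) (N := N)
      (fun i hi S' hS' => by
        refine ⟨?_, ?_⟩
        · simp only [Test.holds, NatExp.val_reg, hS'.1, hI i hi.le S' hS'.2 hS'.1]
          exact hi
        · refine Trip.seq (hstep i hi S' hS'.2 hS'.1) fun S'' hS'' => ?_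
          refine (Trip.letNat ?_).mono (by simp) fun _ h => h
          simp only [NatExp.val, NatExp.val_reg, hS''.1]
          exact ⟨by simp, hS''.2⟩)
      (fun S' hS' => by
        simp only [Test.holds, NatExp.val_reg, hS'.1, hI N le_rfl S' hS'.2 hS'.1, lt_irrefl,
          not_false_iff])
      hS₁)
  refine key.mono ?_ fun _ h => h.2
  simp only [NatExp.cost, Test.cost, NatExp.cost_reg]
  nlinarith

/-- A loop which fills a segment of an array. -/
theorem Trip.fill {a : ℕ} {bnd i : NatExp} {e : NumExp} {S : Store} {off N : ℕ} {g : ℕ → ℂ}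
    (h : ∀ j ≤ N, ∀ S', Same [14] [a] S S' → S'.nat 14 0 = j →
      (∀ l, S'.num a l = if off ≤ l ∧ l < off + j then g (l - off) else S.num a l) →
      bnd.val S' = N ∧ (j < N → i.val S' = off + j ∧ e.val S' = g j)) :
    Trip (.forTo 14 bnd (.setNum a i e)) S ((N + 1) * (bnd.cost + i.cost + e.cost + 10)) fun S' =>
      Same [14] [a] S S' ∧
        ∀ l, S'.num a l = if off ≤ l ∧ l < off + N then g (l - off) else S.num a l := by
  refine (Trip.forTo (T := i.cost + e.cost + 1) (N := N)
    (I := fun j S' => Same [14] [a] S S' ∧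
      ∀ l, S'.num a l = if off ≤ l ∧ l < off + j then g (l - off) else S.num a l)
    ?_ ?_ ?_).mono ?_ fun _ h => h
  · refine ⟨(Same.refl _ _ _).writeNat _ _ , fun l => ?_⟩
    rw [if_neg (by omega), Store.writeNat_num]
  · intro j hj S' hS' hj'
    exact (h j hj S' hS'.1 hj' hS'.2).1
  · intro j hj S' hS' hj'
    obtain ⟨h1, h2⟩ := (h j hj.le S' hS'.1 hj' hS'.2).2 hj
    refine Trip.setNum ?_
    rw [h1, h2]
    refine ⟨by simpa using hj', (hS'.1.writeNum _ _ (by simp)).writeNat _ _, fun l => ?_⟩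
    rw [Store.writeNat_num, Store.writeNum_num, hS'.2]
    by_cases hl : l = off + j
    · subst hl
      rw [if_pos ⟨rfl, rfl⟩, if_pos (by omega)]
      congr 1; omega
    · rw [if_neg (by simp [hl])]
      refine if_congr ?_ rfl rfl
      omega
  · apply Nat.mul_le_mul_left; omega

/-! ### Arithmetic of truncated power series -/

/-- The array `a` holds the coefficients of `p` up to degree `k`, from the cell `off` on. -/
def Coeffs (k : ℕ) (S : Store) (a off : ℕ) (p : PowerSeries ℂ) : Prop :=
  ∀ j ≤ k, S.num a (off + j) = PowerSeries.coeff j p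

/-- The number of coefficients. -/
def lenExp : NatExp := .add (.reg 5) (.const 1)

/-- Compute the coefficients of `A N / D`, where the arrays `5`, `3`, `4` hold those of `A`, `N`
and `D`, in the array `6`. -/
def mulDivProg : Program :=
  .forTo 14 lenExp (.seq (.setNum 6 (.reg 14) (.const 0)) (.seq (.letNum 8 (.const 0))
    (.seq (.forTo 15 (.add (.reg 14) (.const 1)) (.letNum 8 (.add (.reg 8)
        (.sub (.mul (.cell 5 (.sub (.reg 14) (.reg 15))) (.cell 3 (.reg 15)))
          (.mul (.cell 4 (.reg 15)) (.cell 6 (.sub (.reg 14) (.reg 15))))))))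
      (.setNum 6 (.reg 14) (.div (.reg 8) (.reg 4))))))

/-- Comparing coefficients in `D Y = A N` expresses `Y_j` by the earlier coefficients of `Y` and a
division by `D_0`. The term `l = 0` is replaced by `0` to match the program, which clears the cell
of `Y_j` before it sums. -/
theorem coeff_mul_mul_inv {A N D : PowerSeries ℂ} (hD : PowerSeries.constantCoeff D ≠ 0) (j : ℕ) :
    (∑ l ∈ Finset.range (j + 1), (PowerSeries.coeff (j - l) A * PowerSeries.coeff l N -
      PowerSeries.coeff l D * if l = 0 then 0 else PowerSeries.coeff (j - l) (A * N * D⁻¹))) /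
      PowerSeries.coeff 0 D = PowerSeries.coeff j (A * N * D⁻¹) := by
  have h0 : PowerSeries.coeff 0 D ≠ 0 := by simpa using hD
  rw [div_eq_iff h0]
  have h1 : PowerSeries.coeff j (D * (A * N * D⁻¹)) = PowerSeries.coeff j (N * A) := by
    congr 1
    linear_combination A * N * PowerSeries.mul_inv_cancel _ hD
  rw [PowerSeries.coeff_mul, PowerSeries.coeff_mul,
    Finset.Nat.sum_antidiagonal_eq_sum_range_succ_mk,
    Finset.Nat.sum_antidiagonal_eq_sum_range_succ_mk, Finset.sum_range_succ'] at h1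
  simp only [Nat.sub_zero] at h1
  rw [Finset.sum_sub_distrib]
  have h2 : ∑ l ∈ Finset.range (j + 1), (PowerSeries.coeff l D *
      if l = 0 then 0 else PowerSeries.coeff (j - l) (A * N * D⁻¹)) =
      ∑ l ∈ Finset.range j, PowerSeries.coeff (l + 1) D *
        PowerSeries.coeff (j - (l + 1)) (A * N * D⁻¹) := by
    rw [Finset.sum_range_succ']
    simp
  rw [h2, Finset.sum_congr rfl fun l _ => mul_comm (PowerSeries.coeff (j - l) A) _]
  linear_combination -h1

theorem mulDivProg_spec {k : ℕ} {S : Store} {A N D : PowerSeries ℂ} (hk : S.nat 5 0 = k)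
    (hA : Coeffs k S 5 0 A) (hN : Coeffs k S 3 0 N) (hD : Coeffs k S 4 0 D)
    (hD0 : PowerSeries.constantCoeff D ≠ 0) :
    Trip mulDivProg S (500 * (k + 1) ^ 2) fun S' =>
      Same [14, 15] [6, 8] S S' ∧ Coeffs k S' 6 0 (A * N * D⁻¹) := by
  set Y := A * N * D⁻¹ with hY
  simp only [Coeffs, zero_add] at hA hN hD ⊢
  refine (Trip.forTo (N := k + 1) (T := 60 * (k + 2)) (I := fun j S' => Same [14, 15] [6, 8] S S' ∧
    ∀ l < j, S'.num 6 l = PowerSeries.coeff l Y) ?_ ?_ ?_).mono ?_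
      fun S' hS' => ⟨hS'.1, fun j hj => hS'.2 j (by omega)⟩
  · exact ⟨(Same.refl _ _ _).writeNat _ _, fun l hl => absurd hl (by omega)⟩
  · intro j _ S' hS' _
    simp [lenExp, hS'.1.1, hk]
  · intro j hj S₁ hS₁ hj₁
    have key : Trip (.seq (.setNum 6 (.reg 14) (.const 0)) (.seq (.letNum 8 (.const 0))
      (.seq (.forTo 15 (.add (.reg 14) (.const 1)) (.letNum 8 (.add (.reg 8)
        (.sub (.mul (.cell 5 (.sub (.reg 14) (.reg 15))) (.cell 3 (.reg 15)))
          (.mul (.cell 4 (.reg 15)) (.cell 6 (.sub (.reg 14) (.reg 15))))))))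
      (.setNum 6 (.reg 14) (.div (.reg 8) (.reg 4)))))) S₁
      (4 + (3 + ((j + 1 + 1) * 40 + 8)))
        (fun S'' => S''.nat 14 0 = j ∧ Same [14, 15] [6, 8] S S'' ∧
          ∀ l < j + 1, S''.num 6 l = PowerSeries.coeff l Y) := by
      refine Trip.seq (Trip.setNum (Q := fun S' => S' = S₁.writeNum 6 j 0) ?_) ?_
      · simp [hj₁]
      rintro _ rfl
      refine Trip.seq (Trip.letNum (Q := fun S' => S' = (S₁.writeNum 6 j 0).writeNum 8 0 0) ?_) ?_
      · simp
      rintro _ rfl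
      set S₂ := (S₁.writeNum 6 j 0).writeNum 8 0 0 with hS₂
      have hs₂ : Same [14, 15] [6, 8] S S₂ := (hS₁.1.writeNum _ _).writeNum _ _
      refine Trip.seq ((Trip.forTo (N := j + 1) (T := 26) (I := fun i S' => Same [15] [8] S₂ S' ∧
        S'.num 8 0 = ∑ l ∈ Finset.range i, (PowerSeries.coeff (j - l) A * PowerSeries.coeff l N -
          PowerSeries.coeff l D * if l = 0 then 0 else PowerSeries.coeff (j - l) Y)) ?_ ?_ ?_).mono (T' := (j + 1 + 1) * 40)
          (by simp only [NatExp.cost, NatExp.cost_reg]; omega) fun _ h => h) ?_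
      · exact ⟨(Same.refl _ _ _).writeNat _ _, by simp [hS₂]⟩
      · intro i _ S' hS' _
        simp [hS'.1.1, hS₂, hj₁]
      · intro i hi S' hS' hi'
        refine (Trip.letNum ?_).mono (by simp) fun _ h => h
        have hs' := hs₂.trans hS'.1 (ns'' := [14, 15]) (ms'' := [6, 8])
        have e1 : S'.nat 14 0 = j := by rw [hS'.1.nat]; simp [hS₂, hj₁]
        have e2 : S'.num 6 (j - i) = if i = 0 then 0 else PowerSeries.coeff (j - i) Y := by
          rw [hS'.1.num]
          simp only [hS₂, Store.writeNum_num]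
          by_cases h : i = 0
          · simp [h]
          · rw [if_neg (by omega), if_neg (by omega), if_neg h, hS₁.2 _ (by omega)]
        refine ⟨by simpa using hi', (hS'.1.writeNum _ _).writeNat _ _, ?_⟩
        rw [Finset.sum_range_succ, ← hS'.2]
        simp only [Store.writeNat_num, Store.writeNum_num, true_and, if_true, NumExp.val,
          NumExp.val_reg, NatExp.val, NatExp.val_reg, e1, hi', e2, hs'.num (a := 5), hs'.num (a := 4),
          hs'.num (a := 3), hA (j - i) (by omega),
          hN i (by omega), hD i (by omega)]
      · intro S₃ hS₃
        have hs₃ := hs₂.trans hS₃.1 (ns'' := [14, 15]) (ms'' := [6, 8])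
        have hco := coeff_mul_mul_inv (A := A) (N := N) hD0 j
        rw [← hY] at hco
        have e1 : S₃.nat 14 0 = j := by rw [hS₃.1.nat]; simp [hS₂, hj₁]
        refine (Trip.setNum ?_).mono (T' := 8) (by simp) fun _ h => h
        refine ⟨by simpa using e1, hs₃.writeNum _ _, fun l hl => ?_⟩
        simp only [NatExp.val_reg, NumExp.val, NumExp.val_reg, e1, hS₃.2, hs₃.num (a := 4),
          hD 0 (by omega), hco, Store.writeNum_num, true_and]
        split_ifs with h
        · rw [h]
        · rw [hS₃.1.num]
          simp only [hS₂, Store.writeNum_num]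
          rw [if_neg (by omega), if_neg (by omega), hS₁.2 l (by omega)]
    refine key.mono (by omega) fun S'' hS'' => ⟨hS''.1, hS''.2.1.writeNat _ _, ?_⟩
    simpa using hS''.2.2
  · have h : lenExp.cost = 4 := rfl
    calc (k + 1 + 1) * (lenExp.cost + 60 * (k + 2) + 9)
        ≤ (2 * (k + 1)) * (133 * (k + 1)) := Nat.mul_le_mul (by omega) (by rw [h]; omega)
      _ ≤ 500 * (k + 1) ^ 2 := by ring_nf; omega

end Programs

/-! ### The traversal as a program -/

section DfsProgram

variable {n : ℕ}

/-- The cells `0, 1, …` of the array `3` hold the walk. -/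
def WalkRep (S : Store) : List (Fin n) → Prop
  | [] => True
  | v :: p => S.nat 3 p.length = v ∧ WalkRep S p

/-- The arrays `2`, `3` and `4` hold the stack. -/
def StackRep (k : ℕ) (S : Store) : List (Frame n) → Prop
  | [] => True
  | f :: fs => S.nat 3 fs.length = f.v ∧ S.nat 4 fs.length = f.e ∧
      Coeffs k S 2 (fs.length * (k + 1)) f.acc ∧ StackRep k S fs

theorem StackRep.walkRep {k : ℕ} {S : Store} {st : List (Frame n)} (h : StackRep k S st) :
    WalkRep S (st.map Frame.v) := by
  induction st with
  | nil => trivial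
  | cons f fs ih => exact ⟨by simpa using h.1, ih h.2.2.2⟩

theorem WalkRep.congr {S S' : Store} (hS : ∀ i, S'.nat 3 i = S.nat 3 i) {p : List (Fin n)}
    (h : WalkRep S p) : WalkRep S' p := by
  induction p with
  | nil => trivial
  | cons v p ih => exact ⟨(hS _).trans h.1, ih h.2⟩

/-- Only cells below the height of the stack matter, so the space above it can be overwritten
freely. -/
theorem StackRep.congr {k : ℕ} {S S' : Store} {st : List (Frame n)} (h : StackRep k S st)
    (h3 : ∀ i < st.length, S'.nat 3 i = S.nat 3 i) (h4 : ∀ i < st.length, S'.nat 4 i = S.nat 4 i)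
    (h2 : ∀ i < st.length * (k + 1), S'.num 2 i = S.num 2 i) : StackRep k S' st := by
  induction st with
  | nil => trivial
  | cons f fs ih =>
    have hlen : (f :: fs).length = fs.length + 1 := rfl
    rw [hlen] at h3 h4 h2
    refine ⟨(h3 _ (by omega)).trans h.1, (h4 _ (by omega)).trans h.2.1, fun j hj => ?_,
      ih h.2.2.2 (fun i hi => h3 i (by omega)) (fun i hi => h4 i (by omega))
        fun i hi => h2 i (by rw [Nat.add_mul]; omega)⟩
    rw [h2 _ (by rw [Nat.add_mul]; omega)]
    exact h.2.2.1 j hj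

/-- The parameters of the traversal. -/
structure DfsCtx (E : List (Fin n × Fin n)) (β : ℝ) (u : Fin n) (s : Bool) (k : ℕ) (S : Store) :
    Prop where
  k_eq : S.nat 5 0 = k
  len_eq : S.nat 8 0 = E.length
  pin_eq : S.nat 9 0 = u
  spin_eq : S.nat 10 0 = if s = true then 1 else 0
  fst_eq : ∀ (i : ℕ) (h : i < E.length), S.nat 1 i = E[i].1
  snd_eq : ∀ (i : ℕ) (h : i < E.length), S.nat 2 i = E[i].2
  beta_eq : S.num 0 0 = β

theorem DfsCtx.congr {E : List (Fin n × Fin n)} {β : ℝ} {u : Fin n} {s : Bool} {k : ℕ} {S S' : Store}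
    (h : DfsCtx E β u s k S) {ns ms : List ℕ} (hS : Same ns ms S S')
    (hns : ∀ a ∈ [1, 2, 5, 8, 9, 10], a ∉ ns := by decide) (hms : 0 ∉ ms := by decide) :
    DfsCtx E β u s k S' where
  k_eq := (hS.1 5 (hns _ (by simp)) 0).trans h.k_eq
  len_eq := (hS.1 8 (hns _ (by simp)) 0).trans h.len_eq
  pin_eq := (hS.1 9 (hns _ (by simp)) 0).trans h.pin_eq
  spin_eq := (hS.1 10 (hns _ (by simp)) 0).trans h.spin_eq
  fst_eq i hi := (hS.1 1 (hns _ (by simp)) i).trans (h.fst_eq i hi)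
  snd_eq i hi := (hS.1 2 (hns _ (by simp)) i).trans (h.snd_eq i hi)
  beta_eq := (hS.2 0 hms 0).trans h.beta_eq

/-- Search for the vertex in the cell `11` on the walk, from the top of the stack. -/
def searchProg : Program :=
  .seq (.letNat 12 (.reg 6)) (.loop (.conj (.natLt (.const 0) (.reg 12))
    (.neg (.natEq (.cell 3 (.sub (.reg 12) (.const 1))) (.reg 11))))
    (.letNat 12 (.sub (.reg 12) (.const 1))))

/-- The index `q` at which the search stops is one above the position of `w`. Hence cell `q` holds
the vertex to which the walk moved from `w`, and `q = 0` is free to mean that `w` was not found. -/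
theorem exists_search_index (S : Store) (w : Fin n) (p : List (Fin n)) :
    ∀ v, WalkRep S (v :: p) → ∃ q ≤ p.length,
      (∀ i, q ≤ i → i < p.length → S.nat 3 i ≠ w) ∧
      ((w ∈ p ∧ 0 < q ∧ S.nat 3 (q - 1) = w ∧ S.nat 3 q = stepAfter w (v :: p)) ∨
        (w ∉ p ∧ q = 0)) := by
  induction p with
  | nil => intro v _; exact ⟨0, le_rfl, fun i _ hi => absurd hi (by simp), Or.inr ⟨by simp, rfl⟩⟩
  | cons y p ih =>
    intro v hv
    obtain ⟨h1, h2, h3⟩ := hv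
    by_cases hyw : y = w
    · refine ⟨p.length + 1, by simp, fun i hi hi' => absurd hi' (by simp; omega),
        Or.inl ⟨by simp [hyw], by omega, by rw [Nat.add_sub_cancel, h2, hyw], ?_⟩⟩
      rw [List.length_cons] at h1
      rw [h1, stepAfter, if_pos hyw]
    · obtain ⟨q, hq, hne, hcase⟩ := ih y ⟨h2, h3⟩
      refine ⟨q, by simp; omega, fun i hi hi' => ?_, ?_⟩
      · rw [List.length_cons] at hi'
        rcases Nat.lt_succ_iff_lt_or_eq.1 hi' with h | rfl
        · exact hne i hi h
        · rw [h2]; exact fun h => hyw (Fin.ext h)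
      · rw [stepAfter, if_neg hyw]
        rcases hcase with ⟨a1, a2⟩ | ⟨a1, a2⟩
        · exact Or.inl ⟨List.mem_cons_of_mem _ a1, a2⟩
        · refine Or.inr ⟨?_, a2⟩
          rw [List.mem_cons, not_or]
          exact ⟨fun h => hyw h.symm, a1⟩

theorem searchProg_spec {S : Store} {v w : Fin n} {p : List (Fin n)} (hw : WalkRep S (v :: p))
    (h6 : S.nat 6 0 = p.length) (h11 : S.nat 11 0 = w) :
    Trip searchProg S (30 * (p.length + 1)) fun S' => Same [12] [] S S' ∧
      ((w ∈ p ∧ 0 < S'.nat 12 0 ∧ S'.nat 3 (S'.nat 12 0) = stepAfter w (v :: p)) ∨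
        (w ∉ p ∧ S'.nat 12 0 = 0)) := by
  obtain ⟨q, hq, hne, hcase⟩ := exists_search_index S w p v hw
  have key := Trip.seq (p := .letNat 12 (.reg 6)) (S := S) (Q₁ := fun S' => Same [12] [] S S' ∧
    S'.nat 12 0 = p.length - 0) (Trip.letNat ⟨(Same.refl _ _ _).writeNat _ _, by simp [h6]⟩)
    (fun S₁ hS₁ => Trip.loop (I := fun i S' => Same [12] [] S S' ∧ S'.nat 12 0 = p.length - i)
      (b := .conj (.natLt (.const 0) (.reg 12))
        (.neg (.natEq (.cell 3 (.sub (.reg 12) (.const 1))) (.reg 11))))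
      (p := .letNat 12 (.sub (.reg 12) (.const 1))) (T := 8) (N := p.length - q)
      (fun i hi S' hS' => by
        refine ⟨?_, (Trip.letNat ?_).mono (by simp) fun _ h => h⟩
        · simp only [Test.holds, NatExp.val, NatExp.val_reg, hS'.2, hS'.1.nat (a := 11),
            hS'.1.nat (a := 3), h11]
          exact ⟨by omega, hne _ (by omega) (by omega)⟩
        · refine ⟨hS'.1.writeNat _ _, ?_⟩
          simp only [NatExp.val, NatExp.val_reg, hS'.2, Store.writeNat_nat, and_self, if_true]
          omega)
      (fun S' hS' => by
        simp only [Test.holds, NatExp.val, NatExp.val_reg, hS'.2, hS'.1.nat (a := 11),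
            hS'.1.nat (a := 3), h11]
        have h1 : p.length - (p.length - q) = q := by omega
        rw [h1]
        rintro ⟨h2, h3⟩
        rcases hcase with ⟨-, -, a2, -⟩ | ⟨-, a2⟩
        · exact h3 a2
        · omega) hS₁)
  refine key.mono ?_ fun S' hS' => ⟨hS'.1, ?_⟩
  · simp only [NatExp.cost, NatExp.cost_reg, Test.cost]
    omega
  · have h1 : p.length - (p.length - q) = q := by omega
    rw [hS'.2, h1, hS'.1.nat]
    rcases hcase with ⟨a1, a2, -, a3⟩ | h
    · exact Or.inl ⟨a1, a2, a3⟩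
    · exact Or.inr h

/-- Store `β`. -/
def betaProg : Program := .letNum 7 (.reg 0)

/-- Store `1 / β`. -/
def betaInvProg : Program := .letNum 7 (.div (.const 1) (.reg 0))

/-- The cells which represent what to do with an edge. -/
def ActionRep (S : Store) : ℂ ⊕ Fin n → Prop
  | .inl c => S.nat 13 0 = 0 ∧ S.num 7 0 = c
  | .inr w => S.nat 13 0 = 1 ∧ S.nat 11 0 = w

/-- Decide what to do with the neighbour in the cell `11`. -/
def visitProg : Program :=
  .ite (.conj (.natLt (.const 0) (.reg 6)) (.natEq (.cell 3 (.sub (.reg 6) (.const 1))) (.reg 11)))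
    .skip
    (.ite (.natEq (.reg 11) (.reg 9))
      (.ite (.natEq (.reg 10) (.const 1)) betaProg betaInvProg)
      (.seq searchProg
        (.ite (.natLt (.const 0) (.reg 12))
          (.ite (.natLt (.cell 3 (.reg 6)) (.cell 3 (.reg 12))) betaProg betaInvProg)
          (.ite (.natEq (.add (.reg 6) (.const 1)) (.reg 5)) betaInvProg
            (.letNat 13 (.const 1))))))

theorem betaProg_spec {S : Store} {β : ℝ} (hβ : S.num 0 0 = β) (h13 : S.nat 13 0 = 0) :
    Trip betaProg S 8 fun S' => Same [12, 13] [7] S S' ∧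
      ActionRep S' (.inl (β : ℂ) : ℂ ⊕ Fin n) := by
  refine (Trip.letNum ?_).mono (by simp) fun _ h => h
  exact ⟨(Same.refl _ _ _).writeNum _ _, by simp [h13], by simp [hβ]⟩

theorem betaInvProg_spec {S : Store} {β : ℝ} (hβ : S.num 0 0 = β) (h13 : S.nat 13 0 = 0) :
    Trip betaInvProg S 8 fun S' => Same [12, 13] [7] S S' ∧
      ActionRep S' (.inl (β : ℂ)⁻¹ : ℂ ⊕ Fin n) := by
  refine (Trip.letNum ?_).mono (by simp) fun _ h => h
  exact ⟨(Same.refl _ _ _).writeNum _ _, by simp [h13], by simp [hβ]⟩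

/-- The flag `0` in cell `13` and the factor `1` in cell `7` are preset. They are already the right
outcome for the step back, where the program does nothing. -/
theorem visitProg_spec {E : List (Fin n × Fin n)} {β : ℝ} {u : Fin n} {s : Bool} {k : ℕ} {S : Store}
    (hctx : DfsCtx E β u s k S) {v w : Fin n} {p : List (Fin n)} (hw : WalkRep S (v :: p))
    (h6 : S.nat 6 0 = p.length) (h11 : S.nat 11 0 = w) (h13 : S.nat 13 0 = 0)
    (h7 : S.num 7 0 = 1) :
    Trip visitProg S (30 * (p.length + 1) + 50) fun S' => Same [12, 13] [7] S S' ∧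
      ActionRep S' (dfsVisit β u s k p v w) := by
  -- Detecting the step back requires only a look at the cell below the top of the stack, provided
  -- the walk has a previous vertex.
  have hhead : p.head? = some w ↔ 0 < p.length ∧ S.nat 3 (p.length - 1) = w := by
    cases p with
    | nil => simp
    | cons y p => simp [hw.2.1, Fin.val_inj]
  have key : Trip visitProg S (13 + (5 + (30 * (p.length + 1) + 30))) fun S' =>
      Same [12, 13] [7] S S' ∧ ActionRep S' (dfsVisit β u s k p v w) := by
    unfold dfsVisit
    refine Trip.ite (fun hb => ?_) fun hb => ?_
    · simp only [Test.holds, NatExp.val, NatExp.val_reg, h6, h11] at hb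
      rw [if_pos (hhead.2 hb)]
      exact (Trip.skip ⟨Same.refl _ _ _, h13, h7⟩).mono (by omega) fun _ h => h
    simp only [Test.holds, NatExp.val, NatExp.val_reg, h6, h11] at hb
    rw [if_neg (fun h => hb (hhead.1 h))]
    refine Trip.ite (fun hb => ?_) fun hb => ?_
    · simp only [Test.holds, NatExp.val_reg, h11, hctx.pin_eq, Fin.val_inj] at hb
      rw [if_pos hb]
      refine (Trip.ite (T := 8) (fun hb => ?_) fun hb => ?_).mono (by simp) fun _ h => h
      · simp only [Test.holds, NatExp.val, NatExp.val_reg, hctx.spin_eq] at hb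
        rw [if_pos (by by_contra h; simp [h] at hb)]
        exact betaProg_spec hctx.beta_eq h13
      · simp only [Test.holds, NatExp.val, NatExp.val_reg, hctx.spin_eq] at hb
        rw [if_neg (fun h => by simp [h] at hb)]
        exact betaInvProg_spec hctx.beta_eq h13
    simp only [Test.holds, NatExp.val_reg, h11, hctx.pin_eq, Fin.val_inj] at hb
    rw [if_neg hb]
    refine (Trip.seq (T₂ := 30) (searchProg_spec hw h6 h11) fun S₁ hS₁ => ?_).mono (by omega)
      fun _ h => h
    obtain ⟨hs, hcase⟩ := hS₁
    have h13' : S₁.nat 13 0 = 0 := (hs.nat 0).trans h13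
    have hβ' : S₁.num 0 0 = β := (hs.num 0).trans hctx.beta_eq
    have comb : ∀ S' a, Same [12, 13] [7] S₁ S' ∧ ActionRep S' (a : ℂ ⊕ Fin n) →
        Same [12, 13] [7] S S' ∧ ActionRep S' a := fun S' a h => ⟨hs.trans h.1, h.2⟩
    refine (Trip.ite (T := 20) (fun hb => ?_) fun hb => ?_).mono (by simp) fun _ h => h
    · simp only [Test.holds, NatExp.val, NatExp.val_reg] at hb
      rcases hcase with ⟨h1, -, h3⟩ | ⟨-, h2⟩
      · rw [if_pos h1]
        refine (Trip.ite (T := 8) (fun hb => ?_) fun hb => ?_).mono (by simp) fun _ h => h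
        · simp only [Test.holds, NatExp.val, NatExp.val_reg, h3, hs.nat (a := 6), hs.nat (a := 3),
            h6, hw.1, Fin.val_fin_lt] at hb
          rw [if_pos hb]
          exact (betaProg_spec hβ' h13').mono le_rfl fun S' h => comb S' _ h
        · simp only [Test.holds, NatExp.val, NatExp.val_reg, h3, hs.nat (a := 6), hs.nat (a := 3),
            h6, hw.1, Fin.val_fin_lt] at hb
          rw [if_neg hb]
          exact (betaInvProg_spec hβ' h13').mono le_rfl fun S' h => comb S' _ h
      · omega
    · simp only [Test.holds, NatExp.val, NatExp.val_reg] at hb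
      rcases hcase with ⟨-, h2, -⟩ | ⟨h1, -⟩
      · omega
      · rw [if_neg h1]
        refine (Trip.ite (T := 8) (fun hb => ?_) fun hb => ?_).mono (by simp) fun _ h => h
        · simp only [Test.holds, NatExp.val, NatExp.val_reg, hs.nat (a := 6), hs.nat (a := 5), h6,
            hctx.k_eq] at hb
          rw [if_pos hb]
          exact (betaInvProg_spec hβ' h13').mono le_rfl fun S' h => comb S' _ h
        · simp only [Test.holds, NatExp.val, NatExp.val_reg, hs.nat (a := 6), hs.nat (a := 5), h6,
            hctx.k_eq] at hb
          rw [if_neg hb]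
          refine (Trip.letNat ?_).mono (by simp) fun _ h => h
          refine ⟨(hs.trans (Same.refl [12, 13] [7] _)).writeNat _ _, by simp, ?_⟩
          simp [hs.nat (a := 11), h11]
  exact key.mono (by omega) fun _ h => h

/-- The index of the current edge. -/
def edgeExp : NatExp := .cell 4 (.reg 6)

/-- Decide what to do with the current edge. -/
def actionProg : Program :=
  .seq (.letNum 7 (.const 1)) (.seq (.letNat 13 (.const 0))
    (.ite (.natEq (.cell 1 edgeExp) (.cell 3 (.reg 6)))
      (.seq (.letNat 11 (.cell 2 edgeExp)) visitProg)
      (.ite (.natEq (.cell 2 edgeExp) (.cell 3 (.reg 6)))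
        (.seq (.letNat 11 (.cell 1 edgeExp)) visitProg) .skip)))

theorem actionProg_spec {E : List (Fin n × Fin n)} {β : ℝ} {u : Fin n} {s : Bool} {k : ℕ} {S : Store}
    (hctx : DfsCtx E β u s k S) {v : Fin n} {e : ℕ} {p : List (Fin n)} (hw : WalkRep S (v :: p))
    (h6 : S.nat 6 0 = p.length) (h4 : S.nat 4 p.length = e) (he : e < E.length) :
    Trip actionProg S (30 * (p.length + 1) + 100) fun S' => Same [11, 12, 13] [7] S S' ∧
      ActionRep S' (dfsAction β u s k p v E[e]) := by
  have key : Trip actionProg S (3 + (3 + (8 + (8 + (6 + (30 * (p.length + 1) + 50)))))) fun S' =>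
      Same [11, 12, 13] [7] S S' ∧ ActionRep S' (dfsAction β u s k p v E[e]) := by
    refine Trip.seq (Trip.letNum (Q := fun S' => S' = S.writeNum 7 0 1) (by simp)) ?_
    rintro _ rfl
    refine Trip.seq (Trip.letNat (Q := fun S' => S' = (S.writeNum 7 0 1).writeNat 13 0 0)
      (by simp)) ?_
    rintro _ rfl
    set S₁ := (S.writeNum 7 0 1).writeNat 13 0 0 with hS₁
    have hs : Same [11, 12, 13] [7] S S₁ := ((Same.refl _ _ _).writeNum _ _).writeNat _ _
    have h13 : S₁.nat 13 0 = 0 := by simp [hS₁]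
    have h7 : S₁.num 7 0 = 1 := by simp [hS₁]
    have hedge : edgeExp.val S₁ = e := by
      simp [edgeExp, hs.nat (a := 6), hs.nat (a := 4), h6, h4]
    have hv : S₁.nat 3 (S₁.nat 6 0) = v := by rw [hs.nat, hs.nat, h6, hw.1]
    have hvisit : ∀ w : Fin n, Trip visitProg (S₁.writeNat 11 0 w) (30 * (p.length + 1) + 50)
        fun S' => Same [11, 12, 13] [7] S S' ∧ ActionRep S' (dfsVisit β u s k p v w) := by
      intro w
      have hs' : Same [11, 12, 13] [7] S (S₁.writeNat 11 0 w) := hs.writeNat _ _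
      refine (visitProg_spec (hctx.congr hs') (hw.congr fun i => hs'.nat i)
        ((hs'.nat 0).trans h6) (by simp) (by simp [h13]) (by simp [h7])).mono le_rfl
        fun S' h => ⟨hs'.trans h.1, h.2⟩
    unfold dfsAction edgeOther
    refine Trip.ite (fun hb => ?_) fun hb => ?_
    · simp only [Test.holds, NatExp.val, NatExp.val_reg, hedge, hv, hs.nat (a := 1),
        hctx.fst_eq e he, Fin.val_inj] at hb
      rw [if_pos hb]
      refine (Trip.seq (Trip.letNat (Q := fun S' => S' = S₁.writeNat 11 0 E[e].2) ?_)
        (T₂ := 30 * (p.length + 1) + 50) ?_).mono (by simp only [edgeExp, NatExp.cost, NatExp.cost_reg]; omega) fun _ h => h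
      · simp only [NatExp.val, hedge, hs.nat (a := 2), hctx.snd_eq e he]
      · rintro _ rfl
        exact hvisit _
    simp only [Test.holds, NatExp.val, NatExp.val_reg, hedge, hv, hs.nat (a := 1),
        hctx.fst_eq e he, Fin.val_inj] at hb
    rw [if_neg hb]
    refine Trip.ite (fun hb => ?_) fun hb => ?_
    · simp only [Test.holds, NatExp.val, NatExp.val_reg, hedge, hv, hs.nat (a := 2),
        hctx.snd_eq e he, Fin.val_inj] at hb
      rw [if_pos hb]
      refine (Trip.seq (Trip.letNat (Q := fun S' => S' = S₁.writeNat 11 0 E[e].1) ?_)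
        (T₂ := 30 * (p.length + 1) + 50) ?_).mono (by simp only [edgeExp, NatExp.cost, NatExp.cost_reg]; omega) fun _ h => h
      · simp only [NatExp.val, hedge, hs.nat (a := 1), hctx.fst_eq e he]
      · rintro _ rfl
        exact hvisit _
    · simp only [Test.holds, NatExp.val, NatExp.val_reg, hedge, hv, hs.nat (a := 2),
        hctx.snd_eq e he, Fin.val_inj] at hb
      rw [if_neg hb]
      exact (Trip.skip ⟨hs, h13, h7⟩).mono (by omega) fun _ h => h
  exact key.mono (by omega) fun _ h => h

end DfsProgram

/-! ### Stack operations and the loop of the traversal -/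

section DfsLoop

variable {n : ℕ}

/-- The cell of the current coefficient in the top frame. -/
def accExp : NatExp := .add (.reg 7) (.reg 14)

/-- Multiply the product in the top frame by a constant. -/
def scaleProg : Program :=
  .forTo 14 lenExp (.setNum 2 accExp (.mul (.cell 2 accExp) (.reg 7)))

theorem scaleProg_spec {k : ℕ} {S : Store} {c : ℂ} {off : ℕ} {p : PowerSeries ℂ}
    (hk : S.nat 5 0 = k) (h7 : S.num 7 0 = c) (hoff : S.nat 7 0 = off) (hp : Coeffs k S 2 off p) :
    Trip scaleProg S ((k + 2) * 30) fun S' => Same [14] [2] S S' ∧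
      (∀ l < off, S'.num 2 l = S.num 2 l) ∧ Coeffs k S' 2 off (p * PowerSeries.C c) := by
  refine (Trip.fill (a := 2) (S := S) (off := off) (N := k + 1)
    (g := fun j => PowerSeries.coeff j (p * PowerSeries.C c)) ?_).mono ?_ ?_
  · intro j hj S' hs hj' hl
    refine ⟨by simp [lenExp, hs.1, hk], fun hjk => ?_⟩
    have h1 : accExp.val S' = off + j := by simp [accExp, hs.1, hoff, hj']
    refine ⟨h1, ?_⟩
    simp only [NumExp.val, NumExp.val_reg, h1, hl]
    rw [if_neg (by omega), hp j (by omega), hs.num, h7, PowerSeries.coeff_mul_C]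
  · simp [lenExp, accExp]
  · rintro S' ⟨hs, hl⟩
    refine ⟨hs, fun l hlt => by rw [hl, if_neg (by omega)], fun j hj => ?_⟩
    rw [hl, if_pos (by omega), Nat.add_sub_cancel_left]

/-- Put a new frame at the vertex in the cell `11` on top of the stack. -/
def initProg : Program :=
  .seq (.setNat 3 (.reg 6) (.reg 11)) (.seq (.setNat 4 (.reg 6) (.const 0))
    (.seq (.forTo 14 lenExp (.setNum 2 accExp (.const 0)))
      (.setNum 2 (.add (.reg 7) (.const 1)) (.const 1))))

theorem initProg_spec {k : ℕ} {S : Store} (hk : S.nat 5 0 = k) {w : Fin n}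
    {fs : List (Frame n)} (hfs : StackRep k S fs) (h6 : S.nat 6 0 = fs.length)
    (h7 : S.nat 7 0 = fs.length * (k + 1)) (h11 : S.nat 11 0 = w) :
    Trip initProg S ((k + 2) * 30 + 20) fun S' => Same [3, 4, 14] [2] S S' ∧
      StackRep k S' (⟨w, 0, PowerSeries.X⟩ :: fs) := by
  have key : Trip initProg S (5 + (4 + ((k + 2) * 30 + 6))) fun S' => Same [3, 4, 14] [2] S S' ∧
      StackRep k S' (⟨w, 0, PowerSeries.X⟩ :: fs) := by
    refine Trip.seq (Trip.setNat (Q := fun S' => S' = S.writeNat 3 fs.length w)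
      (by simp [h6, h11])) ?_
    rintro _ rfl
    refine Trip.seq (Trip.setNat (Q := fun S' => S' = (S.writeNat 3 fs.length w).writeNat 4 fs.length 0)
      (by simp [h6])) ?_
    rintro _ rfl
    set S₁ := (S.writeNat 3 fs.length w).writeNat 4 fs.length 0 with hS₁
    have hs₁ : Same [3, 4, 14] [2] S S₁ := ((Same.refl _ _ _).writeNat _ _).writeNat _ _
    refine Trip.seq ((Trip.fill (a := 2) (S := S₁) (off := fs.length * (k + 1)) (N := k + 1)
      (g := fun _ => 0) ?_).mono (by simp [lenExp, accExp]) fun _ h => h) ?_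
    · intro j hj S' hs hj' hl
      have hs' := hs₁.trans hs (ns'' := [3, 4, 14]) (ms'' := [2])
      refine ⟨by simp [lenExp, hs'.nat (a := 5), hk], fun _ => ⟨?_, by simp⟩⟩
      simp [accExp, hs'.nat (a := 7), h7, hj']
    · rintro S₂ ⟨hs, hl⟩
      have hs' := hs₁.trans hs (ns'' := [3, 4, 14]) (ms'' := [2])
      refine (Trip.setNum ?_).mono (T' := 6) (by simp) fun _ h => h
      have hidx : NatExp.val S₂ (.add (.reg 7) (.const 1)) = fs.length * (k + 1) + 1 := by
        simp [hs'.nat (a := 7), h7]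
      rw [hidx]
      refine ⟨hs'.writeNum _ _, ?_, ?_, ?_, ?_⟩
      · simp only [Store.writeNum_nat, hs.nat (a := 3)]
        simp [hS₁]
      · simp only [Store.writeNum_nat, hs.nat (a := 4)]
        simp [hS₁]
      · intro j hj
        simp only [Store.writeNum_num, true_and, NumExp.val, hl, PowerSeries.coeff_X]
        by_cases h1 : j = 1
        · subst h1; simp
        · rw [if_neg (by omega), if_pos (by omega), if_neg h1]
      · refine hfs.congr (fun i hi => ?_) (fun i hi => ?_) fun i hi => ?_
        · simp only [Store.writeNum_nat, hs.nat (a := 3)]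
          simp [hS₁, hi.ne]
        · simp only [Store.writeNum_nat, hs.nat (a := 4)]
          simp [hS₁, hi.ne]
        · simp only [Store.writeNum_num, true_and, hl]
          rw [if_neg (by omega), if_neg (by omega)]
          simp [hS₁]
  exact key.mono (by omega) fun _ h => h

/-- Move to the next level and put a new frame there. -/
def pushProg : Program :=
  .seq (.letNat 6 (.add (.reg 6) (.const 1))) (.seq (.letNat 7 (.add (.reg 7) lenExp)) initProg)

/-- Process the current edge of the top frame. -/
def edgeProg : Program :=
  .seq actionProg (.seq (.setNat 4 (.reg 6) (.add edgeExp (.const 1)))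
    (.ite (.natEq (.reg 13) (.const 0)) scaleProg pushProg))

/-- Remove the top frame and multiply its contribution to the frame below it. -/
def popProg : Program :=
  .seq (.letNat 6 (.sub (.reg 6) (.const 1))) (.seq (.letNat 7 (.sub (.reg 7) lenExp))
    (.seq (.forTo 14 lenExp (.setNum 5 (.reg 14) (.cell 2 accExp)))
    (.seq (.forTo 14 lenExp (.setNum 3 (.reg 14) (.mul (.reg 0) (.cell 2 (.add accExp lenExp)))))
    (.seq (.forTo 14 lenExp (.setNum 4 (.reg 14) (.cell 2 (.add accExp lenExp))))
    (.seq (.letNum 3 (.add (.reg 3) (.const 1)))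
    (.seq (.letNum 4 (.add (.reg 4) (.reg 0)))
    (.seq mulDivProg (.forTo 14 lenExp (.setNum 2 accExp (.cell 6 (.reg 14)))))))))))

/-- The memory during the traversal. -/
structure DfsRep (k : ℕ) (S₀ : Store) (st : List (Frame n)) (S : Store) : Prop where
  same : Same [3, 4, 6, 7, 11, 12, 13, 14, 15] [2, 3, 4, 5, 6, 7, 8] S₀ S
  stack : StackRep k S st
  depth : S.nat 6 0 + 1 = st.length
  base : S.nat 7 0 = S.nat 6 0 * (k + 1)

theorem edgeProg_spec {E : List (Fin n × Fin n)} {β : ℝ} {u : Fin n} {s : Bool} {k : ℕ}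
    {S₀ S : Store} (hctx : DfsCtx E β u s k S₀) {f : Frame n} {fs : List (Frame n)}
    (hrep : DfsRep k S₀ (f :: fs) S) (he : f.e < E.length) :
    Trip edgeProg S (30 * (fs.length + 1) + 30 * (k + 2) + 200)
      (DfsRep k S₀ (dfsStep E β u s k (f :: fs))) := by
  have h6 : S.nat 6 0 = fs.length := by have := hrep.depth; simpa using this
  have hw : WalkRep S (f.v :: fs.map Frame.v) := hrep.stack.walkRep
  have hctx' := hctx.congr hrep.same
  have key : Trip edgeProg S ((30 * (fs.length + 1) + 100) + (8 + (4 + (30 * (k + 2) + 50))))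
      (DfsRep k S₀ (dfsStep E β u s k (f :: fs))) := by
    refine Trip.seq ((actionProg_spec hctx' hw (by simpa using h6) (e := f.e)
      (by simpa using hrep.stack.2.1) he).mono (by simp) fun _ h => h) ?_
    rintro S₁ ⟨hs₁, hact⟩
    have h6₁ : S₁.nat 6 0 = fs.length := (hs₁.nat 0).trans h6
    have h4₁ : S₁.nat 4 fs.length = f.e := (hs₁.nat _).trans hrep.stack.2.1
    -- The edge index is advanced before the action is carried out, so that the frame resumes at the
    -- next edge when a child returns.
    refine Trip.seq (Trip.setNat (Q := fun S' => S' = S₁.writeNat 4 fs.length (f.e + 1))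
      (by simp [edgeExp, h6₁, h4₁])) ?_
    rintro _ rfl
    set S₂ := S₁.writeNat 4 fs.length (f.e + 1) with hS₂
    have hs₂ : Same [4, 11, 12, 13] [7] S S₂ :=
      (hs₁.trans (Same.refl [] [] _)).writeNat _ _
    have h13 : S₂.nat 13 0 = S₁.nat 13 0 := by simp [hS₂]
    have h6₂ : S₂.nat 6 0 = fs.length := (hs₂.nat 0).trans h6
    have h7₂ : S₂.nat 7 0 = fs.length * (k + 1) := by rw [hs₂.nat, hrep.base, h6]
    have hk₂ : S₂.nat 5 0 = k := (hs₂.nat 0).trans hctx'.k_eq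
    have hfs₂ : StackRep k S₂ fs := hrep.stack.2.2.2.congr (fun i _ => hs₂.nat i)
      (fun i hi => by
        simp only [hS₂, Store.writeNat_nat]; rw [if_neg (by omega)]; exact hs₁.nat i) (fun i _ => hs₂.num i)
    have hacc₂ : Coeffs k S₂ 2 (fs.length * (k + 1)) f.acc := fun j hj =>
      (hs₂.num _).trans (hrep.stack.2.2.1 j hj)
    have h3₂ : S₂.nat 3 fs.length = f.v := (hs₂.nat _).trans hrep.stack.1
    have h4₂ : S₂.nat 4 fs.length = f.e + 1 := by simp [hS₂]
    have hs₀ := hrep.same.trans hs₂ (ns'' := [3, 4, 6, 7, 11, 12, 13, 14, 15])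
      (ms'' := [2, 3, 4, 5, 6, 7, 8])
    simp only [dfsStep, List.getElem?_eq_getElem he]
    cases hv : dfsAction β u s k (fs.map Frame.v) f.v E[f.e] with
    | inl c =>
      rw [hv] at hact
      have h7 : S₂.num 7 0 = c := by simp [hS₂, hact.2]
      refine Trip.ite (fun _ => ?_) fun hb => ?_
      · refine (scaleProg_spec hk₂ h7 h7₂ hacc₂).mono (by omega) ?_
        rintro S₃ ⟨hs₃, hlow, hacc⟩
        refine ⟨hs₀.trans hs₃, ⟨?_, ?_, hacc, hfs₂.congr (fun i _ => hs₃.nat i)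
          (fun i _ => hs₃.nat i) hlow⟩, ?_, ?_⟩
        · rw [hs₃.nat, h3₂]
        · rw [hs₃.nat, h4₂]
        · rw [hs₃.nat, h6₂]; simp
        · rw [hs₃.nat, hs₃.nat, h6₂, h7₂]
      · exact absurd (by simpa [h13] using hact.1) hb
    | inr w =>
      rw [hv] at hact
      refine Trip.ite (fun hb => ?_) fun _ => ?_
      · exact absurd (hb.symm.trans (h13.trans hact.1)) (by simp)
      · have h11₂ : S₂.nat 11 0 = w := by simp [hS₂, hact.2]
        refine Trip.mono (T := 6 + (9 + ((k + 2) * 30 + 20))) ?_ (by omega) fun _ h => h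
        refine Trip.seq (Trip.letNat (Q := fun S' => S' = S₂.writeNat 6 0 (fs.length + 1))
          (by simp [h6₂])) ?_
        rintro _ rfl
        refine Trip.seq (Trip.letNat (Q := fun S' => S' =
          (S₂.writeNat 6 0 (fs.length + 1)).writeNat 7 0 ((fs.length + 1) * (k + 1)))
          (by simp [lenExp, h7₂, hk₂, Nat.add_mul])) ?_
        rintro _ rfl
        set S₃ := (S₂.writeNat 6 0 (fs.length + 1)).writeNat 7 0 ((fs.length + 1) * (k + 1)) with hS₃
        have hs₃ : Same [6, 7] [] S₂ S₃ := ((Same.refl _ _ _).writeNat _ _).writeNat _ _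
        have hst : StackRep k S₃ (⟨f.v, f.e + 1, f.acc⟩ :: fs) :=
          StackRep.congr (S := S₂) ⟨h3₂, h4₂, hacc₂, hfs₂⟩ (fun i _ => hs₃.nat i)
            (fun i _ => hs₃.nat i) fun i _ => hs₃.num i
        refine (initProg_spec (w := w) ((hs₃.nat 0).trans hk₂) hst (by simp [hS₃])
          (by simp [hS₃]) ((hs₃.nat 0).trans h11₂)).mono le_rfl ?_
        rintro S₄ ⟨hs₄, hst₄⟩
        refine ⟨(hs₀.trans hs₃ (ns'' := [3, 4, 6, 7, 11, 12, 13, 14, 15])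
          (ms'' := [2, 3, 4, 5, 6, 7, 8])).trans hs₄, hst₄, ?_, ?_⟩
        · rw [hs₄.nat]; simp [hS₃]
        · rw [hs₄.nat, hs₄.nat]; simp [hS₃]
  exact key.mono (by omega) fun _ h => h

/-- After the height has been lowered the coefficients of the finished frame still lie directly
above those of the new top, at a distance of `k + 1` cells. The vanishing constant coefficient of
the finished frame makes the denominator invertible. -/
theorem popProg_spec {E : List (Fin n × Fin n)} {β : ℝ} (hβ : β ≠ 0) {u : Fin n} {s : Bool} {k : ℕ}
    {S₀ S : Store} (hctx : DfsCtx E β u s k S₀) {f g : Frame n} {gs : List (Frame n)}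
    (hf0 : PowerSeries.constantCoeff f.acc = 0) (hrep : DfsRep k S₀ (f :: g :: gs) S) :
    Trip popProg S (1000 * (k + 1) ^ 2)
      (DfsRep k S₀ (⟨g.v, g.e, g.acc * edgeFactor β f.acc⟩ :: gs)) := by
  have hb : (β : ℂ) ≠ 0 := by exact_mod_cast hβ
  have h6 : S.nat 6 0 = gs.length + 1 := by have := hrep.depth; simpa using this
  have hctx' := hctx.congr hrep.same
  have h7 : S.nat 7 0 = gs.length * (k + 1) + (k + 1) := by rw [hrep.base, h6, Nat.add_mul, one_mul]
  have hF : Coeffs k S 2 (gs.length * (k + 1) + (k + 1)) f.acc := by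
    have := hrep.stack.2.2.1
    rwa [List.length_cons, Nat.add_mul, one_mul] at this
  have hG : Coeffs k S 2 (gs.length * (k + 1)) g.acc := hrep.stack.2.2.2.2.2.1
  have hlen : lenExp.cost = 4 := rfl
  have hacc : accExp.cost = 5 := rfl
  have key : Trip popProg S (6 + (9 + ((k + 2) * 40 + ((k + 2) * 40 + ((k + 2) * 40 + (6 + (7 +
      (500 * (k + 1) ^ 2 + (k + 2) * 40))))))))
      (DfsRep k S₀ (⟨g.v, g.e, g.acc * edgeFactor β f.acc⟩ :: gs)) := by
    refine Trip.seq (Trip.letNat (Q := fun S' => S' = S.writeNat 6 0 gs.length) (by simp [h6])) ?_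
    rintro _ rfl
    refine Trip.seq (Trip.letNat (Q := fun S' => S' =
      (S.writeNat 6 0 gs.length).writeNat 7 0 (gs.length * (k + 1)))
      (by simp [lenExp, h7, hctx'.k_eq])) ?_
    rintro _ rfl
    set S₁ := (S.writeNat 6 0 gs.length).writeNat 7 0 (gs.length * (k + 1)) with hS₁
    have hs₁ : Same [6, 7] [] S S₁ := ((Same.refl _ _ _).writeNat _ _).writeNat _ _
    have h6₁ : S₁.nat 6 0 = gs.length := by simp [hS₁]
    have h7₁ : S₁.nat 7 0 = gs.length * (k + 1) := by simp [hS₁]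
    have hk₁ : S₁.nat 5 0 = k := (hs₁.nat 0).trans hctx'.k_eq
    have hβ₁ : S₁.num 0 0 = β := (hs₁.num 0).trans hctx'.beta_eq
    have hF₁ : Coeffs k S₁ 2 (gs.length * (k + 1) + (k + 1)) f.acc := fun j hj =>
      (hs₁.num _).trans (hF j hj)
    have hG₁ : Coeffs k S₁ 2 (gs.length * (k + 1)) g.acc := fun j hj =>
      (hs₁.num _).trans (hG j hj)
    refine Trip.seq ((Trip.fill (a := 5) (S := S₁) (off := 0) (N := k + 1)
      (g := fun j => PowerSeries.coeff j g.acc) ?_).mono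
      (by simp [hlen, hacc]) fun _ h => h) ?_
    · intro j hj S' hs hj' hl
      refine ⟨by simp [lenExp, hs.1, hk₁], fun hjk => ⟨by simp [hj'], ?_⟩⟩
      have h1 : accExp.val S' = gs.length * (k + 1) + j := by simp [accExp, hs.1, h7₁, hj']
      simp only [NumExp.val, h1, hs.num (a := 2), hG₁ j (by omega)]
    rintro S₂ ⟨hs₂, hl₂⟩
    refine Trip.seq ((Trip.fill (a := 3) (S := S₂) (off := 0) (N := k + 1)
      (g := fun j => β * PowerSeries.coeff j f.acc) ?_).mono
      (by simp [hlen, hacc]) fun _ h => h) ?_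
    · intro j hj S' hs hj' hl
      have hs' := hs₂.trans hs (ns'' := [14]) (ms'' := [3, 5])
      refine ⟨by simp [lenExp, hs'.1, hk₁], fun hjk => ⟨by simp [hj'], ?_⟩⟩
      have h1 : NatExp.val S' (.add accExp lenExp) = gs.length * (k + 1) + (k + 1) + j := by
        simp [accExp, lenExp, hs'.nat (a := 7), hs'.nat (a := 5), h7₁, hj', hk₁]; omega
      simp only [NumExp.val, NumExp.val_reg, h1, hs'.num (a := 2), hs'.num (a := 0), hβ₁,
        hF₁ j (by omega)]
    rintro S₃ ⟨hs₃, hl₃⟩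
    have hs₁₃ := hs₂.trans hs₃ (ns'' := [14]) (ms'' := [3, 5])
    refine Trip.seq ((Trip.fill (a := 4) (S := S₃) (off := 0) (N := k + 1)
      (g := fun j => PowerSeries.coeff j f.acc) ?_).mono
      (by simp [hlen, hacc]) fun _ h => h) ?_
    · intro j hj S' hs hj' hl
      have hs' := hs₁₃.trans hs (ns'' := [14]) (ms'' := [3, 4, 5])
      refine ⟨by simp [lenExp, hs'.1, hk₁], fun hjk => ⟨by simp [hj'], ?_⟩⟩
      have h1 : NatExp.val S' (.add accExp lenExp) = gs.length * (k + 1) + (k + 1) + j := by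
        simp [accExp, lenExp, hs'.nat (a := 7), hs'.nat (a := 5), h7₁, hj', hk₁]; omega
      simp only [NumExp.val, h1, hs'.num (a := 2), hF₁ j (by omega)]
    rintro S₄ ⟨hs₄, hl₄⟩
    have hs₁₄ := hs₁₃.trans hs₄ (ns'' := [14]) (ms'' := [3, 4, 5])
    refine Trip.seq (Trip.letNum (Q := fun S' => S' = S₄.writeNum 3 0 (S₄.num 3 0 + 1)) (by simp)) ?_
    rintro _ rfl
    refine Trip.seq (Trip.letNum (Q := fun S' => S' =
      (S₄.writeNum 3 0 (S₄.num 3 0 + 1)).writeNum 4 0 (S₄.num 4 0 + β))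
      (by simp [hs₁₄.num (a := 0), hβ₁])) ?_
    rintro _ rfl
    set S₅ := (S₄.writeNum 3 0 (S₄.num 3 0 + 1)).writeNum 4 0 (S₄.num 4 0 + β) with hS₅
    have hs₁₅ : Same [14] [3, 4, 5] S₁ S₅ := (hs₁₄.writeNum _ _).writeNum _ _
    have hA : Coeffs k S₅ 5 0 g.acc := fun j hj => by
      have : S₅.num 5 (0 + j) = S₂.num 5 (0 + j) := by
        simp [hS₅, hs₄.num (a := 5), hs₃.num (a := 5)]
      rw [this, hl₂, if_pos (by omega), Nat.add_sub_cancel_left]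
    have hN : Coeffs k S₅ 3 0 (PowerSeries.C (β : ℂ) * f.acc + 1) := fun j hj => by
      have h1 : ∀ j, S₄.num 3 j = S₃.num 3 j := fun j => hs₄.num j
      simp only [hS₅, Store.writeNum_num, h1, hl₃, map_add, PowerSeries.coeff_C_mul,
        PowerSeries.coeff_one, Nat.zero_add, true_and]
      by_cases h0 : j = 0
      · subst h0; simp
      · simp [h0]; omega
    have hD : Coeffs k S₅ 4 0 (f.acc + PowerSeries.C (β : ℂ)) := fun j hj => by
      simp only [hS₅, Store.writeNum_num, hl₄, map_add, PowerSeries.coeff_C, Nat.zero_add, true_and]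
      by_cases h0 : j = 0
      · subst h0; simp
      · simp [h0]; omega
    refine Trip.seq (mulDivProg_spec ((hs₁₅.nat 0).trans hk₁) hA hN hD (by simp [hf0, hb])) ?_
    rintro S₆ ⟨hs₆, hY⟩
    have hs₁₆ := hs₁₅.trans hs₆ (ns'' := [14, 15]) (ms'' := [3, 4, 5, 6, 8])
    refine (Trip.fill (a := 2) (S := S₆) (off := gs.length * (k + 1)) (N := k + 1)
      (g := fun j => PowerSeries.coeff j (g.acc * edgeFactor β f.acc)) ?_).mono
      (by simp [hlen, hacc]) ?_
    · intro j hj S' hs hj' hl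
      have hs' := hs₁₆.trans hs (ns'' := [14, 15]) (ms'' := [2, 3, 4, 5, 6, 8])
      refine ⟨by simp [lenExp, hs'.nat (a := 5), hk₁], fun hjk => ⟨?_, ?_⟩⟩
      · simp [accExp, hs'.nat (a := 7), h7₁, hj']
      · have := hY j (by omega)
        rw [Nat.zero_add] at this
        simp only [NumExp.val, NatExp.val_reg, hj', hs.num (a := 6), this, edgeFactor, mul_assoc]
    rintro S₇ ⟨hs₇, hl₇⟩
    have hs₁₇ := hs₁₆.trans hs₇ (ns'' := [14, 15]) (ms'' := [2, 3, 4, 5, 6, 8])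
    have hs' := hs₁.trans hs₁₇ (ns'' := [6, 7, 14, 15]) (ms'' := [2, 3, 4, 5, 6, 8])
    refine ⟨hrep.same.trans hs', ⟨?_, ?_, ?_, ?_⟩, ?_, ?_⟩
    · rw [hs'.nat]; exact hrep.stack.2.2.2.1
    · rw [hs'.nat]; exact hrep.stack.2.2.2.2.1
    · intro j hj
      rw [hl₇, if_pos (by omega), Nat.add_sub_cancel_left]
    · refine hrep.stack.2.2.2.2.2.2.congr (fun i _ => hs'.nat i) (fun i _ => hs'.nat i) fun i hi => ?_
      rw [hl₇, if_neg (by omega), hs₁₆.num, hs₁.num]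
    · rw [hs₁₇.nat, h6₁]; rfl
    · rw [hs₁₇.nat, hs₁₇.nat, h6₁, h7₁]
  refine key.mono ?_ fun _ h => h
  have : k + 1 ≤ (k + 1) ^ 2 := Nat.le_self_pow two_ne_zero _
  omega

/-- One step of the traversal. -/
def dfsBody : Program := .ite (.natLt edgeExp (.reg 8)) edgeProg popProg

/-- The height of the stack is at most `k`, so searching the walk costs `O(k)`, which is dominated
by the `O(k²)` of a power series division. -/
theorem dfsBody_spec {E : List (Fin n × Fin n)} {β : ℝ} (hβ : β ≠ 0) {u : Fin n} {s : Bool} {k : ℕ}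
    {S₀ S : Store} (hctx : DfsCtx E β u s k S₀) {st : List (Frame n)}
    (hrun : DfsRunning E st) (hlen : st.length ≤ k)
    (hst0 : ∀ f ∈ st, PowerSeries.constantCoeff f.acc = 0) (hrep : DfsRep k S₀ st S) :
    Trip dfsBody S (1000 * (k + 1) ^ 2 + 10) (DfsRep k S₀ (dfsStep E β u s k st)) := by
  cases st with
  | nil => exact absurd hrep.depth (by simp)
  | cons f fs =>
    have h6 : S.nat 6 0 = fs.length := by have := hrep.depth; simpa using this
    have hctx' := hctx.congr hrep.same
    have hval : edgeExp.val S = f.e := by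
      simp only [edgeExp, NatExp.val, NatExp.val_reg, h6]
      exact hrep.stack.2.1
    have hlen' : fs.length + 1 ≤ k := hlen
    refine (Trip.ite (T := 1000 * (k + 1) ^ 2) (fun hb => ?_) fun hb => ?_).mono
      (by simp [edgeExp]; omega) fun _ h => h
    · simp only [Test.holds, hval, NatExp.val_reg, hctx'.len_eq] at hb
      refine (edgeProg_spec hctx hrep hb).mono ?_ fun _ h => h
      have : k + 1 ≤ (k + 1) ^ 2 := Nat.le_self_pow two_ne_zero _
      omega
    · simp only [Test.holds, hval, NatExp.val_reg, hctx'.len_eq] at hb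
      cases fs with
      | nil => exact absurd ⟨rfl, by simpa using hb⟩ hrun
      | cons g gs =>
        have := popProg_spec hβ hctx (hst0 f (by simp)) hrep
        simpa only [dfsStep, List.getElem?_eq_none (not_lt.1 hb)] using this

/-- Compute the ratio at the vertex in the cell `11`. -/
def dfsProg : Program :=
  .seq (.letNat 6 (.const 0)) (.seq (.letNat 7 (.const 0)) (.seq initProg
    (.loop (.neg (.conj (.natEq (.reg 6) (.const 0)) (.neg (.natLt (.cell 4 (.const 0)) (.reg 8)))))
      dfsBody)))

/-- Every frame starts with the series `X` and is only multiplied afterwards. -/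
theorem constantCoeff_dfsStep {E : List (Fin n × Fin n)} {β : ℝ} {u : Fin n} {s : Bool} {k : ℕ}
    {st : List (Frame n)} (h : ∀ f ∈ st, PowerSeries.constantCoeff f.acc = 0) :
    ∀ f ∈ dfsStep E β u s k st, PowerSeries.constantCoeff f.acc = 0 := by
  unfold dfsStep
  intro f hf
  split at hf
  · exact h f hf
  · split at hf
    · split at hf
      · exact h f hf
      · rcases List.mem_cons.1 hf with rfl | hf
        · simp [h _ (List.mem_cons_of_mem _ List.mem_cons_self)]
        · exact h f (by simp [hf])
    · split at hf
      · rcases List.mem_cons.1 hf with rfl | hf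
        · simp [h _ List.mem_cons_self]
        · exact h f (by simp [hf])
      · rcases List.mem_cons.1 hf with rfl | hf
        · simp
        · rcases List.mem_cons.1 hf with rfl | hf
          · simp [h _ List.mem_cons_self]
          · exact h f (by simp [hf])

/-- At height `k` the cutoff test replaces a descent by a constant. -/
theorem length_dfsStep {E : List (Fin n × Fin n)} {β : ℝ} {u : Fin n} {s : Bool} {k : ℕ}
    {st : List (Frame n)} (h : st.length ≤ k) : (dfsStep E β u s k st).length ≤ k := by
  unfold dfsStep
  split
  · exact h
  · split
    · split
      · exact h
      · simp only [List.length_cons] at h ⊢; omega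
    · rename_i f fs e he
      split
      · simpa using h
      · rename_i w hw
        simp only [List.length_cons] at h ⊢
        unfold dfsAction dfsVisit at hw
        simp only [List.length_map] at hw
        split at hw
        · cases hw
        · split_ifs at hw
          omega

/-- The loop simulates the abstract traversal step by step, so its time is the number of steps times
`O(k²)`. The last frame is never removed, and its coefficients at offset `0` are the result. -/
theorem dfsProg_spec {H : SimpleGraph (Fin n)} {E : List (Fin n × Fin n)} (hE : IsEdgeList H E)
    {Δ : ℕ} (hΔ : ∀ v, (E.filterMap (edgeOther v)).length ≤ Δ) {β : ℝ} (hβ : β ≠ 0) {u : Fin n}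
    {s : Bool} {k : ℕ} {S : Store} (hctx : DfsCtx E β u s k S) (hk1 : 1 ≤ k) {v : Fin n}
    (hv : S.nat 11 0 = v) :
    Trip dfsProg S (2000 * (k + 1) ^ 2 * ((E.length + 1) * (Δ + 1) ^ k)) fun S' =>
      Same [3, 4, 6, 7, 11, 12, 13, 14, 15] [2, 3, 4, 5, 6, 7, 8] S S' ∧
        Coeffs k S' 2 0 (sawRatio H β u s k [v]) := by
  obtain ⟨j, rfl⟩ : ∃ j, k = j + 1 := ⟨k - 1, by omega⟩
  obtain ⟨N, hN, hsteps⟩ := exists_stepsWhile_dfsStep hE β u s (j + 1) hΔ j v [] (by simp)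
  set k := j + 1 with hk
  have key : Trip dfsProg S (3 + (3 + (((k + 2) * 30 + 20) +
      (N * (12 + (1000 * (k + 1) ^ 2 + 10)) + 12)))) fun S' =>
      Same [3, 4, 6, 7, 11, 12, 13, 14, 15] [2, 3, 4, 5, 6, 7, 8] S S' ∧
        Coeffs k S' 2 0 (sawRatio H β u s k [v]) := by
    refine Trip.seq (Trip.letNat (Q := fun S' => S' = S.writeNat 6 0 0) (by simp)) ?_
    rintro _ rfl
    refine Trip.seq (Trip.letNat (Q := fun S' => S' = (S.writeNat 6 0 0).writeNat 7 0 0)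
      (by simp)) ?_
    rintro _ rfl
    set S₁ := (S.writeNat 6 0 0).writeNat 7 0 0 with hS₁
    have hs₁ : Same [6, 7] [] S S₁ := ((Same.refl _ _ _).writeNat _ _).writeNat _ _
    refine Trip.seq (initProg_spec (w := v) (fs := []) ((hs₁.nat 0).trans hctx.k_eq) trivial
      (by simp [hS₁]) (by simp [hS₁]) ((hs₁.nat 0).trans hv)) ?_
    rintro S₂ ⟨hs₂, hst₂⟩
    have hs₁₂ := hs₁.trans hs₂ (ns'' := [3, 4, 6, 7, 11, 12, 13, 14, 15])
      (ms'' := [2, 3, 4, 5, 6, 7, 8])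
    have hrep : DfsRep k S [⟨v, 0, PowerSeries.X⟩] S₂ := ⟨hs₁₂, hst₂,
      by rw [hs₂.nat]; simp [hS₁], by rw [hs₂.nat, hs₂.nat]; simp [hS₁]⟩
    refine (Trip.loop_stepsWhile (R := fun st S' => DfsRep k S st S' ∧ st.length ≤ k ∧
      ∀ f ∈ st, PowerSeries.constantCoeff f.acc = 0) (T := 1000 * (k + 1) ^ 2 + 10)
      ?_ hsteps ?_ ⟨hrep, hk1, by simp⟩).mono ?_ ?_
    · rintro st hrun S' ⟨hrep', hlen', hst0⟩
      have hctx' := hctx.congr hrep'.same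
      refine ⟨?_, (dfsBody_spec hβ hctx hrun hlen' hst0 hrep').mono le_rfl fun S'' h =>
        ⟨h, length_dfsStep hlen', constantCoeff_dfsStep hst0⟩⟩
      simp only [Test.holds, NatExp.val, NatExp.val_reg, hctx'.len_eq]
      rintro ⟨h1, h2⟩
      have h3 : st.length = 1 := by rw [← hrep'.depth, h1]
      refine hrun ⟨h3, ?_⟩
      obtain ⟨f, rfl⟩ := List.length_eq_one_iff.1 h3
      have h4 := hrep'.stack.2.1
      rw [List.length_nil] at h4
      rw [h4] at h2
      simpa using h2
    · rintro S' ⟨hrep', -, -⟩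
      have hctx' := hctx.congr hrep'.same
      have h4 := hrep'.stack.2.1
      have h6 := hrep'.depth
      rw [List.length_nil] at h4
      simp only [Test.holds, NatExp.val, NatExp.val_reg, hctx'.len_eq, h4]
      simpa using h6
    · simp
    · rintro S' ⟨hrep', -, -⟩
      refine ⟨hrep'.same, ?_⟩
      have := hrep'.stack.2.2.1
      simpa using this
  refine key.mono ?_ fun _ h => h
  have h1 : k + 1 ≤ (k + 1) ^ 2 := Nat.le_self_pow two_ne_zero _
  calc 3 + (3 + (((k + 2) * 30 + 20) + (N * (12 + (1000 * (k + 1) ^ 2 + 10)) + 12)))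
      ≤ 2000 * (k + 1) ^ 2 * (N + 1) := by nlinarith
    _ ≤ _ := Nat.mul_le_mul_left _ hN

end DfsLoop

/-! ### The factor of a single edge -/

section EdgeTerm

/-- Fill the first coefficients of the array `a`. -/
def fillProg (a : ℕ) (e : NumExp) : Program := .forTo 14 lenExp (.setNum a (.reg 14) e)

theorem fillProg_spec {a k : ℕ} {e : NumExp} {S : Store} (hk : S.nat 5 0 = k) {p : PowerSeries ℂ}
    (h : ∀ j ≤ k, ∀ S', Same [14] [a] S S' → S'.nat 14 0 = j → e.val S' = PowerSeries.coeff j p) :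
    Trip (fillProg a e) S ((k + 2) * (e.cost + 16)) fun S' =>
      Same [14] [a] S S' ∧ Coeffs k S' a 0 p := by
  have hlen : lenExp.cost = 4 := rfl
  refine (Trip.fill (a := a) (S := S) (off := 0) (N := k + 1)
    (g := fun j => PowerSeries.coeff j p) ?_).mono ?_ ?_
  · intro j hj S' hs hj' _
    refine ⟨by simp [lenExp, hs.1, hk], fun hjk => ⟨by simp [hj'], h j (by omega) S' hs hj'⟩⟩
  · apply Nat.mul_le_mul_left
    rw [hlen, NatExp.cost_reg]
    omega
  · rintro S' ⟨hs, hl⟩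
    refine ⟨hs, fun j hj => ?_⟩
    rw [hl, if_pos (by omega)]
    simp

/-- Add `1` to the power series in the array `a`. -/
def addOneProg (a : ℕ) : Program := .letNum a (.add (.reg a) (.const 1))

theorem addOneProg_spec {a k : ℕ} {S : Store} {p : PowerSeries ℂ} (hp : Coeffs k S a 0 p) :
    Trip (addOneProg a) S 6 fun S' => Same [] [a] S S' ∧ Coeffs k S' a 0 (p + 1) := by
  refine (Trip.letNum ?_).mono (by simp) fun _ h => h
  refine ⟨(Same.refl _ _ _).writeNum _ _ (by simp), fun j hj => ?_⟩
  have := hp j hj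
  have h0 := hp 0 (Nat.zero_le _)
  rw [Nat.zero_add] at this h0 ⊢
  rw [Store.writeNum_num, map_add, PowerSeries.coeff_one]
  by_cases h : j = 0
  · subst h; simp [h0]
  · simp [h, this]

/-- Compute the series of the marginal ratio at the vertex given by the array `r` with the vertex
given by the array `p` pinned, for the edge with the index in the cell `16`. -/
def marginalProg (r p s b : ℕ) : Program :=
  .seq (.letNat 9 (.cell p (.reg 16))) (.seq (.letNat 11 (.cell r (.reg 16)))
    (.seq (.letNat 10 (.const s)) (.seq dfsProg (fillProg b (.cell 2 (.reg 14))))))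

variable {n : ℕ}

/-- The memory when the edge with index `i` is processed. -/
structure EdgeCtx (L : List (Fin n × Fin n)) (β : ℝ) (lam : ℂ) (k i : ℕ) (S : Store) : Prop where
  k_eq : S.nat 5 0 = k
  idx_eq : S.nat 16 0 = i
  len_eq : S.nat 8 0 = i + 1
  fst_eq : ∀ (i : ℕ) (h : i < L.length), S.nat 1 i = L[i].1
  snd_eq : ∀ (i : ℕ) (h : i < L.length), S.nat 2 i = L[i].2
  beta_eq : S.num 0 0 = β
  field_eq : S.num 0 1 = lam

theorem EdgeCtx.congr {L : List (Fin n × Fin n)} {β : ℝ} {lam : ℂ} {k i : ℕ} {S S' : Store}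
    (h : EdgeCtx L β lam k i S) {ns ms : List ℕ} (hS : Same ns ms S S')
    (hns : ∀ a ∈ [1, 2, 5, 8, 16], a ∉ ns := by decide) (hms : 0 ∉ ms := by decide) :
    EdgeCtx L β lam k i S' where
  k_eq := (hS.1 5 (hns _ (by simp)) 0).trans h.k_eq
  idx_eq := (hS.1 16 (hns _ (by simp)) 0).trans h.idx_eq
  len_eq := (hS.1 8 (hns _ (by simp)) 0).trans h.len_eq
  fst_eq i hi := (hS.1 1 (hns _ (by simp)) i).trans (h.fst_eq i hi)
  snd_eq i hi := (hS.1 2 (hns _ (by simp)) i).trans (h.snd_eq i hi)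
  beta_eq := (hS.2 0 hms 0).trans h.beta_eq
  field_eq := (hS.2 0 hms 1).trans h.field_eq

/-- Setting the number of edges to `i + 1` lets the traversal see the prefix graph in the unchanged
input arrays. The array `r` must not be the array `9`, where the pinned vertex is written before `r`
is read, and `b` must differ from the array `2`, from which the result is copied. -/
theorem marginalProg_spec {L : List (Fin n × Fin n)} {β : ℝ} (hβ : β ≠ 0) {lam : ℂ} {k i : ℕ}
    (hk1 : 1 ≤ k) (hi : i < L.length) {H : SimpleGraph (Fin n)}
    (hE : IsEdgeList H (L.take (i + 1))) {Δ : ℕ}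
    (hΔ : ∀ v, ((L.take (i + 1)).filterMap (edgeOther v)).length ≤ Δ) {S : Store}
    (hctx : EdgeCtx L β lam k i S) {r p b : ℕ} {u v : Fin n} (s : Bool)
    (hp : S.nat p i = u) (hv : S.nat r i = v) (hr : r ≠ 9) (hb : b ∉ [0, 2]) :
    Trip (marginalProg r p (if s = true then 1 else 0) b) S
      (3000 * (k + 1) ^ 2 * ((i + 2) * (Δ + 1) ^ k))
      fun S' => Same [3, 4, 6, 7, 9, 10, 11, 12, 13, 14, 15] (b :: [2, 3, 4, 5, 6, 7, 8]) S S' ∧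
        Coeffs k S' b 0 (sawRatio H β u s k [v]) := by
  have key : Trip (marginalProg r p (if s = true then 1 else 0) b) S
      (5 + (5 + (3 + (2000 * (k + 1) ^ 2 * (((L.take (i + 1)).length + 1) * (Δ + 1) ^ k) +
        (k + 2) * 19))))
      fun S' => Same [3, 4, 6, 7, 9, 10, 11, 12, 13, 14, 15] (b :: [2, 3, 4, 5, 6, 7, 8]) S S' ∧
        Coeffs k S' b 0 (sawRatio H β u s k [v]) := by
    refine Trip.seq (Trip.letNat (Q := fun S' => S' = S.writeNat 9 0 u)
      (by simp [hctx.idx_eq, hp])) ?_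
    rintro _ rfl
    refine Trip.seq (Trip.letNat (Q := fun S' => S' = (S.writeNat 9 0 u).writeNat 11 0 v)
      (by simp [hctx.idx_eq, hv, hr])) ?_
    rintro _ rfl
    refine Trip.seq (Trip.letNat (Q := fun S' => S' =
      ((S.writeNat 9 0 u).writeNat 11 0 v).writeNat 10 0 (if s = true then 1 else 0))
      (by simp)) ?_
    rintro _ rfl
    set S₁ := ((S.writeNat 9 0 u).writeNat 11 0 v).writeNat 10 0 (if s = true then 1 else 0)
      with hS₁
    have hs₁ : Same [9, 10, 11] [] S S₁ :=
      (((Same.refl _ _ _).writeNat _ _).writeNat _ _).writeNat _ _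
    have hctx₁ := hctx.congr hs₁
    have hd : DfsCtx (L.take (i + 1)) β u s k S₁ :=
      { k_eq := hctx₁.k_eq
        len_eq := by rw [hctx₁.len_eq, List.length_take]; omega
        pin_eq := by simp [hS₁]
        spin_eq := by simp [hS₁]
        fst_eq := fun j hj => by
          rw [List.length_take] at hj
          rw [List.getElem_take]; exact hctx₁.fst_eq j (by omega)
        snd_eq := fun j hj => by
          rw [List.length_take] at hj
          rw [List.getElem_take]; exact hctx₁.snd_eq j (by omega)
        beta_eq := hctx₁.beta_eq }
    refine Trip.seq (dfsProg_spec hE hΔ hβ hd hk1 (v := v) (by simp [hS₁])) ?_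
    rintro S₂ ⟨hs₂, hY⟩
    have hs₁₂ := hs₁.trans hs₂ (ns'' := [3, 4, 6, 7, 9, 10, 11, 12, 13, 14, 15])
      (ms'' := [2, 3, 4, 5, 6, 7, 8])
    refine (fillProg_spec (k := k) (p := sawRatio H β u s k [v])
      ((hs₂.nat 0).trans hctx₁.k_eq) ?_).mono (by simp) ?_
    · intro j hj S' hs' hj'
      have h2 : 2 ∉ [b] := by simp only [List.mem_cons, not_or, List.not_mem_nil] at hb ⊢; tauto
      have := hY j hj
      rw [Nat.zero_add] at this
      simp only [NumExp.val, NatExp.val_reg, hj', hs'.2 2 h2, this]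
    · rintro S' ⟨hs', hc⟩
      exact ⟨hs₁₂.trans hs' (List.Subset.refl _) (by decide) (List.subset_cons_self _ _)
        (by simp), hc⟩
  refine key.mono ?_ fun _ h => h
  have h1 : k + 1 ≤ (k + 1) ^ 2 := Nat.le_self_pow two_ne_zero _
  have h2 : (L.take (i + 1)).length = i + 1 := by rw [List.length_take]; omega
  have h3 : 1 ≤ (i + 2) * (Δ + 1) ^ k := Nat.mul_pos (by omega) (by positivity)
  rw [h2]
  have h4 := Nat.mul_le_mul_left ((k + 1) ^ 2) h3
  have h5 : 2000 * (k + 1) ^ 2 * ((i + 1 + 1) * (Δ + 1) ^ k) =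
    2000 * ((k + 1) ^ 2 * ((i + 2) * (Δ + 1) ^ k)) := by ring
  have h6 : 3000 * (k + 1) ^ 2 * ((i + 2) * (Δ + 1) ^ k) =
    3000 * ((k + 1) ^ 2 * ((i + 2) * (Δ + 1) ^ k)) := by ring
  rw [h5, h6]
  omega

/-- Compute `(a b + 1) / (a b + 1 + b + c)` from the series `a`, `b`, `c` in the arrays `9`, `10`,
`11`. -/
def combineProg : Program :=
  .seq (fillProg 5 (.cell 9 (.reg 14))) (.seq (fillProg 3 (.cell 10 (.reg 14)))
    (.seq (fillProg 4 (.const 0)) (.seq (addOneProg 4) (.seq mulDivProg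
    (.seq (fillProg 5 (.cell 6 (.reg 14))) (.seq (addOneProg 5)
    (.seq (fillProg 3 (.const 0)) (.seq (addOneProg 3)
    (.seq (fillProg 4 (.add (.cell 6 (.reg 14)) (.add (.cell 10 (.reg 14)) (.cell 11 (.reg 14)))))
    (.seq (addOneProg 4) mulDivProg))))))))))

/-- The division program is used twice: with denominator `1` it forms the product `a b`, and with
second factor `1` it forms the final quotient. The series `0 + 1` arise because `1` is produced by
clearing an array and adding one. -/
theorem combineProg_spec {k : ℕ} {S : Store} (hk : S.nat 5 0 = k) {a b c : PowerSeries ℂ}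
    (ha : Coeffs k S 9 0 a) (hb : Coeffs k S 10 0 b) (hc : Coeffs k S 11 0 c)
    (ha0 : PowerSeries.constantCoeff a = 0) (hb0 : PowerSeries.constantCoeff b = 0)
    (hc0 : PowerSeries.constantCoeff c = 0) :
    Trip combineProg S (2000 * (k + 1) ^ 2) fun S' => Same [14, 15] [3, 4, 5, 6, 8] S S' ∧
      Coeffs k S' 6 0 ((a * b + 1) * (a * b + 1 + b + c)⁻¹) := by
  have key : Trip combineProg S ((k + 2) * 19 + ((k + 2) * 19 + ((k + 2) * 17 + (6 +
      (500 * (k + 1) ^ 2 + ((k + 2) * 19 + (6 + ((k + 2) * 17 + (6 + ((k + 2) * 27 + (6 +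
        500 * (k + 1) ^ 2))))))))))) fun S' => Same [14, 15] [3, 4, 5, 6, 8] S S' ∧
      Coeffs k S' 6 0 ((a * b + 1) * (a * b + 1 + b + c)⁻¹) := by
    simp only [Coeffs, Nat.zero_add] at ha hb hc
    refine Trip.seq ((fillProg_spec (p := a) hk ?_).mono (by simp) fun _ h => h) ?_
    · intro j hj S' hs hj'
      simp only [NumExp.val, NatExp.val_reg, hj', hs.num (a := 9), ha j hj]
    rintro S₁ ⟨hs₁, h5₁⟩
    refine Trip.seq ((fillProg_spec (p := b) ((hs₁.nat 0).trans hk) ?_).mono (by simp)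
      fun _ h => h) ?_
    · intro j hj S' hs hj'
      simp only [NumExp.val, NatExp.val_reg, hj', hs.num (a := 10), hs₁.num (a := 10), hb j hj]
    rintro S₂ ⟨hs₂, h3₂⟩
    have hs₀₂ := hs₁.trans hs₂ (ns'' := [14, 15]) (ms'' := [3, 4, 5, 6, 8])
    refine Trip.seq ((fillProg_spec (p := 0) ((hs₀₂.nat 0).trans hk) ?_).mono (by simp)
      fun _ h => h) ?_
    · intro j hj S' hs hj'
      simp
    rintro S₃ ⟨hs₃, h4₃⟩
    refine Trip.seq (addOneProg_spec h4₃) ?_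
    rintro S₄ ⟨hs₄, h4₄⟩
    have hs₂₄ := hs₃.trans hs₄ (ns'' := [14]) (ms'' := [4])
    have hs₀₄ := hs₀₂.trans hs₂₄ (ns'' := [14, 15]) (ms'' := [3, 4, 5, 6, 8])
    refine Trip.seq (mulDivProg_spec (A := a) (N := b) (D := 0 + 1) ((hs₀₄.nat 0).trans hk)
      (fun j hj => ?_) (fun j hj => ?_) h4₄ (by simp)) ?_
    · rw [hs₂₄.num, hs₂.num]; exact h5₁ j hj
    · rw [hs₂₄.num]; exact h3₂ j hj
    rintro S₅ ⟨hs₅, h6₅⟩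
    have hs₀₅ := hs₀₄.trans hs₅ (ns'' := [14, 15]) (ms'' := [3, 4, 5, 6, 8])
    have hone : (0 + 1 : PowerSeries ℂ)⁻¹ = 1 := by simp
    rw [hone, mul_one] at h6₅
    simp only [Coeffs, Nat.zero_add] at h6₅
    refine Trip.seq ((fillProg_spec (p := a * b) ((hs₀₅.nat 0).trans hk) ?_).mono (by simp)
      fun _ h => h) ?_
    · intro j hj S' hs hj'
      simp only [NumExp.val, NatExp.val_reg, hj', hs.num (a := 6), h6₅ j hj]
    rintro S₆ ⟨hs₆, h5₆⟩
    refine Trip.seq (addOneProg_spec h5₆) ?_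
    rintro S₇ ⟨hs₇, h5₇⟩
    have hs₅₇ := hs₆.trans hs₇ (ns'' := [14]) (ms'' := [3, 5])
    have hs₀₇ := hs₀₅.trans hs₅₇ (ns'' := [14, 15]) (ms'' := [3, 4, 5, 6, 8])
    refine Trip.seq ((fillProg_spec (p := 0) ((hs₀₇.nat 0).trans hk) ?_).mono (by simp)
      fun _ h => h) ?_
    · intro j hj S' hs hj'
      simp
    rintro S₈ ⟨hs₈, h3₈⟩
    refine Trip.seq (addOneProg_spec h3₈) ?_
    rintro S₉ ⟨hs₉, h3₉⟩
    have hs₇₉ := hs₈.trans hs₉ (ns'' := [14]) (ms'' := [3])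
    have hs₅₉ := hs₅₇.trans hs₇₉ (ns'' := [14]) (ms'' := [3, 5])
    have hs₀₉ := hs₀₅.trans hs₅₉ (ns'' := [14, 15]) (ms'' := [3, 4, 5, 6, 8])
    refine Trip.seq ((fillProg_spec (p := a * b + (b + c)) ((hs₀₉.nat 0).trans hk) ?_).mono
      (by simp) fun _ h => h) ?_
    · intro j hj S' hs hj'
      simp only [NumExp.val, NatExp.val_reg, hj', hs.num (a := 6), hs₅₉.num (a := 6), h6₅ j hj,
        hs.num (a := 10), hs₀₉.num (a := 10), hs.num (a := 11), hs₀₉.num (a := 11), hb j hj,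
        hc j hj, map_add]
    rintro S₁₀ ⟨hs₁₀, h4₁₀⟩
    refine Trip.seq (addOneProg_spec h4₁₀) ?_
    rintro S₁₁ ⟨hs₁₁, h4₁₁⟩
    have hs₉₁ := hs₁₀.trans hs₁₁ (ns'' := [14]) (ms'' := [4])
    have hs₀₁ := hs₀₉.trans hs₉₁ (ns'' := [14, 15]) (ms'' := [3, 4, 5, 6, 8])
    refine (mulDivProg_spec (A := a * b + 1) (N := 0 + 1) (D := a * b + (b + c) + 1)
      ((hs₀₁.nat 0).trans hk) (fun j hj => ?_) (fun j hj => ?_) h4₁₁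
      (by simp [ha0, hb0, hc0])).mono le_rfl ?_
    · rw [hs₉₁.num, hs₇₉.num]; exact h5₇ j hj
    · rw [hs₉₁.num]; exact h3₉ j hj
    rintro S' ⟨hs', h6⟩
    refine ⟨hs₀₁.trans hs', ?_⟩
    have : a * b + (b + c) + 1 = a * b + 1 + b + c := by ring
    rwa [this, zero_add, mul_one] at h6
  refine key.mono ?_ fun _ h => h
  have : k + 1 ≤ (k + 1) ^ 2 := Nat.le_self_pow two_ne_zero _
  omega

/-- Divide the output by the value at the field of the truncated edge-deletion ratio. -/
def divideProg : Program :=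
  .seq (.letNum 12 (.const 0)) (.seq (.letNum 13 (.const 1))
    (.seq (.forTo 14 lenExp (.seq (.letNum 12 (.add (.reg 12) (.mul (.cell 6 (.reg 14)) (.reg 13))))
      (.letNum 13 (.mul (.reg 13) (.cell 0 (.const 1))))))
    (.letNum 1 (.div (.reg 1) (.sub (.const 1)
      (.mul (.sub (.const 1) (.div (.const 1) (.reg 0))) (.reg 12)))))))

/-- Truncation is linear and fixes `1`, so the program only sums the truncated series `q` at the
field and applies the affine map to the resulting number. -/
theorem eval_trunc_one_sub_C_mul (c x : ℂ) (q : PowerSeries ℂ) (k : ℕ) :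
    (PowerSeries.trunc (k + 1) (1 - PowerSeries.C c * q)).eval x =
      1 - c * ∑ j ∈ Finset.range (k + 1), PowerSeries.coeff j q * x ^ j := by
  rw [Polynomial.eval_eq_sum_range' (n := k + 1) (PowerSeries.natDegree_trunc_lt _ _)]
  have : ∀ j ∈ Finset.range (k + 1),
      (PowerSeries.trunc (k + 1) (1 - PowerSeries.C c * q)).coeff j * x ^ j =
        (if j = 0 then 1 else 0) - c * (PowerSeries.coeff j q * x ^ j) := by
    intro j hj
    rw [PowerSeries.coeff_trunc, if_pos (Finset.mem_range.1 hj), map_sub, PowerSeries.coeff_C_mul,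
      PowerSeries.coeff_one]
    split_ifs with h
    · subst h; simp
    · ring
  rw [Finset.sum_congr rfl this, Finset.sum_sub_distrib, ← Finset.mul_sum]
  simp

theorem divideProg_spec {k : ℕ} {S : Store} (hk : S.nat 5 0 = k) {β : ℝ} {lam : ℂ}
    (hβ : S.num 0 0 = β) (hlam : S.num 0 1 = lam) {q : PowerSeries ℂ} (hq : Coeffs k S 6 0 q) :
    Trip divideProg S (50 * (k + 2)) fun S' => Same [14] [1, 12, 13] S S' ∧ S'.num 1 0 =
      S.num 1 0 / (PowerSeries.trunc (k + 1)
        (1 - PowerSeries.C (1 - (β : ℂ)⁻¹) * q)).eval lam := by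
  simp only [Coeffs, Nat.zero_add] at hq
  have hlen : lenExp.cost = 4 := rfl
  have key : Trip divideProg S (3 + (3 + ((k + 2) * 31 + 16))) fun S' =>
      Same [14] [1, 12, 13] S S' ∧ S'.num 1 0 =
      S.num 1 0 / (PowerSeries.trunc (k + 1)
        (1 - PowerSeries.C (1 - (β : ℂ)⁻¹) * q)).eval lam := by
    refine Trip.seq (Trip.letNum (Q := fun S' => S' = S.writeNum 12 0 0) (by simp)) ?_
    rintro _ rfl
    refine Trip.seq (Trip.letNum (Q := fun S' => S' = (S.writeNum 12 0 0).writeNum 13 0 1)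
      (by simp)) ?_
    rintro _ rfl
    set S₁ := (S.writeNum 12 0 0).writeNum 13 0 1 with hS₁
    have hs₁ : Same [] [12, 13] S S₁ := ((Same.refl _ _ _).writeNum _ _).writeNum _ _
    refine Trip.seq ((Trip.forTo (N := k + 1) (T := 18) (I := fun i S' =>
      Same [14] [12, 13] S S' ∧ S'.num 13 0 = lam ^ i ∧
      S'.num 12 0 = ∑ j ∈ Finset.range i, PowerSeries.coeff j q * lam ^ j) ?_ ?_ ?_).mono
      (by rw [hlen]) fun _ h => h) ?_
    · exact ⟨(hs₁.trans (Same.refl [] [] _)).writeNat _ _, by simp [hS₁], by simp [hS₁]⟩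
    · intro i _ S' hS' _
      simp [lenExp, hS'.1.nat (a := 5), hk]
    · intro i hi S' hS' hi'
      refine Trip.mono (T := 11 + 7) ?_ (by omega) fun _ h => h
      refine Trip.seq (Trip.letNum (Q := fun S'' => S'' =
        S'.writeNum 12 0 (S'.num 12 0 + PowerSeries.coeff i q * lam ^ i)) ?_) ?_
      · simp [hi', hS'.1.num (a := 6), hq i (by omega), hS'.2.1]
      rintro _ rfl
      refine (Trip.letNum ?_).mono (by simp) fun _ h => h
      refine ⟨by simpa using hi', ((hS'.1.writeNum _ _).writeNum _ _).writeNat _ _, ?_, ?_⟩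
      · simp [hS'.2.1, hS'.1.num (a := 0), hlam, pow_succ]
      · simp [hS'.2.2, Finset.sum_range_succ]
    · rintro S₂ ⟨hs₂, -, h12⟩
      refine (Trip.letNum ?_).mono (by simp) fun _ h => h
      refine ⟨(hs₂.trans (Same.refl [] [] _)).writeNum _ _, ?_⟩
      rw [eval_trunc_one_sub_C_mul]
      simp [hs₂.num (a := 1), hs₂.num (a := 0), h12, hβ]
  exact key.mono (by omega) fun _ h => h

/-- Process the edge with the index in the cell `16`. -/
def edgeTermProg : Program :=
  .seq (marginalProg 2 1 1 9) (.seq (marginalProg 1 2 0 10) (.seq (marginalProg 2 1 0 11)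
    (.seq combineProg divideProg)))

theorem edgeTermProg_spec {L : List (Fin n × Fin n)} {β : ℝ} (hβ : β ≠ 0) {lam : ℂ} {k i : ℕ}
    (hk1 : 1 ≤ k) (hi : i < L.length) {H : SimpleGraph (Fin n)}
    (hE : IsEdgeList H (L.take (i + 1))) {Δ : ℕ}
    (hΔ : ∀ v, ((L.take (i + 1)).filterMap (edgeOther v)).length ≤ Δ) {S : Store}
    (hctx : EdgeCtx L β lam k i S) :
    Trip edgeTermProg S (12000 * (k + 1) ^ 2 * ((i + 2) * (Δ + 1) ^ k)) fun S' =>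
      Same [3, 4, 6, 7, 9, 10, 11, 12, 13, 14, 15] [1, 2, 3, 4, 5, 6, 7, 8, 9, 10, 11, 12, 13] S S' ∧
        S'.num 1 0 = S.num 1 0 /
          (PowerSeries.trunc (k + 1) (sawEdgeRatio H β L[i].1 L[i].2 k)).eval lam := by
  set T := 3000 * (k + 1) ^ 2 * ((i + 2) * (Δ + 1) ^ k) with hT
  have key : Trip edgeTermProg S (T + (T + (T + (2000 * (k + 1) ^ 2 + 50 * (k + 2))))) fun S' =>
      Same [3, 4, 6, 7, 9, 10, 11, 12, 13, 14, 15] [1, 2, 3, 4, 5, 6, 7, 8, 9, 10, 11, 12, 13] S S' ∧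
        S'.num 1 0 = S.num 1 0 /
          (PowerSeries.trunc (k + 1) (sawEdgeRatio H β L[i].1 L[i].2 k)).eval lam := by
    -- The three marginals, in order: at `v` with `u` pinned to `+`, at `u` with `v` pinned to `-`,
    -- and at `v` with `u` pinned to `-`. They are saved in arrays that the later traversals leave
    -- alone.
    refine Trip.seq (marginalProg_spec hβ hk1 hi hE hΔ hctx true (hctx.fst_eq i hi)
      (hctx.snd_eq i hi) (by decide) (by decide)) ?_
    rintro S₁ ⟨hs₁, ha⟩
    have hctx₁ := hctx.congr hs₁
    refine Trip.seq (marginalProg_spec hβ hk1 hi hE hΔ hctx₁ false (hctx₁.snd_eq i hi)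
      (hctx₁.fst_eq i hi) (by decide) (by decide)) ?_
    rintro S₂ ⟨hs₂, hb⟩
    have hctx₂ := hctx₁.congr hs₂
    refine Trip.seq (marginalProg_spec hβ hk1 hi hE hΔ hctx₂ false (hctx₂.fst_eq i hi)
      (hctx₂.snd_eq i hi) (by decide) (by decide)) ?_
    rintro S₃ ⟨hs₃, hc⟩
    have hctx₃ := hctx₂.congr hs₃
    refine Trip.seq (combineProg_spec hctx₃.k_eq
      (a := sawRatio H β L[i].1 true k [L[i].2]) (b := sawRatio H β L[i].2 false k [L[i].1])
      (c := sawRatio H β L[i].1 false k [L[i].2]) (fun j hj => ?_) (fun j hj => ?_) hc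
      (constantCoeff_sawRatio _ _ _ _ _ _) (constantCoeff_sawRatio _ _ _ _ _ _)
      (constantCoeff_sawRatio _ _ _ _ _ _)) ?_
    · rw [hs₃.num, hs₂.num]; exact ha j hj
    · rw [hs₃.num]; exact hb j hj
    rintro S₄ ⟨hs₄, hq⟩
    have hctx₄ := hctx₃.congr hs₄
    refine (divideProg_spec hctx₄.k_eq hctx₄.beta_eq hctx₄.field_eq hq).mono le_rfl ?_
    rintro S₅ ⟨hs₅, h1⟩
    have hs₀₂ := hs₁.trans hs₂ (ns'' := [3, 4, 6, 7, 9, 10, 11, 12, 13, 14, 15])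
      (ms'' := [2, 3, 4, 5, 6, 7, 8, 9, 10])
    have hs₀₃ := hs₀₂.trans hs₃ (ns'' := [3, 4, 6, 7, 9, 10, 11, 12, 13, 14, 15])
      (ms'' := [2, 3, 4, 5, 6, 7, 8, 9, 10, 11])
    have hs₀₄ := hs₀₃.trans hs₄ (ns'' := [3, 4, 6, 7, 9, 10, 11, 12, 13, 14, 15])
      (ms'' := [2, 3, 4, 5, 6, 7, 8, 9, 10, 11])
    exact ⟨hs₀₄.trans hs₅, by rw [h1, hs₀₄.num]; rfl⟩
  refine key.mono ?_ fun _ h => h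
  have h1 : k + 1 ≤ (k + 1) ^ 2 := Nat.le_self_pow two_ne_zero _
  have h3 : 1 ≤ (i + 2) * (Δ + 1) ^ k := Nat.mul_pos (by omega) (by positivity)
  have h4 := Nat.mul_le_mul_left ((k + 1) ^ 2) h3
  have h5 : T = 3000 * ((k + 1) ^ 2 * ((i + 2) * (Δ + 1) ^ k)) := by rw [hT]; ring
  have h6 : 12000 * (k + 1) ^ 2 * ((i + 2) * (Δ + 1) ^ k) =
    12000 * ((k + 1) ^ 2 * ((i + 2) * (Δ + 1) ^ k)) := by ring
  rw [h5, h6]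
  omega

end EdgeTerm

/-! ### The truncation degree and the complete algorithm -/

theorem IsEdgeList.take {V : Type*} {G : SimpleGraph V} {L : List (V × V)} (hL : IsEdgeList G L)
    (i : ℕ) : IsEdgeList (prefixGraph L i) (L.take i) := by
  refine ⟨by rw [List.map_take]; exact hL.1.sublist (List.take_sublist _ _), fun e => ?_⟩
  induction e with
  | h x y => rw [SimpleGraph.mem_edgeSet, hL.prefixGraph_adj]

theorem IsEdgeList.length_filterMap_take_le {n : ℕ} {G : SimpleGraph (Fin n)} [DecidableRel G.Adj]
    {L : List (Fin n × Fin n)} (hL : IsEdgeList G L) (i : ℕ) (v : Fin n) :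
    ((L.take i).filterMap (edgeOther v)).length ≤ G.maxDegree := by
  classical
  rw [length_filterMap_edgeOther (hL.take i)]
  exact (SimpleGraph.degree_le_of_le (hL.prefixGraph_le i)).trans (G.degree_le_maxDegree v)

/-- The degree at which the series are truncated. -/
noncomputable def cutoff (c N m : ℕ) (ε : ℝ) : ℕ :=
  sInf {k : ℕ | (c * m : ℝ) * ((N : ℝ) / (N + 1)) ^ k ≤ ε}

/-- The rate has the form `N / (N + 1)` because the constants of a program are integers. Its powers
tend to `0`, so the infimum defining the cutoff is attained. -/
theorem mul_pow_cutoff_le (c N m : ℕ) {ε : ℝ} (hε : 0 < ε) :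
    (c * m : ℝ) * ((N : ℝ) / (N + 1)) ^ cutoff c N m ε ≤ ε := by
  refine Nat.sInf_mem (s := {k : ℕ | (c * m : ℝ) * ((N : ℝ) / (N + 1)) ^ k ≤ ε}) ?_
  have h : Filter.Tendsto (fun k : ℕ => (c * m : ℝ) * ((N : ℝ) / (N + 1)) ^ k) Filter.atTop
      (nhds ((c * m : ℝ) * 0)) :=
    (tendsto_pow_atTop_nhds_zero_of_lt_one (by positivity)
      ((div_lt_one (by positivity)).2 (by linarith))).const_mul _
  rw [mul_zero] at h
  obtain ⟨k, hk⟩ := (h.eventually (ge_mem_nhds hε)).exists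
  exact ⟨k, hk⟩

theorem lt_mul_pow_of_lt_cutoff {c N m : ℕ} {ε : ℝ} {j : ℕ} (hj : j < cutoff c N m ε) :
    ε < (c * m : ℝ) * ((N : ℝ) / (N + 1)) ^ j :=
  not_le.1 (Nat.notMem_of_lt_sInf hj)

theorem cutoff_zero (c N : ℕ) {ε : ℝ} (hε : 0 < ε) : cutoff c N 0 ε = 0 := by
  by_contra h
  have := lt_mul_pow_of_lt_cutoff (Nat.pos_of_ne_zero h)
  simp at this
  linarith

/-- For `k = 0` the left side would be `c m ≥ 1 > ε`. The traversal opens a frame for the root, so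
it requires a positive depth. -/
theorem one_le_cutoff {c N m : ℕ} (hc : 1 ≤ c) (hm : 1 ≤ m) {ε : ℝ} (hε : 0 < ε) (hε1 : ε < 1) :
    1 ≤ cutoff c N m ε := by
  by_contra h
  have h0 : cutoff c N m ε = 0 := by omega
  have := mul_pow_cutoff_le c N m hε
  rw [h0, pow_zero, mul_one] at this
  have : (1 : ℝ) ≤ c * m := by exact_mod_cast Nat.mul_pos hc hm
  linarith

/-- Compute `(1 + z) ^ n`. -/
def powerProg : Program :=
  .seq (.letNum 1 (.const 1)) (.forTo 14 (.cell 0 (.const 0))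
    (.letNum 1 (.mul (.reg 1) (.add (.const 1) (.cell 0 (.const 1))))))

theorem powerProg_spec (S : Store) :
    Trip powerProg S (30 * (S.nat 0 0 + 1)) fun S' => Same [14] [1] S S' ∧
      S'.num 1 0 = (1 + S.num 0 1) ^ S.nat 0 0 := by
  have key : Trip powerProg S (3 + (S.nat 0 0 + 1) * 20) fun S' => Same [14] [1] S S' ∧
      S'.num 1 0 = (1 + S.num 0 1) ^ S.nat 0 0 := by
    refine Trip.seq (Trip.letNum (Q := fun S' => S' = S.writeNum 1 0 1) (by simp)) ?_
    rintro _ rfl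
    refine (Trip.forTo (N := S.nat 0 0) (T := 9) (I := fun i S' => Same [14] [1] S S' ∧
      S'.num 1 0 = (1 + S.num 0 1) ^ i) ?_ ?_ ?_).mono (by simp) fun _ h => h
    · exact ⟨((Same.refl _ _ _).writeNum _ _).writeNat _ _, by simp⟩
    · intro i _ S' hS' _
      simp [hS'.1.nat (a := 0)]
    · intro i _ S' hS' hi'
      refine (Trip.letNum ?_).mono (by simp) fun _ h => h
      refine ⟨by simpa using hi', (hS'.1.writeNum _ _).writeNat _ _, ?_⟩
      simp [hS'.2, hS'.1.num (a := 0), pow_succ]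
  exact key.mono (by omega) fun _ h => h

/-- Compute `c m`. -/
def scaleSizeProg (c : ℕ) : Program :=
  .seq (.letNum 12 (.const 0)) (.forTo 14 (.cell 0 (.const 1))
    (.letNum 12 (.add (.reg 12) (.const c))))

/-- Programs cannot convert a natural number into a complex one, so `c m` is obtained by adding the
constant `c` once per edge. -/
theorem scaleSizeProg_spec (c : ℕ) (S : Store) :
    Trip (scaleSizeProg c) S (30 * (S.nat 0 1 + 1)) fun S' => Same [14] [12] S S' ∧
      S'.num 12 0 = ((c * S.nat 0 1 : ℝ) : ℂ) := by
  have key : Trip (scaleSizeProg c) S (3 + (S.nat 0 1 + 1) * 17) fun S' => Same [14] [12] S S' ∧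
      S'.num 12 0 = ((c * S.nat 0 1 : ℝ) : ℂ) := by
    refine Trip.seq (Trip.letNum (Q := fun S' => S' = S.writeNum 12 0 0) (by simp)) ?_
    rintro _ rfl
    refine (Trip.forTo (N := S.nat 0 1) (T := 6) (I := fun i S' => Same [14] [12] S S' ∧
      S'.num 12 0 = ((c * i : ℝ) : ℂ)) ?_ ?_ ?_).mono (by simp) fun _ h => h
    · exact ⟨((Same.refl _ _ _).writeNum _ _).writeNat _ _, by simp⟩
    · intro i _ S' hS' _
      simp [hS'.1.nat (a := 0)]
    · intro i _ S' hS' hi'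
      refine (Trip.letNum ?_).mono (by simp) fun _ h => h
      refine ⟨by simpa using hi', (hS'.1.writeNum _ _).writeNat _ _, ?_⟩
      simp [hS'.2, mul_add]
  exact key.mono (by omega) fun _ h => h

/-- Find the degree at which the series are truncated. -/
def cutoffProg (N : ℕ) : Program :=
  .seq (.letNat 5 (.const 0)) (.loop (.reLt (.cell 0 (.const 2)) (.reg 12))
    (.seq (.letNum 12 (.div (.mul (.reg 12) (.const N)) (.const (N + 1))))
      (.letNat 5 (.add (.reg 5) (.const 1)))))

theorem cutoffProg_spec {c N m : ℕ} {ε : ℝ} (hε : 0 < ε) {S : Store}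
    (h12 : S.num 12 0 = ((c * m : ℝ) : ℂ)) (h0 : S.num 0 2 = ε) :
    Trip (cutoffProg N) S (30 * (cutoff c N m ε + 1)) fun S' => Same [5] [12] S S' ∧
      S'.nat 5 0 = cutoff c N m ε := by
  set k := cutoff c N m ε with hk
  have key : Trip (cutoffProg N) S (3 + (k * (5 + 14) + 5)) fun S' => Same [5] [12] S S' ∧
      S'.nat 5 0 = k ∧ S'.num 12 0 = ((c * m * ((N : ℝ) / (N + 1)) ^ k : ℝ) : ℂ) := by
    refine Trip.seq (Trip.letNat (Q := fun S' => S' = S.writeNat 5 0 0) (by simp)) ?_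
    rintro _ rfl
    refine (Trip.loop (T := 14) (I := fun i S' => Same [5] [12] S S' ∧ S'.nat 5 0 = i ∧
      S'.num 12 0 = ((c * m * ((N : ℝ) / (N + 1)) ^ i : ℝ) : ℂ)) ?_ ?_ ?_).mono (by simp)
      fun _ h => h
    · intro i hi S' hS'
      refine ⟨?_, ?_⟩
      · simp only [Test.holds, NumExp.val, NatExp.val, NumExp.val_reg, hS'.2.2,
          hS'.1.num (a := 0), h0, Complex.ofReal_re]
        exact lt_mul_pow_of_lt_cutoff hi
      · refine Trip.mono (T := 8 + 6) ?_ (by omega) fun _ h => h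
        refine Trip.seq (Trip.letNum (Q := fun S'' => S'' = S'.writeNum 12 0
          ((c * m * ((N : ℝ) / (N + 1)) ^ (i + 1) : ℝ) : ℂ)) ?_) ?_
        · simp only [NumExp.val, NumExp.val_reg, hS'.2.2]
          congr 1
          push_cast
          ring
        rintro _ rfl
        refine (Trip.letNat ?_).mono (by simp) fun _ h => h
        exact ⟨(hS'.1.writeNum _ _).writeNat _ _, by simp [hS'.2.1], by simp⟩
    · intro S' hS'
      simp only [Test.holds, NumExp.val, NatExp.val, NumExp.val_reg, hS'.2.2,
        hS'.1.num (a := 0), h0, Complex.ofReal_re]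
      exact not_lt.2 (mul_pow_cutoff_le c N m hε)
    · exact ⟨(Same.refl _ _ _).writeNat _ _, by simp, by simp [h12]⟩
  exact key.mono (by omega) fun _ h => ⟨h.1, h.2.1⟩

/-- The algorithm. -/
def isingProg (c N : ℕ) : Program :=
  .seq powerProg (.seq (scaleSizeProg c) (.seq (cutoffProg N) (.forTo 16 (.cell 0 (.const 1))
    (.seq (.letNat 8 (.add (.reg 16) (.const 1))) edgeTermProg))))

theorem isingProg_spec {n : ℕ} {G : SimpleGraph (Fin n)} [DecidableRel G.Adj]
    {L : List (Fin n × Fin n)} (hL : IsEdgeList G L) {β : ℝ} (hβ : β ≠ 0) (lam : ℂ) {c : ℕ}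
    (hc : 1 ≤ c) (N : ℕ) {ε : ℝ} (hε : 0 < ε) (hε1 : ε < 1) {k : ℕ}
    (hk : k = cutoff c N L.length ε) :
    Trip (isingProg c N) (inputStore β lam L ε) (30 * (n + 1) +
      30000 * ((L.length + 1) ^ 2 * (k + 1) ^ 2 * (G.maxDegree + 1) ^ k)) fun S =>
      S.output = (1 + lam) ^ n / ∏ i : Fin L.length, (PowerSeries.trunc (k + 1)
        (sawEdgeRatio (prefixGraph L (i + 1)) β L[i].1 L[i].2 k)).eval lam := by
  set S₀ := inputStore β lam L ε with hS₀
  set m := L.length with hm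
  have hn0 : S₀.nat 0 0 = n := by simp [hS₀, inputStore]
  have hm0 : S₀.nat 0 1 = m := by simp [hS₀, inputStore, hm]
  have hfst : ∀ (i : ℕ) (h : i < L.length), S₀.nat 1 i = L[i].1 := fun i h => by
    simp [hS₀, inputStore, List.getD, h]
  have hsnd : ∀ (i : ℕ) (h : i < L.length), S₀.nat 2 i = L[i].2 := fun i h => by
    simp [hS₀, inputStore, List.getD, h]
  have hβ0 : S₀.num 0 0 = β := by simp [hS₀, inputStore]
  have hlam0 : S₀.num 0 1 = lam := by simp [hS₀, inputStore]
  have hε0 : S₀.num 0 2 = ε := by simp [hS₀, inputStore]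
  -- The factors are extended to all indices so that the loop invariant can use products over
  -- ranges.
  obtain ⟨f, hf⟩ : ∃ f : ℕ → ℂ, ∀ (i : ℕ) (h : i < L.length), f i = (PowerSeries.trunc (k + 1)
      (sawEdgeRatio (prefixGraph L (i + 1)) β L[i].1 L[i].2 k)).eval lam :=
    ⟨fun i => if h : i < L.length then (PowerSeries.trunc (k + 1)
      (sawEdgeRatio (prefixGraph L (i + 1)) β L[i].1 L[i].2 k)).eval lam else 1,
      fun i h => dif_pos h⟩
  set T := 12000 * (k + 1) ^ 2 * ((m + 1) * (G.maxDegree + 1) ^ k) with hT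
  have key : Trip (isingProg c N) S₀ (30 * (n + 1) + (30 * (m + 1) + (30 * (k + 1) +
      (m + 1) * (2 + (6 + T) + 9)))) fun S =>
      S.num 1 0 = (1 + lam) ^ n / ∏ i ∈ Finset.range m, f i := by
    have h1 := powerProg_spec S₀
    rw [hn0, hlam0] at h1
    refine Trip.seq h1 ?_
    rintro S₁ ⟨hs₁, h1₁⟩
    have h2 := scaleSizeProg_spec c S₁
    rw [hs₁.nat, hm0] at h2
    refine Trip.seq h2 ?_
    rintro S₂ ⟨hs₂, h12⟩
    have hs₀₂ := hs₁.trans hs₂ (ns'' := [14]) (ms'' := [1, 12])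
    have h3 := cutoffProg_spec (N := N) hε h12 ((hs₀₂.num 2).trans hε0)
    rw [← hk] at h3
    refine Trip.seq h3 ?_
    rintro S₃ ⟨hs₃, h5⟩
    have hs₀₃ := hs₀₂.trans hs₃ (ns'' := [5, 14]) (ms'' := [1, 12])
    refine (Trip.forTo (N := m) (T := 6 + T) (I := fun i S' =>
      Same [3, 4, 6, 7, 8, 9, 10, 11, 12, 13, 14, 15, 16]
        [1, 2, 3, 4, 5, 6, 7, 8, 9, 10, 11, 12, 13] S₃ S' ∧
      S'.num 1 0 = (1 + lam) ^ n / ∏ l ∈ Finset.range i, f l) ?_ ?_ ?_).mono (by simp)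
      fun _ h => h.2
    · refine ⟨(Same.refl _ _ _).writeNat _ _, ?_⟩
      rw [Store.writeNat_num, hs₃.num, hs₂.num, h1₁]
      simp
    · intro i _ S' hS' _
      simp only [NatExp.val]
      rw [hS'.1.nat, hs₀₃.nat, hm0]
    · intro i hi S' hS' hi'
      refine Trip.seq (Trip.letNat (Q := fun S'' => S'' = S'.writeNat 8 0 (i + 1))
        (by simp [hi'])) ?_
      rintro _ rfl
      set S'' := S'.writeNat 8 0 (i + 1) with hS''
      have hs'' := hS'.1.writeNat (a := 8) 0 (i + 1)
      rw [← hS''] at hs''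
      have hctx : EdgeCtx L β lam k i S'' :=
        { k_eq := (hs''.nat 0).trans h5
          idx_eq := by simpa [hS''] using hi'
          len_eq := by simp [hS'']
          fst_eq := fun j hj => (hs''.nat j).trans ((hs₀₃.nat j).trans (hfst j hj))
          snd_eq := fun j hj => (hs''.nat j).trans ((hs₀₃.nat j).trans (hsnd j hj))
          beta_eq := (hs''.num 0).trans ((hs₀₃.num 0).trans hβ0)
          field_eq := (hs''.num 1).trans ((hs₀₃.num 1).trans hlam0) }
      -- The loop body runs only if there is an edge, so the case `k = 0`, which occurs for the
      -- empty list, does not arise here.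
      have hk1 : 1 ≤ k := by rw [hk]; exact one_le_cutoff hc (by omega) hε hε1
      refine (edgeTermProg_spec hβ hk1 hi (hL.take (i + 1))
        (hL.length_filterMap_take_le (i + 1)) hctx).mono ?_ ?_
      · exact Nat.mul_le_mul_left _ (Nat.mul_le_mul_right _ (by omega))
      · rintro S₄ ⟨hs₄, h⟩
        refine ⟨(hs₄.nat 0).trans hctx.idx_eq, (hs''.trans hs₄).writeNat _ _, ?_⟩
        rw [Store.writeNat_num, h, hS'', Store.writeNat_num, hS'.2, Finset.prod_range_succ,
          div_div, hf i hi]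
  refine key.mono ?_ ?_
  · set P := (m + 1) ^ 2 * (k + 1) ^ 2 * (G.maxDegree + 1) ^ k with hP
    have hd : 1 ≤ (G.maxDegree + 1) ^ k := Nat.one_le_pow _ _ (by omega)
    have hp1 : m + 1 ≤ P := by
      calc m + 1 ≤ (m + 1) ^ 2 := Nat.le_self_pow two_ne_zero _
        _ = (m + 1) ^ 2 * 1 * 1 := by ring
        _ ≤ P := Nat.mul_le_mul (Nat.mul_le_mul_left _ (Nat.one_le_pow _ _ (by omega))) hd
    have hp2 : k + 1 ≤ P := by
      calc k + 1 ≤ (k + 1) ^ 2 := Nat.le_self_pow two_ne_zero _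
        _ = 1 * (k + 1) ^ 2 * 1 := by ring
        _ ≤ P := Nat.mul_le_mul (Nat.mul_le_mul_right _ (Nat.one_le_pow _ _ (by omega))) hd
    have hp3 : (m + 1) * T = 12000 * P := by rw [hT, hP]; ring
    have : (m + 1) * (2 + (6 + T) + 9) = 17 * (m + 1) + 12000 * P := by rw [← hp3]; ring
    rw [this]
    omega
  · intro S hS
    rw [Store.output, hS, Finset.prod_range]
    congr 1
    refine Finset.prod_congr rfl fun i _ => ?_
    exact hf i i.2

/-! ### Bounds for the truncation degree and the running time -/

theorem cutoff_le_mul_one_add_log {c N : ℕ} (hc : 1 ≤ c) (hN : 1 ≤ N) :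
    ∃ A : ℝ, 0 ≤ A ∧ ∀ (m : ℕ) (ε : ℝ), 0 < ε → ε < 1 →
      (cutoff c N m ε : ℝ) ≤ A * (1 + Real.log (m / ε)) := by
  have hN0 : (0 : ℝ) < N := by exact_mod_cast hN
  set r : ℝ := (N : ℝ) / (N + 1) with hr
  have hr0 : 0 < r := by positivity
  have hr1 : r < 1 := (div_lt_one (by positivity)).2 (by linarith)
  have hlog : 0 < -Real.log r := neg_pos.2 (Real.log_neg hr0 hr1)
  have hc1 : (1 : ℝ) ≤ c := by exact_mod_cast hc
  have hlc : 0 ≤ Real.log c := Real.log_nonneg hc1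
  have hA : 0 ≤ 1 + (Real.log c + 1) / -Real.log r := by positivity
  refine ⟨_, hA, fun m ε hε hε1 => ?_⟩
  rcases Nat.eq_zero_or_pos m with rfl | hm
  -- Here `Real.log (0 / ε) = 0`, so the right side is just `A`.
  · simpa [cutoff_zero c N hε] using hA
  have hm1 : (1 : ℝ) ≤ m := by exact_mod_cast hm
  have hx : 1 ≤ m / ε := (one_le_div hε).2 (by linarith)
  have hlx : 0 ≤ Real.log (m / ε) := Real.log_nonneg hx
  have hk1 := one_le_cutoff (N := N) hc hm hε hε1
  have hlt := lt_mul_pow_of_lt_cutoff (c := c) (N := N) (m := m) (ε := ε)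
    (j := cutoff c N m ε - 1) (by omega)
  set k := cutoff c N m ε with hk
  rw [← hr] at hlt
  -- By minimality the degree `k - 1` is not yet sufficient. Taking logarithms bounds `k - 1` by
  -- `(log c + log (m/ε)) / (-log r)`.
  have h1 : 1 < c * (m / ε) * r ^ (k - 1) := by
    rw [show c * (m / ε) * r ^ (k - 1) = c * m * r ^ (k - 1) / ε by ring]
    exact (one_lt_div hε).2 hlt
  have h2 := Real.log_pos h1
  rw [Real.log_mul (by positivity) (by positivity), Real.log_mul (by positivity) (by positivity),
    Real.log_pow, Nat.cast_sub hk1, Nat.cast_one] at h2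
  have h3 : (k : ℝ) - 1 ≤ (Real.log c + Real.log (m / ε)) / -Real.log r := by
    rw [le_div_iff₀ hlog]; linarith
  have h4 : (1 + (Real.log c + 1) / -Real.log r) * (1 + Real.log (m / ε)) =
      1 + (Real.log c + Real.log (m / ε)) / -Real.log r + (Real.log (m / ε) +
        (Real.log c * Real.log (m / ε) + 1) / -Real.log r) := by ring
  rw [h4]
  have : 0 ≤ (Real.log c * Real.log (m / ε) + 1) / -Real.log r := by positivity
  linarith

/-- The main term of the running time. -/
theorem sq_mul_sq_mul_pow_le {A x : ℝ} (hA : 0 ≤ A) {m D k : ℕ} (hm : 1 ≤ m) (hD : 1 ≤ D)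
    (hDm : D ≤ m) (hmx : (m : ℝ) ≤ x) (hk : (k : ℝ) ≤ A * (1 + Real.log x)) :
    ((m : ℝ) + 1) ^ 2 * (k + 1) ^ 2 * (D + 1) ^ k ≤
      4 * 2 ^ (3 * A) * x ^ (((2 + 3 * A) / Real.log 2 + 3 * A) * Real.log (D + 1)) := by
  have hm1 : (1 : ℝ) ≤ m := by exact_mod_cast hm
  have hD1 : (1 : ℝ) ≤ D := by exact_mod_cast hD
  have hDm' : (D : ℝ) ≤ m := by exact_mod_cast hDm
  have hx0 : 0 < x := by linarith
  have hl2 : 0 < Real.log 2 := Real.log_pos one_lt_two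
  have hlD : Real.log 2 ≤ Real.log (D + 1) := Real.log_le_log two_pos (by linarith)
  have h1 : ((m : ℝ) + 1) ^ 2 ≤ 4 * x ^ (2 : ℝ) := by
    rw [Real.rpow_two]; nlinarith
  -- The polynomial factor is absorbed by `k + 1 ≤ 2 ^ k ≤ (D + 1) ^ k`, which is the origin of the
  -- exponent `3 k`.
  have h2 : ((k : ℝ) + 1) ^ 2 * (D + 1) ^ k ≤ ((D : ℝ) + 1) ^ (3 * (k : ℝ)) := by
    have h3 : (k : ℝ) + 1 ≤ (D + 1) ^ k := by
      calc (k : ℝ) + 1 ≤ 2 ^ k := by exact_mod_cast Nat.lt_two_pow_self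
        _ ≤ _ := pow_le_pow_left₀ (by norm_num) (by linarith) _
    calc ((k : ℝ) + 1) ^ 2 * (D + 1) ^ k ≤ (((D : ℝ) + 1) ^ k) ^ 2 * (D + 1) ^ k := by gcongr
      _ = ((D : ℝ) + 1) ^ (3 * k) := by rw [← pow_mul, ← pow_add]; congr 1; ring
      _ = _ := by rw [← Real.rpow_natCast]; push_cast; rfl
  -- The identity `(D + 1) ^ log x = x ^ log (D + 1)` turns the logarithmic depth into a power of
  -- `x`.
  have h3 : ((D : ℝ) + 1) ^ (3 * (k : ℝ)) ≤
      (D + 1) ^ (3 * A) * x ^ (3 * A * Real.log (D + 1)) := by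
    calc ((D : ℝ) + 1) ^ (3 * (k : ℝ)) ≤ (D + 1) ^ (3 * A + Real.log x * (3 * A)) :=
          Real.rpow_le_rpow_of_exponent_le (by linarith) (by linarith)
      _ = _ := by
        rw [Real.rpow_add (by positivity)]
        congr 1
        rw [Real.rpow_def_of_pos (by positivity), Real.rpow_def_of_pos hx0]
        congr 1; ring
  have h4 : ((D : ℝ) + 1) ^ (3 * A) ≤ 2 ^ (3 * A) * x ^ (3 * A) := by
    rw [← Real.mul_rpow two_pos.le hx0.le]
    exact Real.rpow_le_rpow (by positivity) (by linarith) (by positivity)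
  have h5 : x ^ (2 : ℝ) * (x ^ (3 * A) * x ^ (3 * A * Real.log (D + 1))) ≤
      x ^ (((2 + 3 * A) / Real.log 2 + 3 * A) * Real.log (D + 1)) := by
    rw [← Real.rpow_add hx0, ← Real.rpow_add hx0]
    refine Real.rpow_le_rpow_of_exponent_le (by linarith) ?_
    -- The bounded part of the exponent is absorbed into a multiple of `log (D + 1)`, which is at
    -- least `log 2` because there is an edge.
    have : 2 + 3 * A ≤ (2 + 3 * A) / Real.log 2 * Real.log (D + 1) := by
      rw [div_mul_eq_mul_div, le_div_iff₀ hl2]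
      exact mul_le_mul_of_nonneg_left hlD (by positivity)
    linarith
  calc ((m : ℝ) + 1) ^ 2 * (k + 1) ^ 2 * (D + 1) ^ k
      = ((m : ℝ) + 1) ^ 2 * (((k : ℝ) + 1) ^ 2 * (D + 1) ^ k) := by ring
    _ ≤ 4 * x ^ (2 : ℝ) * ((2 ^ (3 * A) * x ^ (3 * A)) * x ^ (3 * A * Real.log (D + 1))) := by
        refine mul_le_mul h1 (h2.trans (h3.trans ?_)) (by positivity) (by positivity)
        gcongr
    _ = 4 * 2 ^ (3 * A) * (x ^ (2 : ℝ) * (x ^ (3 * A) * x ^ (3 * A * Real.log (D + 1)))) := by ring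
    _ ≤ _ := by gcongr

/-- The general bound has the additive `n` and a leading constant. If `D ≥ 2` and `n ≤ 2 m`, both
can be moved into the exponent, because then `x = m/ε ≥ 2` and every constant is at most a power of
`x`. -/
theorem exists_time_bound {A : ℝ} (hA : 0 ≤ A) : ∃ C : ℝ, A ≤ C ∧
    ∀ (n m D k : ℕ) (ε t : ℝ), 0 < ε → ε < 1 → (m = 0 → k = 0) → (1 ≤ m → 1 ≤ D) → D ≤ m →
      (k : ℝ) ≤ A * (1 + Real.log (m / ε)) →
      t ≤ 30 * (n + 1) + 30000 * ((m + 1) ^ 2 * (k + 1) ^ 2 * (D + 1) ^ k) →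
      (2 ≤ D → n ≤ 2 * m → t ≤ (m / ε) ^ (C * Real.log D)) ∧
        t ≤ C * (n + (m / ε) ^ (C * Real.log (D + 1))) := by
  have hl2 : 1 / 2 < Real.log 2 := by linarith [Real.log_two_gt_d9]
  set B : ℝ := (2 + 3 * A) / Real.log 2 + 3 * A with hB
  have hB0 : 0 ≤ B := by positivity
  set K : ℝ := 40000 + 120000 * 2 ^ (3 * A) + B + A with hK
  have hp : (0 : ℝ) ≤ 2 ^ (3 * A) := by positivity
  have hK0 : 40000 ≤ K := by rw [hK]; linarith
  -- The summand `6 K` absorbs the leading constant `3 K ≤ x ^ (6 K)`, the `1` absorbs `n ≤ 2 x`,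
  -- and `2 K` comes from `log (D + 1) ≤ 2 log D`. The division by `log 2` turns constants into
  -- multiples of `log D`.
  set C : ℝ := (6 * K + 1) / Real.log 2 + 2 * K with hC
  have hKC : K ≤ C := by
    have : 0 ≤ (6 * K + 1) / Real.log 2 := by positivity
    rw [hC]; linarith
  refine ⟨C, by linarith, fun n m D k ε t hε hε1 hmk hmD hDm hk ht => ?_⟩
  rcases Nat.eq_zero_or_pos m with rfl | hm
  · obtain rfl := hmk rfl
    obtain rfl : D = 0 := by omega
    refine ⟨fun h => by omega, ?_⟩
    -- Without edges the power is `0 ^ 0 = 1`, so a bound `C (n + 1)` remains, and `C ≥ 40000`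
    -- suffices for it.
    simp only [Nat.cast_zero, zero_add, Real.log_one, mul_zero, Real.rpow_zero]
    norm_num at ht
    have : (0 : ℝ) ≤ n := Nat.cast_nonneg n
    nlinarith
  have hm1 : (1 : ℝ) ≤ m := by exact_mod_cast hm
  have hD := hmD hm
  have hD1 : (1 : ℝ) ≤ D := by exact_mod_cast hD
  have hmx : (m : ℝ) ≤ m / ε := (le_div_iff₀ hε).2 (by nlinarith)
  set x : ℝ := m / ε with hx
  have hx1 : 1 ≤ x := by linarith
  have hx0 : 0 < x := by linarith
  have hlD : 0 ≤ Real.log (D + 1) := Real.log_nonneg (by linarith)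
  have hmain := sq_mul_sq_mul_pow_le hA hm hD hDm hmx hk
  rw [← hB] at hmain
  have hn : (0 : ℝ) ≤ n := Nat.cast_nonneg n
  have hbound : t ≤ K * (n + x ^ (K * Real.log (D + 1))) := by
    have h1 : x ^ (B * Real.log (D + 1)) ≤ x ^ (K * Real.log (D + 1)) :=
      Real.rpow_le_rpow_of_exponent_le hx1 (mul_le_mul_of_nonneg_right (by linarith) hlD)
    have h2 : 1 ≤ x ^ (K * Real.log (D + 1)) := Real.one_le_rpow hx1 (by positivity)
    set y := x ^ (K * Real.log (D + 1)) with hy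
    have h3 : 4 * 2 ^ (3 * A) * x ^ (B * Real.log (D + 1)) ≤ 4 * 2 ^ (3 * A) * y := by gcongr
    have h4 : K * (n + y) = K * n + (40000 * y + 120000 * 2 ^ (3 * A) * y + (B + A) * y) := by
      rw [hK]; ring
    have h5 : 0 ≤ (B + A) * y := by positivity
    have h6 : 30 * (n : ℝ) ≤ K * n := by gcongr; linarith
    rw [h4]
    linarith
  refine ⟨fun hD2 hnm => ?_, hbound.trans ?_⟩
  · have hD2' : (2 : ℝ) ≤ D := by exact_mod_cast hD2
    have hx2 : 2 ≤ x := by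
      have : (D : ℝ) ≤ m := by exact_mod_cast hDm
      linarith
    have hnx : (n : ℝ) ≤ 2 * x := by
      have : (n : ℝ) ≤ 2 * m := by exact_mod_cast hnm
      linarith
    have hlD2 : Real.log 2 ≤ Real.log D := Real.log_le_log two_pos hD2'
    have hsq : Real.log (D + 1) ≤ 2 * Real.log D := by
      have := Real.log_le_log (by linarith : (0 : ℝ) < D + 1) (by nlinarith : (D + 1 : ℝ) ≤ D ^ 2)
      rwa [Real.log_pow, Nat.cast_ofNat] at this
    set y := x ^ (K * Real.log (D + 1)) with hy
    have hy1 : 1 ≤ y := Real.one_le_rpow hx1 (by positivity)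
    have h3K : 3 * K ≤ x ^ (6 * K) := by
      calc 3 * K ≤ Real.log 2 * (6 * K) + 1 := by nlinarith
        _ ≤ Real.exp (Real.log 2 * (6 * K)) := Real.add_one_le_exp _
        _ = 2 ^ (6 * K) := (Real.rpow_def_of_pos two_pos _).symm
        _ ≤ x ^ (6 * K) := Real.rpow_le_rpow two_pos.le hx2 (by positivity)
    calc t ≤ K * (n + y) := hbound
      _ ≤ K * (2 * (x * y) + x * y) := by
        refine mul_le_mul_of_nonneg_left ?_ (by linarith)
        nlinarith
      _ = 3 * K * (x * y) := by ring
      _ ≤ x ^ (6 * K) * (x ^ (1 : ℝ) * y) := by rw [Real.rpow_one]; gcongr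
      _ = x ^ (6 * K + (1 + K * Real.log (D + 1))) := by
        rw [hy, Real.rpow_add hx0, Real.rpow_add hx0]
      _ ≤ x ^ (C * Real.log D) := by
        refine Real.rpow_le_rpow_of_exponent_le hx1 ?_
        have h1 : 6 * K + 1 ≤ (6 * K + 1) / Real.log 2 * Real.log D := by
          rw [div_mul_eq_mul_div, le_div_iff₀ (by linarith)]
          exact mul_le_mul_of_nonneg_left hlD2 (by positivity)
        have h2 : K * Real.log (D + 1) ≤ K * (2 * Real.log D) := by gcongr
        rw [hC, add_mul]
        linarith
  · have h1 : x ^ (K * Real.log (D + 1)) ≤ x ^ (C * Real.log (D + 1)) :=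
      Real.rpow_le_rpow_of_exponent_le hx1 (mul_le_mul_of_nonneg_right hKC hlD)
    have h2 : 0 ≤ x ^ (K * Real.log (D + 1)) := by positivity
    exact mul_le_mul hKC (by linarith) (by linarith) (by linarith)

/-! ### The main theorem -/

theorem mainTheorem1 (β : ℝ) (hβ : 1 < β) (lam : ℂ) (hlam : ‖lam‖ < 1) :
    ∃ (prog : Program) (C : ℝ) (k : ℕ → ℝ → ℕ),
      (∀ (m : ℕ) (ε : ℝ), 0 < ε → ε < 1 → (k m ε : ℝ) ≤ C * (1 + Real.log (m / ε))) ∧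
      ∀ (n : ℕ) (G : SimpleGraph (Fin n)) [DecidableRel G.Adj] (L : List (Fin n × Fin n)),
        IsEdgeList G L → ∀ ε : ℝ, 0 < ε → ε < 1 →
        ∃ (t : ℕ) (S : Store),
          -- on input `(G, ε)` the program halts after `t` steps
          Runs prog (inputStore β lam L ε) t S ∧
          -- its output has relative error at most `ε`
          isingZ G β lam ≠ 0 ∧
          ‖(isingZ G β lam - S.output) / isingZ G β lam‖ ≤ ε ∧
          -- the running time is `(m / ε) ^ O(log Δ)`
          (2 ≤ G.maxDegree → (∀ v, 1 ≤ G.degree v) →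
            (t : ℝ) ≤ ((G.edgeFinset.card : ℝ) / ε) ^ (C * Real.log (G.maxDegree : ℝ))) ∧
          -- the same for all graphs, with the degenerate cases included
          (t : ℝ) ≤ C * (n + ((G.edgeFinset.card : ℝ) / ε) ^
            (C * Real.log ((G.maxDegree : ℝ) + 1))) ∧
          -- the output is the telescoping product of truncated edge-deletion ratios
          S.output = (1 + lam) ^ n / ∏ i : Fin L.length,
            (taylorPoly (edgeRatio (prefixGraph L (i + 1)) β s(L[i].1, L[i].2))
              (k G.edgeFinset.card ε)).eval lam ∧
          -- the truncated series are given by the recursion on self-avoiding walk trees of depth `k`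
          ∀ i : Fin L.length,
            taylorPoly (edgeRatio (prefixGraph L (i + 1)) β s(L[i].1, L[i].2))
                (k G.edgeFinset.card ε) =
              PowerSeries.trunc (k G.edgeFinset.card ε + 1)
                (sawEdgeRatio (prefixGraph L (i + 1)) β L[i].1 L[i].2
                  (k G.edgeFinset.card ε)) := by
  obtain ⟨M, θ, hM, hθ0, hθ1, htail⟩ := exists_norm_taylorPoly_div_sub_one_le hβ hlam
  -- The cutoff has to ensure `M θ ^ k ≤ ε / (4 m)`. The integers `c ≥ 4 M` and `N` with `θ ≤ N / (N
  -- + 1)` replace the real constants, which a program cannot contain.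
  obtain ⟨c, hcM⟩ := exists_nat_ge (4 * M + 1)
  obtain ⟨N, hNθ⟩ := exists_nat_ge (1 / (1 - θ))
  have hθ' : 0 < 1 - θ := by linarith
  have hc : 1 ≤ c := by
    have : (1 : ℝ) ≤ c := by linarith
    exact_mod_cast this
  have hN : 1 ≤ N := by
    have : 0 < (N : ℝ) := lt_of_lt_of_le (by positivity) hNθ
    exact_mod_cast this
  have hθN : θ ≤ (N : ℝ) / (N + 1) := by
    rw [div_le_iff₀ hθ'] at hNθ
    rw [le_div_iff₀ (by positivity)]
    linarith
  obtain ⟨A, hA, hcut⟩ := cutoff_le_mul_one_add_log hc hN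
  obtain ⟨C, hAC, htime⟩ := exists_time_bound hA
  refine ⟨isingProg c N, C, fun m ε => cutoff c N m ε, fun m ε hε hε1 => ?_, ?_⟩
  · refine (hcut m ε hε hε1).trans (mul_le_mul_of_nonneg_right hAC ?_)
    rcases Nat.eq_zero_or_pos m with rfl | hm
    · simp
    · have hm1 : (1 : ℝ) ≤ m := by exact_mod_cast hm
      have := Real.log_nonneg ((one_le_div hε).2 (by linarith : ε ≤ m))
      linarith
  intro n G _ L hL ε hε hε1
  have hZ : isingZ G β lam ≠ 0 := isingZ_ne_zero G hβ.le hlam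
  have hm := hL.length_eq
  rw [← hm]
  set k := cutoff c N L.length ε with hk
  obtain ⟨t, S, hrun, ht, hout⟩ := isingProg_spec hL (by linarith : β ≠ 0) lam hc N hε hε1 hk
  have htrunc : ∀ i : Fin L.length,
      taylorPoly (edgeRatio (prefixGraph L (i + 1)) β s(L[i].1, L[i].2)) k =
        PowerSeries.trunc (k + 1) (sawEdgeRatio (prefixGraph L (i + 1)) β L[i].1 L[i].2 k) :=
    fun i => taylorPoly_edgeRatio _ hβ.le (hL.prefixGraph_succ_adj i.2) k
  have hout' : S.output = (1 + lam) ^ n / ∏ i : Fin L.length,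
      (taylorPoly (edgeRatio (prefixGraph L (i + 1)) β s(L[i].1, L[i].2)) k).eval lam := by
    rw [hout]
    exact congrArg _ (Finset.prod_congr rfl fun i _ => by rw [htrunc i])
  have hdeg : 1 ≤ L.length → 1 ≤ G.maxDegree := fun h => by
    have hadj : G.Adj L[0].1 L[0].2 := hL.mem_edgeSet h
    exact ((G.degree_pos_iff_exists_adj _).2 ⟨_, hadj⟩).trans_le (G.degree_le_maxDegree _)
  have hdeg' : G.maxDegree ≤ L.length := by
    rw [hm]
    exact G.maxDegree_le_of_forall_degree_le _ fun v => G.degree_le_card_edgeFinset v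
  obtain ⟨ht1, ht2⟩ := htime n L.length G.maxDegree k ε t hε hε1
    (fun h => by rw [hk, h, cutoff_zero c N hε]) hdeg hdeg' (hcut _ ε hε hε1)
    (by exact_mod_cast ht)
  refine ⟨t, S, hrun, hZ, ?_, fun h2 hiso => ht1 h2 ?_, ht2, hout', htrunc⟩
  · have hpos : ∀ i : Fin L.length,
        ‖(taylorPoly (edgeRatio (prefixGraph L (i + 1)) β s(L[i].1, L[i].2)) k).eval lam /
          edgeRatio (prefixGraph L (i + 1)) β s(L[i].1, L[i].2) lam - 1‖ ≤
            ε / (4 * L.length) := by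
      intro i
      have hm1 : (1 : ℝ) ≤ L.length := by exact_mod_cast i.pos
      refine (htail n _ _ (hL.prefixGraph_succ_adj i.2) k).trans ?_
      rw [le_div_iff₀ (by positivity)]
      calc M * θ ^ k * (4 * L.length) = 4 * M * L.length * θ ^ k := by ring
        _ ≤ c * L.length * ((N : ℝ) / (N + 1)) ^ k := by gcongr; linarith
        _ ≤ ε := mul_pow_cutoff_le c N L.length hε
    -- The factor `(1 + λ)^n` is nonzero and cancels. The output divided by the partition function
    -- is then the product of the inverses of the quotients of truncated and exact edge-deletion
    -- ratios.
    have hfrac : (isingZ G β lam - S.output) / isingZ G β lam = 1 - ∏ i : Fin L.length,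
        ((taylorPoly (edgeRatio (prefixGraph L (i + 1)) β s(L[i].1, L[i].2)) k).eval lam /
          edgeRatio (prefixGraph L (i + 1)) β s(L[i].1, L[i].2) lam)⁻¹ := by
      rw [sub_div, div_self hZ, hout', hL.isingZ_eq hβ.le hlam, Fintype.card_fin]
      have h1 : (1 + lam) ^ n ≠ 0 := pow_ne_zero _ fun h => by
        rw [eq_neg_of_add_eq_zero_right h, norm_neg, norm_one] at hlam
        exact lt_irrefl _ hlam
      rw [div_eq_mul_inv _ (∏ i, _), mul_div_mul_left _ _ h1, ← Finset.prod_inv_distrib,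
        ← Finset.prod_div_distrib]
      congr 1
      refine Finset.prod_congr rfl fun i _ => ?_
      rw [inv_div, div_inv_eq_mul, mul_comm, ← div_eq_mul_inv]
    rw [hfrac]
    exact norm_one_sub_prod_inv_le hε hε1 hpos
  -- If there are no isolated vertices, the sum of the degrees gives `n ≤ 2 m`.
  · have h3 := G.sum_degrees_eq_twice_card_edges
    rw [← hm] at h3
    rw [← h3]
    calc n = ∑ _v : Fin n, 1 := by simp
      _ ≤ _ := Finset.sum_le_sum fun v _ => hiso v
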